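/- Let $n$ be an odd prime, $\mathbb F_q$ a finite field of odd characteristic, and let $E_{a,d}: ax^2+y^2=1+dx^2y^2$ with $a,d\in\mathbb F_q\setminus\{0\}$, $a\neq d$, be a twisted Edwards curve. Its projective closure in $\mathbb P^2$ has two points at infinity, the nodes $\Omega_1=[1,0,0]$ and $\Omega_2=[0,1,0]$. Let $E_{a,d}(\mathbb F_{q^n})$ be the group of $\mathbb F_{q^n}$-rational points of the smooth projective model of the curve, with the twisted Edwards addition law $$(x_1,y_1)+(x_2,y_2)=\left(\frac{x_1y_2+x_2y_1}{1+dx_1x_2y_1y_2},\frac{y_1y_2-ax_1x_2}{1-dx_1x_2y_1y_2}\right)$$ (where the denominators do not vanish) and neutral element $\mathcal O=(0,1)$, let $\varphi$ be the $q$-power Frobenius, and let $$\mathcal T_n=\{P\in E_{a,d}(\mathbb F_{q^n}) : P+\varphi(P)+\dots+\varphi^{n-1}(P)=\mathcal O\}$$ be the trace zero subgroup. Put $\mathcal O'=(0,-1)$. The divisor of a polynomial $f(x,y)$ is taken on the projective closure of $E_{a,d}$ over $\overline{\mathbb F}_q$; its multiplicity at a point is the sum of the orders of $f$ at the points of the smooth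 model lying over that point. **(A)** For every $P\in\mathcal T_n$ there are $q_1,q_2\in\mathbb F_q[y]$ such that $q_P=q_1(y)+xq_2(y)$ satisfies 1. $\operatorname{div}(q_P)=P+\varphi(P)+\dots+\varphi^{n-1}(P)+\mathcal O'-2\Omega_1-(n-1)\Omega_2$; 2. $\max\{\deg q_1,\deg q_2\}=\frac{n-1}2$; 3. $q_1=(1+y)\hat q_1$ with $\hat q_1\in\mathbb F_q[y]$ and $\deg\hat q_1\le\frac{n-3}2$; 4. $q_2\neq0$. **(B)** There is a map $\mathcal R:\mathcal T_n\to\mathbb F_q^{n-1}\times\mathbb F_2$ of the form $$\mathcal R(P)=\left(a_0,\dots,a_{\frac{n-3}2},b_0,\dots,b_{\frac{n-3}2},b_{\frac{n-1}2}\right),\qquad b_{\frac{n-1}2}\in\{0,1\},$$ where $(1+y)\sum_i a_iy^i+x\sum_j b_jy^j$ has the divisor in 1 and $\sum_j b_jy^j$ is monic. For $P,Q\in\mathcal T_n$ one has $\mathcal R(P)=\mathcal R(Q)$ if and only if $Q=\varphi^i(P)$ for some $0\le i<n$, so every fibre of $\mathcal R$ has at most $n$ elements. The representation is optimal: there is a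 constant $B$ depending only on $n$ such that its size in bits $(n-1)\lceil\log_2q\rceil+1$ differs from $\lceil\log_2|\mathcal T_n|\rceil$ by at most $B$, for all $q$, $a$, $d$. -/

import Mathlib

open Polynomial

/-- A twisted Edwards curve `a x² + y² = 1 + d x² y²` over a field of characteristic not two,
with `a`, `d` nonzero and distinct. -/
structure TwistedEdwards (F : Type*) [Field F] where
  a : F
  d : F
  a_ne_zero : a ≠ 0
  d_ne_zero : d ≠ 0
  a_ne_d : a ≠ d
  two_ne_zero : (2 : F) ≠ 0

namespace TwistedEdwards

variable {F : Type*} [Field F] (E : TwistedEdwards F)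
  (K : Type*) [Field K] [Algebra F K]

/-- The coefficient `a`, in an extension field. -/
def aK : K := algebraMap F K E.a

/-- The coefficient `d`, in an extension field. -/
def dK : K := algebraMap F K E.d

lemma aK_ne_zero : E.aK K ≠ 0 := by simpa [aK] using E.a_ne_zero
lemma dK_ne_zero : E.dK K ≠ 0 := by simpa [dK] using E.d_ne_zero
lemma aK_ne_dK : E.aK K ≠ E.dK K := by simpa [aK, dK] using E.a_ne_d
lemma two_ne_zeroK (E : TwistedEdwards F) (K : Type*) [Field K] [Algebra F K] : (2 : K) ≠ 0 := by
  have h := (map_ne_zero (algebraMap F K)).2 E.two_ne_zero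
  rwa [map_ofNat (algebraMap F K) 2] at h

/-- The `K`-rational points of the smooth projective model of the curve, that is, of its closure
in `ℙ¹ × ℙ¹`: the affine points, the points with `x = ∞` (which lie over the singular point
`Ω₁ = [1, 0, 0]` of the projective closure in the plane) and the points with `y = ∞` (over
`Ω₂ = [0, 1, 0]`). -/
inductive Point : Type _
  | affine (x y : K) (h : E.aK K * x ^ 2 + y ^ 2 = 1 + E.dK K * x ^ 2 * y ^ 2)
  | inf₁ (y : K) (h : E.dK K * y ^ 2 = E.aK K)
  | inf₂ (x : K) (h : E.dK K * x ^ 2 = 1)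

/-- The Weierstrass model `Y² = X³ + 2(a+d) X² + (a-d)² X`. -/
def weierstrass : WeierstrassCurve F :=
  ⟨0, 2 * (E.a + E.d), 0, (E.a - E.d) ^ 2, 0⟩

/-- The Weierstrass model over an extension field. -/
abbrev weierstrassK : WeierstrassCurve.Affine K := (E.weierstrass.baseChange K).toAffine

variable {K}

lemma equation_iff (X Y : K) : (E.weierstrassK K).Equation X Y ↔
    Y ^ 2 = X ^ 3 + 2 * (E.aK K + E.dK K) * X ^ 2 + (E.aK K - E.dK K) ^ 2 * X := by
  rw [WeierstrassCurve.Affine.equation_iff]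
  simp [weierstrassK, weierstrass, WeierstrassCurve.baseChange, WeierstrassCurve.map, aK, dK,
    map_ofNat (algebraMap F K) 2]

lemma nonsingular_iff (X Y : K) : (E.weierstrassK K).Nonsingular X Y ↔
    Y ^ 2 = X ^ 3 + 2 * (E.aK K + E.dK K) * X ^ 2 + (E.aK K - E.dK K) ^ 2 * X := by
  rw [← equation_iff]
  refine ⟨fun h => h.1, fun h => ?_⟩
  refine (WeierstrassCurve.Affine.equation_iff_nonsingular_of_Δ_ne_zero ?_).1 h
  have h2 := E.two_ne_zeroK K
  have ha := E.aK_ne_zero K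
  have hd := E.dK_ne_zero K
  have had := sub_ne_zero.2 (E.aK_ne_dK K)
  have : (E.weierstrassK K).Δ = 2 ^ 8 * E.aK K * E.dK K * (E.aK K - E.dK K) ^ 4 := by
    simp [weierstrassK, weierstrass, WeierstrassCurve.baseChange, WeierstrassCurve.map, aK, dK,
      WeierstrassCurve.Δ, WeierstrassCurve.b₂, WeierstrassCurve.b₄, WeierstrassCurve.b₆,
      WeierstrassCurve.b₈, map_ofNat (algebraMap F K) 2]
    ring
  rw [this]
  simp [h2, ha, hd, had]


lemma one_sub_ne_zero {x y : K} (h : E.aK K * x ^ 2 + y ^ 2 = 1 + E.dK K * x ^ 2 * y ^ 2)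
    (hx : x ≠ 0) : 1 - y ≠ 0 := by
  intro hy
  obtain rfl : y = 1 := by linear_combination -hy
  exact mul_ne_zero (sub_ne_zero.2 (E.aK_ne_dK K)) (pow_ne_zero 2 hx) (by linear_combination h)

lemma affine_nonsingular {x y : K} (h : E.aK K * x ^ 2 + y ^ 2 = 1 + E.dK K * x ^ 2 * y ^ 2)
    (hx : x ≠ 0) : (E.weierstrassK K).Nonsingular ((E.aK K - E.dK K) * (1 + y) / (1 - y))
      (2 * ((E.aK K - E.dK K) * (1 + y) / (1 - y)) / x) := by
  have hy := E.one_sub_ne_zero h hx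
  have ha : E.aK K = (1 + E.dK K * x ^ 2 * y ^ 2 - y ^ 2) / x ^ 2 := by
    field_simp; linear_combination h
  rw [nonsingular_iff, ha]
  field_simp
  ring

open scoped Classical in
/-- The birational equivalence
`(x, y) ↦ ((a - d) (1 + y) / (1 - y), 2 (a - d) (1 + y) / ((1 - y) x))`, extended to all points of
the smooth model. It sends `(0, 1)` to the neutral element and `(0, -1)` to `(0, 0)`. -/
noncomputable def toWeierstrass : E.Point K → (E.weierstrassK K).Point
  | .affine x y h =>
      if hx : x = 0 then
        if y = 1 then 0 else .some 0 0 ((E.nonsingular_iff 0 0).2 (by ring))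
      else
        .some ((E.aK K - E.dK K) * (1 + y) / (1 - y))
          (2 * ((E.aK K - E.dK K) * (1 + y) / (1 - y)) / x) (E.affine_nonsingular h hx)
  | .inf₁ y h =>
      .some (-E.dK K * (1 + y) ^ 2) 0 <| (E.nonsingular_iff _ _).2 <| by
        rw [← h]; ring
  | .inf₂ x h =>
      .some (E.dK K - E.aK K) (2 * (E.dK K - E.aK K) / x) <| (E.nonsingular_iff _ _).2 <| by
        have hx : x ≠ 0 := by rintro rfl; simp at h
        field_simp
        linear_combination (-4) * (E.dK K - E.aK K) ^ 2 * h

lemma toWeierstrass_affine {x y X Y : K}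
    (h : E.aK K * x ^ 2 + y ^ 2 = 1 + E.dK K * x ^ 2 * y ^ 2)
    (hW : (E.weierstrassK K).Nonsingular X Y)
    (hX : X * (1 - y) = (E.aK K - E.dK K) * (1 + y)) (hY : Y * x = 2 * X) :
    E.toWeierstrass (.affine x y h) = .some X Y hW := by
  have h2 := E.two_ne_zeroK K
  have had := sub_ne_zero.2 (E.aK_ne_dK K)
  by_cases hx : x = 0
  · subst hx
    have hX0 : X = 0 := by simpa [h2] using hY.symm
    subst hX0
    have hY0 : Y = 0 := by simpa using (E.nonsingular_iff _ _).1 hW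
    subst hY0
    have hy : 1 + y = 0 := by simpa [had] using hX.symm
    have hy1 : y ≠ 1 := by rintro rfl; exact h2 (by linear_combination hy)
    simp [toWeierstrass, hy1]
  · have hy := E.one_sub_ne_zero h hx
    have hX' : X = (E.aK K - E.dK K) * (1 + y) / (1 - y) := by field_simp; exact hX
    have hY' : Y = 2 * X / x := by field_simp; exact hY
    subst hY' hX'
    simp [toWeierstrass, hx]

lemma toWeierstrass_eq_zero (P : E.Point K) :
    E.toWeierstrass P = 0 ↔ P = .affine 0 1 (by ring) := by
  cases P with
  | affine x y h =>
    by_cases hx : x = 0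
    · by_cases hy : y = 1
      · simp [toWeierstrass, hx, hy]
      · simp [toWeierstrass, hx, hy]
    · simp [toWeierstrass, hx]
  | inf₁ y h => simp [toWeierstrass]
  | inf₂ x h => simp [toWeierstrass]

lemma affine_rel {x y X Y : K}
    {h : E.aK K * x ^ 2 + y ^ 2 = 1 + E.dK K * x ^ 2 * y ^ 2}
    {hW : (E.weierstrassK K).Nonsingular X Y}
    (H : E.toWeierstrass (.affine x y h) = .some X Y hW) :
    X * (1 - y) = (E.aK K - E.dK K) * (1 + y) ∧ Y * x = 2 * X ∧ (Y = 0 → x = 0) := by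
  have h2 := E.two_ne_zeroK K
  have had := sub_ne_zero.2 (E.aK_ne_dK K)
  by_cases hx : x = 0
  · subst hx
    by_cases hy : y = 1
    · simp [toWeierstrass, hy] at H
    · simp [toWeierstrass, hy] at H
      obtain ⟨rfl, rfl⟩ := H
      have hy' : 1 + y = 0 := by
        have : (1 + y) * (y - 1) = 0 := by linear_combination h
        exact (mul_eq_zero.1 this).resolve_right (sub_ne_zero.2 hy)
      simp [hy']
  · have hy := E.one_sub_ne_zero h hx
    simp [toWeierstrass, hx] at H
    obtain ⟨rfl, rfl⟩ := H
    refine ⟨by field_simp, by field_simp, ?_⟩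
    intro h0
    exfalso
    have hy1 : 1 + y = 0 := by simpa [had, h2, hx, hy] using h0
    obtain rfl : y = -1 := by linear_combination hy1
    exact mul_ne_zero had (pow_ne_zero 2 hx) (by linear_combination h)

lemma toWeierstrass_injective : Function.Injective (E.toWeierstrass (K := K)) := by
  have h2 := E.two_ne_zeroK K
  have had := sub_ne_zero.2 (E.aK_ne_dK K)
  have hdd := E.dK_ne_zero K
  intro P Q H
  rcases hQ : E.toWeierstrass Q with _ | ⟨X, Y, hW⟩
  · have e1 := (E.toWeierstrass_eq_zero Q).1 hQ
    have e2 := (E.toWeierstrass_eq_zero P).1 (H.trans hQ)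
    rw [e1, e2]
  rw [hQ] at H
  have key : ∀ {y y' : K} (_ : X * (1 - y) = (E.aK K - E.dK K) * (1 + y))
      (_ : X * (1 - y') = (E.aK K - E.dK K) * (1 + y')), y = y' := by
    intro y y' h1 h3
    have : (y - y') * (X + (E.aK K - E.dK K)) = 0 := by linear_combination h3 - h1
    rcases mul_eq_zero.1 this with h | h
    · exact sub_eq_zero.1 h
    · exact absurd (by linear_combination -h1 + (1 - y) * h) (mul_ne_zero h2 had)
  have r1 : ∀ {y : K} {h : E.dK K * y ^ 2 = E.aK K},
      E.toWeierstrass (.inf₁ y h) = .some X Y hW →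
      X * (1 - y) = (E.aK K - E.dK K) * (1 + y) ∧ Y = 0 ∧ X ≠ 0 := by
    intro y h e
    simp only [toWeierstrass, WeierstrassCurve.Affine.Point.some.injEq] at e
    obtain ⟨rfl, rfl⟩ := e
    refine ⟨by rw [← h]; ring, rfl, ?_⟩
    intro h0
    have : 1 + y = 0 := by simpa [hdd] using h0
    obtain rfl : y = -1 := by linear_combination this
    exact had (by linear_combination -h)
  have r2 : ∀ {x : K} {h : E.dK K * x ^ 2 = 1},
      E.toWeierstrass (.inf₂ x h) = .some X Y hW →
      X = E.dK K - E.aK K ∧ Y * x = 2 * X ∧ Y ≠ 0 := by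
    intro x h e
    simp only [toWeierstrass, WeierstrassCurve.Affine.Point.some.injEq] at e
    obtain ⟨rfl, rfl⟩ := e
    have hx : x ≠ 0 := by rintro rfl; simp at h
    have had' := sub_ne_zero.2 (E.aK_ne_dK K).symm
    exact ⟨rfl, by field_simp, by simp [hx, h2, had']⟩
  cases P with
  | affine x y h =>
    obtain ⟨p1, p2, p3⟩ := E.affine_rel H
    cases Q with
    | affine x' y' h' =>
      obtain ⟨s1, s2, s3⟩ := E.affine_rel hQ
      obtain rfl := key p1 s1
      by_cases hY : Y = 0
      · obtain rfl := p3 hY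
        obtain rfl := s3 hY
        rfl
      · obtain rfl := mul_left_cancel₀ hY (p2.trans s2.symm)
        rfl
    | inf₁ y' h' =>
      obtain ⟨s1, s2, s3⟩ := r1 hQ
      exact absurd (by rw [← p2, s2, zero_mul]) (mul_ne_zero h2 s3)
    | inf₂ x' h' =>
      obtain ⟨s1, s2, s3⟩ := r2 hQ
      rw [s1] at p1
      exact absurd (by linear_combination -p1) (mul_ne_zero h2 had)
  | inf₁ y h =>
    obtain ⟨p1, p2, p3⟩ := r1 H
    cases Q with
    | affine x' y' h' =>
      obtain ⟨s1, s2, s3⟩ := E.affine_rel hQ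
      exact absurd (by rw [← s2, p2, zero_mul]) (mul_ne_zero h2 p3)
    | inf₁ y' h' =>
      obtain ⟨s1, s2, s3⟩ := r1 hQ
      obtain rfl := key p1 s1
      rfl
    | inf₂ x' h' =>
      obtain ⟨s1, s2, s3⟩ := r2 hQ
      exact absurd p2 s3
  | inf₂ x h =>
    obtain ⟨p1, p2, p3⟩ := r2 H
    cases Q with
    | affine x' y' h' =>
      obtain ⟨s1, s2, s3⟩ := E.affine_rel hQ
      rw [p1] at s1
      exact absurd (by linear_combination -s1) (mul_ne_zero h2 had)
    | inf₁ y' h' =>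
      obtain ⟨s1, s2, s3⟩ := r1 hQ
      exact absurd s2 p3
    | inf₂ x' h' =>
      obtain ⟨s1, s2, s3⟩ := r2 hQ
      obtain rfl := mul_left_cancel₀ p3 (p2.trans s2.symm)
      rfl

lemma toWeierstrass_surjective : Function.Surjective (E.toWeierstrass (K := K)) := by
  have h2 := E.two_ne_zeroK K
  have had := sub_ne_zero.2 (E.aK_ne_dK K)
  have hdd := E.dK_ne_zero K
  rintro (_ | ⟨X, Y, hW⟩)
  · exact ⟨.affine 0 1 (by ring), (E.toWeierstrass_eq_zero _).2 rfl⟩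
  have hE := (E.nonsingular_iff _ _).1 hW
  by_cases hX : X + (E.aK K - E.dK K) = 0
  · obtain rfl : X = E.dK K - E.aK K := by linear_combination hX
    have hX0 : E.dK K - E.aK K ≠ 0 := fun h => had (by linear_combination -h)
    have hY2 : Y ^ 2 = 4 * E.dK K * (E.aK K - E.dK K) ^ 2 := by rw [hE]; ring
    have hY : Y ≠ 0 := by
      rintro rfl
      have : (2 : K) * 2 * E.dK K * (E.aK K - E.dK K) ^ 2 = 0 := by linear_combination -hY2
      simp [h2, hdd, had] at this
    refine ⟨.inf₂ (2 * (E.dK K - E.aK K) / Y) ?_, ?_⟩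
    · field_simp
      rw [hY2]; ring
    · simp only [toWeierstrass, WeierstrassCurve.Affine.Point.some.injEq, true_and]
      field_simp
  · by_cases hY : Y = 0
    · subst hY
      by_cases hX0 : X = 0
      · subst hX0
        exact ⟨.affine 0 (-1) (by ring), E.toWeierstrass_affine _ _ (by ring) (by ring)⟩
      · have hq : X ^ 2 + 2 * (E.aK K + E.dK K) * X + (E.aK K - E.dK K) ^ 2 = 0 := by
          refine (mul_eq_zero.1 (?_ : X * _ = 0)).resolve_left hX0
          linear_combination -hE
        refine ⟨.inf₁ ((X - (E.aK K - E.dK K)) / (X + (E.aK K - E.dK K))) ?_, ?_⟩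
        · field_simp
          linear_combination (E.dK K - E.aK K) * hq
        · simp only [toWeierstrass, WeierstrassCurve.Affine.Point.some.injEq, and_true]
          field_simp
          linear_combination (-X) * hq
    · refine ⟨.affine (2 * X / Y) ((X - (E.aK K - E.dK K)) / (X + (E.aK K - E.dK K))) ?_,
        E.toWeierstrass_affine _ _ ?_ ?_⟩
      · field_simp
        linear_combination (-4) * (E.aK K - E.dK K) * X * hE
      · field_simp
        ring
      · field_simp

/-- The points of the smooth model correspond bijectively to those of the Weierstrass model. -/
noncomputable def pointEquiv : E.Point K ≃ (E.weierstrassK K).Point :=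
  Equiv.ofBijective E.toWeierstrass ⟨E.toWeierstrass_injective, E.toWeierstrass_surjective⟩


open scoped Classical in
/-- The group law on the smooth model, for which `toWeierstrass` is an isomorphism of groups. See
`zero_eq`, `neg_affine` and `affine_add_affine` for the neutral element `(0, 1)`, the inverse
`(-x, y)` and the twisted Edwards addition law. -/
noncomputable instance : AddCommGroup (E.Point K) := E.pointEquiv.addCommGroup

open scoped Classical in
lemma toWeierstrass_add (P Q : E.Point K) :
    E.toWeierstrass (P + Q) = E.toWeierstrass P + E.toWeierstrass Q :=
  E.pointEquiv.apply_symm_apply _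

lemma zero_eq : (0 : E.Point K) = .affine 0 1 (by ring) :=
  (E.toWeierstrass_eq_zero _).1 (E.pointEquiv.apply_symm_apply _)

lemma closure_identity {k : Type*} [Field k] (a d x₁ y₁ x₂ y₂ : k) (h₁ : a * x₁ ^ 2 + y₁ ^ 2 = 1 + d * x₁ ^ 2 * y₁ ^ 2)
    (h₂ : a * x₂ ^ 2 + y₂ ^ 2 = 1 + d * x₂ ^ 2 * y₂ ^ 2) :
   a * (x₁ * y₂ + x₂ * y₁)^2 * (1 - d * x₁ * x₂ * y₁ * y₂)^2 + (y₁ * y₂ - a * x₁ * x₂)^2 * (1 + d * x₁ * x₂ * y₁ * y₂)^2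
    = (1 + d * x₁ * x₂ * y₁ * y₂)^2 * (1 - d * x₁ * x₂ * y₁ * y₂)^2 + d * (x₁ * y₂ + x₂ * y₁)^2 * (y₁ * y₂ - a * x₁ * x₂)^2 := by
  grind

lemma chord_identity_X {k : Type*} [Field k] (a d x₁ y₁ x₂ y₂ : k) (h₁ : a * x₁ ^ 2 + y₁ ^ 2 = 1 + d * x₁ ^ 2 * y₁ ^ 2)
    (h₂ : a * x₂ ^ 2 + y₂ ^ 2 = 1 + d * x₂ ^ 2 * y₂ ^ 2) (hx₁ : x₁ ≠ 0) (hx₂ : x₂ ≠ 0)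
    (hy₁ : 1 - y₁ ≠ 0) (hy₂ : 1 - y₂ ≠ 0) (hy : y₁ - y₂ ≠ 0) (hyp : y₁ + y₂ ≠ 0)
    (X₁ Y₁ X₂ Y₂ l X : k) (hX₁ : X₁ = (a-d)*(1+y₁)/(1-y₁)) (hX₂ : X₂ = (a-d)*(1+y₂)/(1-y₂))
    (hY₁ : Y₁ = 2 * X₁ / x₁) (hY₂ : Y₂ = 2 * X₂ / x₂) (hl : l * (X₁-X₂) = Y₁ - Y₂) (had : a - d ≠ 0) (h2 : (2: k) ≠ 0)
    (hX : X = l^2 - 2*(a+d) - X₁ - X₂) :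
    X * (1 - d * x₁ * x₂ * y₁ * y₂ - (y₁ * y₂ - a * x₁ * x₂)) = (a-d) * (1 - d * x₁ * x₂ * y₁ * y₂ + (y₁ * y₂ - a * x₁ * x₂)) := by
  have hyy : y₁^2 - y₂^2 ≠ 0 := by
    have := mul_ne_zero hy hyp
    intro h; apply this; linear_combination h
  have hl' : l = ((1+y₁)*(1-y₂)*x₂-(1+y₂)*(1-y₁)*x₁)/(x₁*x₂*(y₁-y₂)) := by
    subst hY₁ hY₂ hX₁ hX₂
    field_simp at hl ⊢
    apply mul_left_cancel₀ h2
    linear_combination hl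
  have ha : a = (y₁^2*x₁^2*(1-y₂^2) - y₂^2*x₂^2*(1-y₁^2))/(x₁^2*x₂^2*(y₁^2-y₂^2)) := by
    field_simp
    linear_combination x₁^2*y₁^2*h₂ - x₂^2*y₂^2*h₁
  have hd : d = (x₁^2*(1-y₂^2) - x₂^2*(1-y₁^2))/(x₁^2*x₂^2*(y₁^2-y₂^2)) := by
    field_simp
    linear_combination x₁^2*h₂ - x₂^2*h₁
  subst hX hX₁ hX₂ hl'
  clear hl hY₁ hY₂ had h₁ h₂ h2
  subst ha hd
  field_simp
  ring

lemma chord_identity_Y {k : Type*} [Field k] (a d x₁ y₁ x₂ y₂ : k) (h₁ : a * x₁ ^ 2 + y₁ ^ 2 = 1 + d * x₁ ^ 2 * y₁ ^ 2)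
    (h₂ : a * x₂ ^ 2 + y₂ ^ 2 = 1 + d * x₂ ^ 2 * y₂ ^ 2) (hx₁ : x₁ ≠ 0) (hx₂ : x₂ ≠ 0)
    (hy₁ : 1 - y₁ ≠ 0) (hy₂ : 1 - y₂ ≠ 0) (hy : y₁ - y₂ ≠ 0) (hyp : y₁ + y₂ ≠ 0)
    (X₁ Y₁ X₂ Y₂ l X : k) (hX₁ : X₁ = (a-d)*(1+y₁)/(1-y₁)) (hX₂ : X₂ = (a-d)*(1+y₂)/(1-y₂))
    (hY₁ : Y₁ = 2 * X₁ / x₁) (hY₂ : Y₂ = 2 * X₂ / x₂) (hl : l * (X₁-X₂) = Y₁ - Y₂) (had : a - d ≠ 0) (h2 : (2: k) ≠ 0)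
    (hX : X = l^2 - 2*(a+d) - X₁ - X₂) :
    -(l * (X - X₁) + Y₁) * (x₁ * y₂ + x₂ * y₁) = 2 * X * (1 + d * x₁ * x₂ * y₁ * y₂) := by
  have hyy : y₁^2 - y₂^2 ≠ 0 := by
    have := mul_ne_zero hy hyp
    intro h; apply this; linear_combination h
  have hl' : l = ((1+y₁)*(1-y₂)*x₂-(1+y₂)*(1-y₁)*x₁)/(x₁*x₂*(y₁-y₂)) := by
    subst hY₁ hY₂ hX₁ hX₂
    field_simp at hl ⊢
    apply mul_left_cancel₀ h2
    linear_combination hl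
  have ha : a = (y₁^2*x₁^2*(1-y₂^2) - y₂^2*x₂^2*(1-y₁^2))/(x₁^2*x₂^2*(y₁^2-y₂^2)) := by
    field_simp
    linear_combination x₁^2*y₁^2*h₂ - x₂^2*y₂^2*h₁
  have hd : d = (x₁^2*(1-y₂^2) - x₂^2*(1-y₁^2))/(x₁^2*x₂^2*(y₁^2-y₂^2)) := by
    field_simp
    linear_combination x₁^2*h₂ - x₂^2*h₁
  subst hX hY₁ hX₁ hX₂ hl'
  clear hl hY₂ had h₁ h₂ h2
  subst ha hd
  field_simp
  ring

lemma one_add_ne_zero {x y : K} (h : E.aK K * x ^ 2 + y ^ 2 = 1 + E.dK K * x ^ 2 * y ^ 2)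
    (hx : x ≠ 0) : 1 + y ≠ 0 := by
  intro hy
  obtain rfl : y = -1 := by linear_combination hy
  exact mul_ne_zero (sub_ne_zero.2 (E.aK_ne_dK K)) (pow_ne_zero 2 hx) (by linear_combination h)

open scoped Classical in
lemma toWeierstrass_of_ne {x y : K} (h : E.aK K * x ^ 2 + y ^ 2 = 1 + E.dK K * x ^ 2 * y ^ 2)
    (hx : x ≠ 0) : E.toWeierstrass (.affine x y h) = .some _ _ (E.affine_nonsingular h hx) := by
  simp [toWeierstrass, hx]

lemma toWeierstrass_O' : E.toWeierstrass (.affine (0 : K) (-1) (by ring)) =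
    .some 0 0 ((E.nonsingular_iff 0 0).2 (by ring)) :=
  E.toWeierstrass_affine _ _ (by ring) (by ring)

lemma negY_eq (X Y : K) : (E.weierstrassK K).negY X Y = -Y := by
  simp [WeierstrassCurve.Affine.negY, weierstrassK, weierstrass, WeierstrassCurve.baseChange,
    WeierstrassCurve.map]

lemma addX_eq (X₁ X₂ l : K) : (E.weierstrassK K).addX X₁ X₂ l =
    l ^ 2 - 2 * (E.aK K + E.dK K) - X₁ - X₂ := by
  simp [WeierstrassCurve.Affine.addX, weierstrassK, weierstrass, WeierstrassCurve.baseChange,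
    WeierstrassCurve.map, aK, dK, map_ofNat (algebraMap F K) 2]

lemma addY_eq (X₁ X₂ Y₁ l : K) : (E.weierstrassK K).addY X₁ X₂ Y₁ l =
    -(l * (l ^ 2 - 2 * (E.aK K + E.dK K) - X₁ - X₂ - X₁) + Y₁) := by
  simp only [WeierstrassCurve.Affine.addY, WeierstrassCurve.Affine.negAddY, negY_eq, addX_eq]

/-- The negative of an affine point. -/
lemma neg_affine {x y : K} (h : E.aK K * x ^ 2 + y ^ 2 = 1 + E.dK K * x ^ 2 * y ^ 2) :
    -(Point.affine x y h : E.Point K) = .affine (-x) y (by linear_combination h) := by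
  classical
  have e : E.toWeierstrass (-(Point.affine x y h)) = -E.toWeierstrass (.affine x y h) :=
    E.pointEquiv.apply_symm_apply _
  apply E.toWeierstrass_injective
  rw [e]
  by_cases hx : x = 0
  · subst hx
    by_cases hy : y = 1
    · subst hy
      simp [toWeierstrass]
    · simp [toWeierstrass, hy, weierstrass]
  · rw [toWeierstrass_of_ne _ h hx, toWeierstrass_of_ne _ _ (neg_ne_zero.2 hx)]
    simp [weierstrass, div_neg]

lemma eq_or_eq_neg {x₁ x₂ y₁ y₂ : K}
    (h₁ : E.aK K * x₁ ^ 2 + y₁ ^ 2 = 1 + E.dK K * x₁ ^ 2 * y₁ ^ 2)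
    (h₂ : E.aK K * x₂ ^ 2 + y₂ ^ 2 = 1 + E.dK K * x₂ ^ 2 * y₂ ^ 2)
    (hx₁ : x₁ ≠ 0) (hy : y₁ ^ 2 = y₂ ^ 2) : x₂ = x₁ ∨ x₂ = -x₁ := by
  have h0 : (1 - y₁) * (1 + y₁) ≠ 0 :=
    mul_ne_zero (E.one_sub_ne_zero h₁ hx₁) (E.one_add_ne_zero h₁ hx₁)
  have h3 : E.aK K - E.dK K * y₁ ^ 2 ≠ 0 := by
    intro h
    apply h0
    linear_combination -h₁ + x₁ ^ 2 * h
  apply sq_eq_sq_iff_eq_or_eq_neg.1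
  apply mul_left_cancel₀ h3
  linear_combination h₂ - h₁ + (1 - E.dK K * x₂ ^ 2) * hy

lemma clear_X {k : Type*} [Field k] {X A N D : k} (hD : D ≠ 0) (h : X * (D - N) = A * (D + N)) :
    X * (1 - N / D) = A * (1 + N / D) := by
  field_simp; exact h

lemma clear_Y {k : Type*} [Field k] {X Y N D : k} (hD : D ≠ 0) (h : Y * N = 2 * X * D) :
    Y * (N / D) = 2 * X := by
  field_simp; linear_combination h

lemma closure_frac {k : Type*} [Field k] {a d N M D D' : k} (hD : D ≠ 0) (hD' : D' ≠ 0)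
    (h : a * N ^ 2 * D' ^ 2 + M ^ 2 * D ^ 2 = D ^ 2 * D' ^ 2 + d * N ^ 2 * M ^ 2) :
    a * (N / D) ^ 2 + (M / D') ^ 2 = 1 + d * (N / D) ^ 2 * (M / D') ^ 2 := by
  field_simp; linear_combination h

lemma twoTorsion_add {y₁ x₂ y₂ : K}
    (h₁ : E.aK K * 0 ^ 2 + y₁ ^ 2 = 1 + E.dK K * 0 ^ 2 * y₁ ^ 2)
    (h₂ : E.aK K * x₂ ^ 2 + y₂ ^ 2 = 1 + E.dK K * x₂ ^ 2 * y₂ ^ 2) :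
    ∃ h, (Point.affine 0 y₁ h₁ : E.Point K) + .affine x₂ y₂ h₂ =
      .affine (x₂ * y₁) (y₁ * y₂) h := by
  classical
  have h2 := E.two_ne_zeroK K
  have had := sub_ne_zero.2 (E.aK_ne_dK K)
  have hy : (y₁ - 1) * (y₁ + 1) = 0 := by linear_combination h₁
  rcases mul_eq_zero.1 hy with hy | hy
  · obtain rfl : y₁ = 1 := by linear_combination hy
    refine ⟨by linear_combination h₂, ?_⟩
    rw [show (Point.affine 0 1 h₁ : E.Point K) = 0 from E.zero_eq.symm]
    simp
  · obtain rfl : y₁ = -1 := by linear_combination hy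
    refine ⟨by linear_combination h₂, E.toWeierstrass_injective ?_⟩
    rw [toWeierstrass_add, toWeierstrass_O']
    by_cases hx : x₂ = 0
    · subst hx
      have hy : (y₂ - 1) * (y₂ + 1) = 0 := by linear_combination h₂
      rcases mul_eq_zero.1 hy with hy | hy
      · obtain rfl : y₂ = 1 := by linear_combination hy
        rw [(E.toWeierstrass_eq_zero (.affine 0 1 h₂)).2 rfl, add_zero]
        exact (E.toWeierstrass_affine _ _ (by ring) (by ring)).symm
      · obtain rfl : y₂ = -1 := by linear_combination hy
        rw [toWeierstrass_O', WeierstrassCurve.Affine.Point.add_self_of_Y_eq (by rw [negY_eq, neg_zero]),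
          eq_comm, toWeierstrass_eq_zero]
        simp
    · have hy₂ := E.one_sub_ne_zero h₂ hx
      have hy₂' := E.one_add_ne_zero h₂ hx
      rw [toWeierstrass_of_ne _ h₂ hx]
      have hX : (0 : K) ≠ (E.aK K - E.dK K) * (1 + y₂) / (1 - y₂) := by
        exact (div_ne_zero (mul_ne_zero had hy₂') hy₂).symm
      rw [WeierstrassCurve.Affine.Point.add_some (fun h => hX h.1), eq_comm]
      have hl : (E.weierstrassK K).slope 0 ((E.aK K - E.dK K) * (1 + y₂) / (1 - y₂)) 0
          (2 * ((E.aK K - E.dK K) * (1 + y₂) / (1 - y₂)) / x₂) = 2 / x₂ := by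
        rw [WeierstrassCurve.Affine.slope_of_X_ne hX]
        field_simp
        ring
      apply E.toWeierstrass_affine
      · rw [hl, addX_eq]
        have ha : E.aK K = (1 + E.dK K * x₂ ^ 2 * y₂ ^ 2 - y₂ ^ 2) / x₂ ^ 2 := by
          field_simp; linear_combination h₂
        rw [ha]
        field_simp
        ring
      · rw [hl, addX_eq, addY_eq]
        field_simp
        ring

lemma chord_special_identity {k : Type*} [Field k] {a d x y e : k}
    (h : a * x ^ 2 + y ^ 2 = 1 + d * x ^ 2 * y ^ 2) (hx : x ≠ 0) (hy : y ≠ 0)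
    (h1 : 1 - y ≠ 0) (h1' : 1 + y ≠ 0) (he : e ^ 2 = 1) (h2 : (2 : k) ≠ 0)
    (had : a - d ≠ 0)
    {l X : k}
    (hl : l * ((a - d) * (1 + y) / (1 - y) - (a - d) * (1 + -y) / (1 - -y)) =
      2 * ((a - d) * (1 + y) / (1 - y)) / x - 2 * ((a - d) * (1 + -y) / (1 - -y)) / (e * x))
    (hX : X = l ^ 2 - 2 * (a + d) - (a - d) * (1 + y) / (1 - y)
      - (a - d) * (1 + -y) / (1 - -y)) :
    X * (1 - d * x * (e * x) * y * -y - (y * -y - a * x * (e * x))) =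
        (a - d) * (1 - d * x * (e * x) * y * -y + (y * -y - a * x * (e * x))) ∧
      -(l * (X - (a - d) * (1 + y) / (1 - y)) + 2 * ((a - d) * (1 + y) / (1 - y)) / x) *
        (x * -y + e * x * y) = 2 * X * (1 + d * x * (e * x) * y * -y) := by
  have ha : a = (1 + d * x ^ 2 * y ^ 2 - y ^ 2) / x ^ 2 := by
    field_simp; linear_combination h
  have h3 : 1 - -y ≠ 0 := by simpa using h1'
  rcases (show e = 1 ∨ e = -1 from sq_eq_sq_iff_eq_or_eq_neg.1 (by rw [he, one_pow])) with rfl | rfl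
  · have hl' : l = 2 / x := by
      field_simp at hl ⊢
      apply mul_left_cancel₀ (mul_ne_zero (mul_ne_zero h2 h2) hy)
      linear_combination hl
    subst hX hl'
    clear hl had
    subst ha
    constructor
    · field_simp
      ring
    · field_simp
      ring
  · have hl' : l = (1 + y ^ 2) / (x * y) := by
      field_simp at hl ⊢
      apply mul_left_cancel₀ (mul_ne_zero h2 h2)
      linear_combination hl
    subst hX hl'
    clear hl had
    subst ha
    constructor
    · field_simp
      ring
    · field_simp
      ring

lemma tangent_identity {k : Type*} [Field k] {a d x y : k}
    (h : a * x ^ 2 + y ^ 2 = 1 + d * x ^ 2 * y ^ 2) (hx : x ≠ 0)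
    (h1 : 1 - y ≠ 0) (h1' : 1 + y ≠ 0) (h2 : (2 : k) ≠ 0) (had : a - d ≠ 0) {l X Z : k}
    (hZ : Z = (a - d) * (1 + y) / (1 - y))
    (hl : l * (2 * Z / x - -(2 * Z / x)) = 3 * Z ^ 2 + 2 * (2 * (a + d)) * Z + (a - d) ^ 2)
    (hX : X = l ^ 2 - 2 * (a + d) - Z - Z) :
    X * (1 - d * x * x * y * y - (y * y - a * x * x)) =
        (a - d) * (1 - d * x * x * y * y + (y * y - a * x * x)) ∧
      -(l * (X - Z) + 2 * Z / x) * (x * y + x * y) = 2 * X * (1 + d * x * x * y * y) := by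
  have ha : a = (1 + d * x ^ 2 * y ^ 2 - y ^ 2) / x ^ 2 := by
    field_simp; linear_combination h
  have hZ0 : Z ≠ 0 := hZ ▸ div_ne_zero (mul_ne_zero had h1') h1
  have hl' : l = (2 + y - d * x ^ 2 * y) / x := by
    have hne : 2 * Z / x - -(2 * Z / x) ≠ 0 := by
      rw [show 2 * Z / x - -(2 * Z / x) = 2 * (2 * Z / x) by ring]
      exact mul_ne_zero h2 (div_ne_zero (mul_ne_zero h2 hZ0) hx)
    apply mul_right_cancel₀ hne
    rw [hl]
    clear hl hne hX hZ0 had h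
    subst hZ ha
    field_simp
    ring
  clear hl hZ0 had h
  subst hX hl' hZ ha
  constructor
  · field_simp
    ring
  · field_simp
    ring

open scoped Classical in
/-- Wherever its denominators do not vanish, the addition is given by the twisted Edwards
addition law. -/
theorem affine_add_affine {x₁ y₁ x₂ y₂ : K}
    (h₁ : E.aK K * x₁ ^ 2 + y₁ ^ 2 = 1 + E.dK K * x₁ ^ 2 * y₁ ^ 2)
    (h₂ : E.aK K * x₂ ^ 2 + y₂ ^ 2 = 1 + E.dK K * x₂ ^ 2 * y₂ ^ 2)
    (hp : 1 + E.dK K * x₁ * x₂ * y₁ * y₂ ≠ 0) (hm : 1 - E.dK K * x₁ * x₂ * y₁ * y₂ ≠ 0) :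
    ∃ h, (Point.affine x₁ y₁ h₁ : E.Point K) + .affine x₂ y₂ h₂ =
      .affine ((x₁ * y₂ + x₂ * y₁) / (1 + E.dK K * x₁ * x₂ * y₁ * y₂))
        ((y₁ * y₂ - E.aK K * x₁ * x₂) / (1 - E.dK K * x₁ * x₂ * y₁ * y₂)) h := by
  have h2 := E.two_ne_zeroK K
  have had := sub_ne_zero.2 (E.aK_ne_dK K)
  have hc : E.aK K * ((x₁ * y₂ + x₂ * y₁) / (1 + E.dK K * x₁ * x₂ * y₁ * y₂)) ^ 2 +
      ((y₁ * y₂ - E.aK K * x₁ * x₂) / (1 - E.dK K * x₁ * x₂ * y₁ * y₂)) ^ 2 =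
      1 + E.dK K * ((x₁ * y₂ + x₂ * y₁) / (1 + E.dK K * x₁ * x₂ * y₁ * y₂)) ^ 2 *
      ((y₁ * y₂ - E.aK K * x₁ * x₂) / (1 - E.dK K * x₁ * x₂ * y₁ * y₂)) ^ 2 :=
    closure_frac hp hm (closure_identity _ _ _ _ _ _ h₁ h₂)
  by_cases hx₁ : x₁ = 0
  · subst hx₁
    obtain ⟨h, e⟩ := E.twoTorsion_add h₁ h₂
    refine ⟨hc, e.trans ?_⟩
    congr 1 <;> simp
  by_cases hx₂ : x₂ = 0
  · subst hx₂
    obtain ⟨h, e⟩ := E.twoTorsion_add h₂ h₁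
    refine ⟨hc, (add_comm _ _).trans (e.trans ?_)⟩
    congr 1 <;> simp [mul_comm]
  have n₁ := E.one_sub_ne_zero h₁ hx₁
  have n₂ := E.one_sub_ne_zero h₂ hx₂
  have m₁ := E.one_add_ne_zero h₁ hx₁
  refine ⟨hc, E.toWeierstrass_injective ?_⟩
  rw [toWeierstrass_add, toWeierstrass_of_ne _ h₁ hx₁, toWeierstrass_of_ne _ h₂ hx₂]
  by_cases hy : y₁ = y₂
  · subst hy
    rcases E.eq_or_eq_neg h₁ h₂ hx₁ rfl with rfl | rfl
    · have hZ : (E.aK K - E.dK K) * (1 + y₁) / (1 - y₁) ≠ 0 :=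
        div_ne_zero (mul_ne_zero had m₁) n₁
      have hY : 2 * ((E.aK K - E.dK K) * (1 + y₁) / (1 - y₁)) / x₂ ≠
          (E.weierstrassK K).negY ((E.aK K - E.dK K) * (1 + y₁) / (1 - y₁))
            (2 * ((E.aK K - E.dK K) * (1 + y₁) / (1 - y₁)) / x₂) := by
        rw [negY_eq]
        intro h
        refine mul_ne_zero h2 (div_ne_zero (mul_ne_zero h2 hZ) hx₁) ?_
        linear_combination h
      have hl := WeierstrassCurve.Affine.slope_of_Y_ne (W := E.weierstrassK K) rfl hY
      rw [eq_div_iff (sub_ne_zero.2 hY), negY_eq] at hl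
      have hl' := hl.trans (show _ =
        3 * ((E.aK K - E.dK K) * (1 + y₁) / (1 - y₁)) ^ 2 + 2 * (2 * (E.aK K + E.dK K)) *
          ((E.aK K - E.dK K) * (1 + y₁) / (1 - y₁)) + (E.aK K - E.dK K) ^ 2 by
        simp [weierstrass, WeierstrassCurve.baseChange,
          WeierstrassCurve.map, aK, dK, map_ofNat (algebraMap F K) 2])
      obtain ⟨i₁, i₂⟩ := tangent_identity h₁ hx₁ n₁ m₁ h2 had rfl
        hl' rfl
      rw [WeierstrassCurve.Affine.Point.add_self_of_Y_ne hY, eq_comm]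
      refine E.toWeierstrass_affine _ _ (clear_X hm ?_) (clear_Y hp ?_)
      · rw [addX_eq]
        exact i₁
      · rw [addX_eq, addY_eq]
        exact i₂
    · rw [← toWeierstrass_of_ne _ h₁ hx₁, ← toWeierstrass_of_ne _ h₂ hx₂, ← toWeierstrass_add,
        ← E.neg_affine h₁, add_neg_cancel, E.zero_eq]
      congr 2
      · ring
      · rw [eq_comm, div_eq_one_iff_eq hm]
        linear_combination h₁
  · have hy' := sub_ne_zero.2 hy
    have hX : (E.aK K - E.dK K) * (1 + y₁) / (1 - y₁) ≠
        (E.aK K - E.dK K) * (1 + y₂) / (1 - y₂) := by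
      intro h
      field_simp at h
      exact mul_ne_zero h2 hy' (by linear_combination h)
    have hl := WeierstrassCurve.Affine.slope_of_X_ne (W := E.weierstrassK K)
      (y₁ := 2 * ((E.aK K - E.dK K) * (1 + y₁) / (1 - y₁)) / x₁)
      (y₂ := 2 * ((E.aK K - E.dK K) * (1 + y₂) / (1 - y₂)) / x₂) hX
    rw [eq_div_iff (sub_ne_zero.2 hX)] at hl
    rw [WeierstrassCurve.Affine.Point.add_some (fun h => hX h.1), eq_comm]
    by_cases hyp : y₁ + y₂ = 0
    · obtain rfl : y₂ = -y₁ := by linear_combination hyp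
      have hy0 : y₁ ≠ 0 := by rintro rfl; simp at hy
      obtain ⟨e, he, rfl⟩ : ∃ e : K, e ^ 2 = 1 ∧ x₂ = e * x₁ := by
        rcases E.eq_or_eq_neg h₁ h₂ hx₁ (by ring) with h | h
        · exact ⟨1, by ring, by rw [h, one_mul]⟩
        · exact ⟨-1, by ring, by rw [h]; ring⟩
      obtain ⟨i₁, i₂⟩ := chord_special_identity h₁ hx₁ hy0 n₁ m₁ he h2 had hl rfl
      refine E.toWeierstrass_affine _ _ (clear_X hm ?_) (clear_Y hp ?_)
      · rw [addX_eq]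
        exact i₁
      · rw [addX_eq, addY_eq]
        exact i₂
    · refine E.toWeierstrass_affine _ _ (clear_X hm ?_) (clear_Y hp ?_)
      · exact chord_identity_X _ _ _ _ _ _ h₁ h₂ hx₁ hx₂ n₁ n₂ hy' hyp _ _ _ _ _ _ rfl rfl rfl
          rfl hl had h2 (addX_eq ..)
      · rw [addY_eq, ← addX_eq]
        exact chord_identity_Y _ _ _ _ _ _ h₁ h₂ hx₁ hx₂ n₁ n₂ hy' hyp _ _ _ _ _ _ rfl rfl rfl
          rfl hl had h2 (addX_eq ..)


variable {L : Type*} [Field L] [Algebra F L]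

/-- The action of an `F`-embedding of fields on points, coordinate by coordinate. -/
def mapFun (f : K →ₐ[F] L) : E.Point K → E.Point L
  | .affine x y h => .affine (f x) (f y) <| by
      have := congr_arg f h
      simpa [aK, dK] using this
  | .inf₁ y h => .inf₁ (f y) <| by
      have := congr_arg f h
      simpa [aK, dK] using this
  | .inf₂ x h => .inf₂ (f x) <| by
      have := congr_arg f h
      simpa [dK] using this

open scoped Classical in
lemma some_eq_map (f : K →ₐ[F] L) {X Y : K} {X' Y' : L} (h : (E.weierstrassK K).Nonsingular X Y)
    (h' : (E.weierstrassK L).Nonsingular X' Y') (hX : f X = X') (hY : f Y = Y') :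
    (WeierstrassCurve.Affine.Point.some X' Y' h' : (E.weierstrassK L).Point) =
      WeierstrassCurve.Affine.Point.map (W' := E.weierstrass) f (.some X Y h) := by
  subst hX hY
  rfl

open scoped Classical in
lemma toWeierstrass_mapFun (f : K →ₐ[F] L) (P : E.Point K) :
    E.toWeierstrass (E.mapFun f P) =
      WeierstrassCurve.Affine.Point.map (W' := E.weierstrass) f (E.toWeierstrass P) := by
  have ha : f (E.aK K) = E.aK L := by simp [aK]
  have hd : f (E.dK K) = E.dK L := by simp [dK]
  have h2 : f 2 = 2 := map_ofNat f 2
  cases P with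
  | affine x y h =>
    by_cases hx : x = 0
    · subst hx
      by_cases hy : y = 1
      · subst hy
        simp [mapFun, toWeierstrass]
      · have : f y ≠ 1 := (map_eq_one_iff f f.toRingHom.injective).not.2 hy
        simp only [mapFun, toWeierstrass, hy, this, map_zero, dite_true, if_false]
        exact E.some_eq_map f _ _ (map_zero f) (map_zero f)
    · have hx' : f x ≠ 0 := by simpa using hx
      simp only [mapFun, toWeierstrass, hx, hx', dite_false]
      apply E.some_eq_map f <;> simp [ha, hd, h2]
  | inf₁ y h => exact E.some_eq_map f _ _ (by simp [hd]) (map_zero f)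
  | inf₂ x h => exact E.some_eq_map f _ _ (by simp [ha, hd]) (by simp [ha, hd, h2])

/-- The group homomorphism `E(K) → E(L)` induced by an `F`-embedding `K → L`. -/
noncomputable def map (f : K →ₐ[F] L) : E.Point K →+ E.Point L :=
  AddMonoidHom.mk' (E.mapFun f) fun P Q => by
    classical
    apply E.toWeierstrass_injective
    rw [toWeierstrass_add, toWeierstrass_mapFun, toWeierstrass_mapFun, toWeierstrass_mapFun,
      toWeierstrass_add, map_add]

section TraceZero

variable (K) [Fintype F]

/-- The Frobenius endomorphism `(x, y) ↦ (x ^ q, y ^ q)` of `E(K)`, where `q = #F`. -/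
noncomputable def frobenius : AddMonoid.End (E.Point K) :=
  E.map (FiniteField.frobeniusAlgHom F K)

/-- The trace map `P ↦ P + φ(P) + ⋯ + φ^(n-1)(P)`, where `n = [K : F]`. -/
noncomputable def trace : E.Point K →+ E.Point K :=
  (∑ i ∈ Finset.range (Module.finrank F K), E.frobenius K ^ i : AddMonoid.End (E.Point K))

/-- The trace zero subgroup of `E(K)`. -/
noncomputable def traceZero : AddSubgroup (E.Point K) := (E.trace K).ker

end TraceZero

/-! ### Divisors of polynomial functions

Polynomials in `x` and `y` are elements of `L[X][X]`: the outer variable is `x` and the inner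
variable is `y`. -/

/-- The polynomial `(a - d y²) x² + (y² - 1)` of the curve. -/
noncomputable def curve (L : Type*) [Field L] [Algebra F L] : L[X][X] :=
  C (C (E.aK L) - C (E.dK L) * X ^ 2) * X ^ 2 + C (X ^ 2 - 1)

/-- The order of vanishing of `f` along the plane curve `G = 0` at the point with outer coordinate
`u` and inner coordinate `v`: the largest `m` with `f ∈ 𝔪 ^ m + (G)`, where `𝔪` is the maximal
ideal of the point. At a smooth point of the curve this is the normalized valuation of `f` in the
local ring of the curve (and the value is `0`, by convention, if `f` vanishes identically on the
component through the point). -/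
noncomputable def vanishingOrder {L : Type*} [Field L] (G f : L[X][X]) (u v : L) : ℕ :=
  sSup {m : ℕ | f ∈ Ideal.span {X - C (C u), C (X - C v)} ^ m ⊔ Ideal.span {G}}

/-- The order of the polynomial function `f` at a point of the smooth model. At an affine point it
is the order of vanishing. At a point with `x = ∞` one passes to the chart with coordinates
`(s, y)`, `s = 1/x`, where `f = f.reverse / s ^ deg_x f` and the curve is given by `curve.reverse`.
At a point with `y = ∞` one exchanges the roles of `x` and `y` and passes to `(t, x)`, `t = 1/y`. -/
noncomputable def ord (f : L[X][X]) : E.Point L → ℤ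
  | .affine x y _ => vanishingOrder (E.curve L) f x y
  | .inf₁ y _ =>
      vanishingOrder (E.curve L).reverse f.reverse 0 y -
        f.natDegree * vanishingOrder (E.curve L).reverse X 0 y
  | .inf₂ x _ =>
      vanishingOrder (Bivariate.swap (E.curve L)).reverse (Bivariate.swap f).reverse 0 x -
        (Bivariate.swap f).natDegree *
          vanishingOrder (Bivariate.swap (E.curve L)).reverse X 0 x

variable (L) in
/-- The points of the projective closure of the curve in the projective plane: the affine points
and the two singular points at infinity `Ω₁ = [1, 0, 0]` and `Ω₂ = [0, 1, 0]`. -/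
inductive ProjPoint : Type _
  | affine (x y : L) (h : E.aK L * x ^ 2 + y ^ 2 = 1 + E.dK L * x ^ 2 * y ^ 2)
  | Ω₁
  | Ω₂

/-- The normalization map from the smooth model to the projective closure: the points with
`x = ∞` lie over `Ω₁`, those with `y = ∞` over `Ω₂`. -/
def toProj : E.Point L → E.ProjPoint L
  | .affine x y h => .affine x y h
  | .inf₁ _ _ => .Ω₁
  | .inf₂ _ _ => .Ω₂

/-- The divisor, on the projective closure over `L`, of a polynomial function `f`. The multiplicity
at a point is the sum of the orders of `f` at the points of the normalization lying over it. -/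
noncomputable def div (f : L[X][X]) (Q : E.ProjPoint L) : ℤ :=
  ∑ᶠ (P : E.Point L) (_ : E.toProj P = Q), E.ord f P

/-- The point `O' = (0, -1)`. -/
def O' : E.ProjPoint L := .affine 0 (-1) (by ring)

/-- The divisor `P + φ(P) + ⋯ + φ^(n-1)(P) + O' - 2 Ω₁ - (n - 1) Ω₂` on the projective closure of
the curve over the algebraic closure of `K`, where `n = [K : F]`. -/
noncomputable def traceDivisor [Fintype F] (P : E.Point K) :
    E.ProjPoint (AlgebraicClosure K) →₀ ℤ :=
  ∑ i ∈ Finset.range (Module.finrank F K),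
      Finsupp.single (E.toProj (E.map (IsScalarTower.toAlgHom F K (AlgebraicClosure K))
        ((E.frobenius K ^ i) P))) 1
    + Finsupp.single E.O' 1 - Finsupp.single .Ω₁ 2
    - Finsupp.single .Ω₂ ((Module.finrank F K : ℤ) - 1)

variable (K) in
/-- The polynomial `q₁(y) + x q₂(y)`, with coefficients in `F`, viewed over the algebraic closure
of `K`. -/
noncomputable def linearInX (q₁ q₂ : F[X]) : (AlgebraicClosure K)[X][X] :=
  (C q₁ + X * C q₂).map (mapRingHom (algebraMap F (AlgebraicClosure K)))

end TwistedEdwards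

/-! ### Orders of vanishing along a smooth branch -/

section Branch

variable {L : Type*} [Field L]

/-- Approximate square roots: if `B(0) c² = A(0)` with `B(0)`, `c` nonzero, then `B s² = A` is
solvable modulo any power of the variable, with `s(0) = c`. -/
lemma exists_sq_approx (h2 : (2 : L) ≠ 0) (A B : L[X]) {c : L} (hB : B.eval 0 ≠ 0) (hc : c ≠ 0)
    (h : B.eval 0 * c ^ 2 = A.eval 0) (N : ℕ) :
    ∃ s : L[X], s.eval 0 = c ∧ X ^ N ∣ B * s ^ 2 - A := by
  suffices H : ∀ N : ℕ, ∃ s : L[X], s.eval 0 = c ∧ X ^ (N + 1) ∣ B * s ^ 2 - A by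
    obtain ⟨s, hs, hd⟩ := H N
    exact ⟨s, hs, (pow_dvd_pow _ N.le_succ).trans hd⟩
  intro N
  induction N with
  | zero =>
    refine ⟨C c, by simp, ?_⟩
    rw [zero_add, pow_one, X_dvd_iff, coeff_zero_eq_eval_zero]
    simp [h]
  | succ N ih =>
    obtain ⟨s, hs, w, hw⟩ := ih
    refine ⟨s + C (-(w.eval 0) / (2 * B.eval 0 * c)) * X ^ (N + 1), by simp [hs], ?_⟩
    set e := -(w.eval 0) / (2 * B.eval 0 * c) with he
    have hX : X ∣ w + 2 * B * s * C e + B * C e ^ 2 * X ^ (N + 1) := by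
      rw [X_dvd_iff, coeff_zero_eq_eval_zero]
      simp only [eval_add, eval_mul, eval_pow, eval_C, eval_X, hs, eval_ofNat, he]
      field_simp
      ring
    obtain ⟨z, hz⟩ := hX
    exact ⟨z, by linear_combination hw + X ^ (N + 1) * hz⟩

/-- Evaluation of a polynomial in two variables along the parametrized branch `(α, β)`. -/
noncomputable def branchEval (α β : L[X]) : L[X][X] →+* L[X] :=
  eval₂RingHom (compRingHom β) α

@[simp] lemma branchEval_X (α β : L[X]) : branchEval α β X = α := by simp [branchEval]

@[simp] lemma branchEval_C (α β p : L[X]) : branchEval α β (C p) = p.comp β := by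
  simp [branchEval]

lemma eval_branchEval (α β : L[X]) (f : L[X][X]) :
    (branchEval α β f).eval 0 = f.evalEval (β.eval 0) (α.eval 0) := by
  have : (evalRingHom 0).comp (branchEval α β) = evalEvalRingHom (β.eval 0) (α.eval 0) := by
    ext <;> simp
  simpa using congr($this f)

/-- If `h f = w τ ^ k` on the curve `G = 0`, where `h` and `w` do not vanish at the point `(u, v)`
and `τ` is the parameter of a branch of the curve there, then `f` vanishes to order `k`. -/
theorem vanishingOrder_eq {G f h w τ : L[X][X]} {u v : L} {k : ℕ} {α β : L[X]}
    (hα : α.eval 0 = u) (hβ : β.eval 0 = v) (hG : X ^ (k + 1) ∣ branchEval α β G)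
    (hτ : branchEval α β τ = X) (hτm : τ ∈ Ideal.span {X - C (C u), C (X - C v)})
    (hh : h.evalEval v u ≠ 0) (hw : w.evalEval v u ≠ 0) (hid : G ∣ h * f - w * τ ^ k) :
    TwistedEdwards.vanishingOrder G f u v = k := by
  set M : Ideal L[X][X] := Ideal.span {X - C (C u), C (X - C v)} with hM
  have hle : M ≤ Ideal.comap (branchEval α β) (Ideal.span {X}) := by
    rw [hM, Ideal.span_le]
    rintro p (rfl | rfl) <;>
    · simp only [SetLike.mem_coe, Ideal.mem_comap, Ideal.mem_span_singleton]
      rw [X_dvd_iff, coeff_zero_eq_eval_zero, eval_branchEval]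
      simp [evalEval, hα, hβ]
  have hdvd : ∀ j p, p ∈ M ^ j → X ^ j ∣ branchEval α β p := by
    intro j p hp
    have : p ∈ Ideal.comap (branchEval α β) (Ideal.span {X} ^ j) :=
      Ideal.le_comap_pow _ j (Ideal.pow_right_mono hle j hp)
    rwa [Ideal.mem_comap, Ideal.span_singleton_pow, Ideal.mem_span_singleton] at this
  have hset : {j : ℕ | f ∈ M ^ j ⊔ Ideal.span {G}} = Set.Iic k := by
    ext j
    simp only [Set.mem_ofPred_eq, Set.mem_Iic]
    constructor
    · intro hj
      by_contra! hkj
      obtain ⟨p, hp, g, hg, rfl⟩ := Submodule.mem_sup.1 hj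
      obtain ⟨g', rfl⟩ := Ideal.mem_span_singleton.1 hg
      obtain ⟨z, hz⟩ := hid
      have h1 : X ^ (k + 1) ∣ branchEval α β p := (pow_dvd_pow _ hkj).trans (hdvd j p hp)
      have h2 : X ^ (k + 1) ∣ branchEval α β w * X ^ k := by
        have e : branchEval α β w * X ^ k = branchEval α β h * branchEval α β p +
            branchEval α β G * (branchEval α β h * branchEval α β g' - branchEval α β z) := by
          have := congr(branchEval α β $hz)
          simp only [map_sub, map_mul, map_pow, map_add, hτ] at this
          linear_combination -this
        rw [e]
        exact dvd_add (h1.mul_left _) (hG.mul_right _)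
      rw [pow_succ, mul_comm _ (X ^ k), mul_dvd_mul_iff_left (pow_ne_zero _ X_ne_zero), X_dvd_iff,
        coeff_zero_eq_eval_zero, eval_branchEval, hα, hβ] at h2
      exact hw h2
    · intro hjk
      have hcop : IsCoprime (Ideal.span {h}) (M ^ j) := by
        apply IsCoprime.pow_right
        rw [Ideal.isCoprime_iff_exists]
        have hmem : h - C (C (h.evalEval v u)) ∈ M := by
          rw [hM, Set.pair_comm, show (X - C (C u) : L[X][X]) = X - C (C u) from rfl,
            mem_span_C_X_sub_C_X_sub_C_iff_eval_eval_eq_zero]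
          simp [evalEval]
        refine ⟨C (C (h.evalEval v u)⁻¹) * h, Ideal.mul_mem_left _ _
          (Ideal.mem_span_singleton_self h), -(C (C (h.evalEval v u)⁻¹) * (h -
            C (C (h.evalEval v u)))), M.neg_mem (M.mul_mem_left _ hmem), ?_⟩
        have : (C (C (h.evalEval v u)⁻¹) * C (C (h.evalEval v u)) : L[X][X]) = 1 := by
          rw [← C_mul, ← C_mul, inv_mul_cancel₀ hh, C_1, C_1]
        linear_combination this
      obtain ⟨s, hs, t, ht, hst⟩ := (Ideal.isCoprime_iff_exists).1 hcop
      obtain ⟨s', rfl⟩ := Ideal.mem_span_singleton.1 hs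
      obtain ⟨z, hz⟩ := hid
      have e : f = (s' * w * τ ^ k + t * f) + G * (s' * z) := by
        linear_combination s' * hz - f * hst
      rw [e]
      refine Submodule.add_mem_sup ?_ (Ideal.mul_mem_right _ _ (Ideal.mem_span_singleton_self G))
      exact Ideal.add_mem _ (Ideal.mul_mem_left _ _ (Ideal.pow_le_pow_right hjk
        (Ideal.pow_mem_pow hτm k))) (Ideal.mul_mem_right _ _ ht)
  rw [TwistedEdwards.vanishingOrder, hset, csSup_Iic]

/-- The polynomial `α u² v² + β u² + γ v² + δ`, with outer variable `u` and inner variable `v`. -/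
noncomputable def biquadratic (α β γ δ : L) : L[X][X] :=
  C (C α * X ^ 2 + C β) * X ^ 2 + C (C γ * X ^ 2 + C δ)

variable {α β γ δ : L} {f h w : L[X][X]} {u v : L} {k : ℕ}

/-- Where the outer coordinate vanishes, it is a local parameter. -/
theorem vanishingOrder_biquadratic_outer (h2 : (2 : L) ≠ 0) (hγ : γ ≠ 0) (hv : v ≠ 0)
    (hP : γ * v ^ 2 + δ = 0) (hh : h.evalEval v 0 ≠ 0) (hw : w.evalEval v 0 ≠ 0)
    (hid : biquadratic α β γ δ ∣ h * f - w * X ^ k) :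
    TwistedEdwards.vanishingOrder (biquadratic α β γ δ) f 0 v = k := by
  obtain ⟨s, hs, hd⟩ := exists_sq_approx h2 (-(C β * X ^ 2 + C δ)) (C α * X ^ 2 + C γ)
    (c := v) (by simpa) hv (by simp; linear_combination hP) (k + 1)
  refine vanishingOrder_eq (α := X) (β := s) (τ := X) (by simp) hs ?_ (by simp) ?_ hh hw hid
  · convert hd using 1
    simp [biquadratic]
    ring
  · exact Ideal.subset_span (by simp)

/-- Where the outer coordinate does not vanish, the inner coordinate is a local parameter. -/
theorem vanishingOrder_biquadratic_inner (h2 : (2 : L) ≠ 0) (hu : u ≠ 0)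
    (hB : α * v ^ 2 + β ≠ 0) (hP : (α * v ^ 2 + β) * u ^ 2 + (γ * v ^ 2 + δ) = 0)
    (hh : h.evalEval v u ≠ 0) (hw : w.evalEval v u ≠ 0)
    (hid : biquadratic α β γ δ ∣ h * f - w * C (X - C v) ^ k) :
    TwistedEdwards.vanishingOrder (biquadratic α β γ δ) f u v = k := by
  obtain ⟨s, hs, hd⟩ := exists_sq_approx h2 (-(C γ * (X + C v) ^ 2 + C δ))
    (C α * (X + C v) ^ 2 + C β) (c := u) (by simpa) hu (by simp; linear_combination hP) (k + 1)
  refine vanishingOrder_eq (α := s) (β := X + C v) (τ := C (X - C v)) hs (by simp) ?_ (by simp)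
    ?_ hh hw hid
  · convert hd using 1
    simp [biquadratic]
    ring
  · exact Ideal.subset_span (by simp)

/-- A function that does not vanish at a point of the curve has order zero there. -/
theorem vanishingOrder_biquadratic_outer_of_ne (h2 : (2 : L) ≠ 0) (hγ : γ ≠ 0) (hv : v ≠ 0)
    (hP : γ * v ^ 2 + δ = 0) (hf : f.evalEval v 0 ≠ 0) :
    TwistedEdwards.vanishingOrder (biquadratic α β γ δ) f 0 v = 0 :=
  vanishingOrder_biquadratic_outer (h := 1) (w := f) h2 hγ hv hP (by simp) hf (by simp)

theorem vanishingOrder_biquadratic_outer_X (h2 : (2 : L) ≠ 0) (hγ : γ ≠ 0) (hv : v ≠ 0)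
    (hP : γ * v ^ 2 + δ = 0) :
    TwistedEdwards.vanishingOrder (biquadratic α β γ δ) X 0 v = 1 :=
  vanishingOrder_biquadratic_outer (h := 1) (w := 1) h2 hγ hv hP (by simp) (by simp) (by simp)

lemma C_mul_X_sq_add_C_reverse {R : Type*} [Semiring R] {A B : R} (hA : A ≠ 0) :
    (C A * X ^ 2 + C B : R[X]).reverse = C B * X ^ 2 + C A := by
  have hd : (C A * X ^ 2 + C B : R[X]).natDegree = 2 := by
    rw [natDegree_add_C, natDegree_C_mul_X_pow 2 A hA]
  rw [reverse, hd, reflect_add, reflect_C_mul_X_pow, reflect_C, add_comm,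
    revAt_le le_rfl]
  simp

lemma evalEval_reverse_zero (f : L[X][X]) (v : L) :
    f.reverse.evalEval v 0 = f.leadingCoeff.eval v := by
  rw [evalEval, C_0, ← coeff_zero_eq_eval_zero, coeff_zero_reverse]

lemma biquadratic_reverse (h : C α * X ^ 2 + C β ≠ (0 : L[X])) :
    (biquadratic α β γ δ).reverse = biquadratic γ δ α β :=
  C_mul_X_sq_add_C_reverse h

lemma swap_biquadratic :
    Bivariate.swap (biquadratic α β γ δ) = biquadratic α γ β δ := by
  simp only [biquadratic, map_add, map_mul, map_pow, Bivariate.swap_X, Bivariate.swap_Y,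
    Bivariate.swap_C_C]
  ring

end Branch

/-! ### The divisor of a polynomial that is linear in `x` -/

namespace TwistedEdwards

variable {F : Type*} [Field F] (E : TwistedEdwards F) {L : Type*} [Field L] [Algebra F L]

lemma curve_eq_biquadratic : E.curve L = biquadratic (-E.dK L) (E.aK L) 1 (-1) := by
  simp [curve, biquadratic]
  ring

lemma curve_reverse : (E.curve L).reverse = biquadratic 1 (-1) (-E.dK L) (E.aK L) := by
  rw [curve_eq_biquadratic, biquadratic_reverse]
  intro h
  have := congr(($h).coeff 0)
  simp [E.aK_ne_zero] at this

lemma swap_curve_reverse :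
    (Bivariate.swap (E.curve L)).reverse = biquadratic (E.aK L) (-1) (-E.dK L) 1 := by
  rw [curve_eq_biquadratic, swap_biquadratic, biquadratic_reverse]
  intro h
  have := congr(($h).coeff 0)
  simp at this

lemma sub_mul_sq_ne_zero {x y : L} (h : E.aK L * x ^ 2 + y ^ 2 = 1 + E.dK L * x ^ 2 * y ^ 2) :
    E.aK L - E.dK L * y ^ 2 ≠ 0 := by
  intro h0
  have hy : y ^ 2 = 1 := by linear_combination h - x ^ 2 * h0
  rw [hy, mul_one] at h0
  exact E.aK_ne_dK L (sub_eq_zero.1 h0)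

variable {q₁ q₂ : L[X]}

lemma evalEval_linear (x y : L) :
    (C q₁ + X * C q₂).evalEval y x = q₁.eval y + x * q₂.eval y := by
  simp only [evalEval, eval_add, eval_mul, eval_C, eval_X]

/-- The order at a point where `x` is finite and nonzero, in terms of the norm of the function. -/
lemma ord_affine_of_conj_ne_zero {x y : L}
    (h : E.aK L * x ^ 2 + y ^ 2 = 1 + E.dK L * x ^ 2 * y ^ 2) (hx : x ≠ 0)
    (hc : q₁.eval y - x * q₂.eval y ≠ 0) {N : L[X]} {k : ℕ} (hN : N.eval y ≠ 0)
    (hid : (C (E.aK L) - C (E.dK L) * X ^ 2) * q₁ ^ 2 - (1 - X ^ 2) * q₂ ^ 2 =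
      N * (X - C y) ^ k) :
    E.ord (C q₁ + X * C q₂) (.affine x y h) = k := by
  have h0 := E.sub_mul_sq_ne_zero h
  simp only [ord, curve_eq_biquadratic, Nat.cast_inj]
  refine vanishingOrder_biquadratic_inner
    (h := C (C (E.aK L) - C (E.dK L) * X ^ 2) * (C q₁ - X * C q₂)) (w := C N)
    (E.two_ne_zeroK L) hx (fun h1 => h0 (by linear_combination h1))
    (by linear_combination h) ?_ (by simpa [evalEval] using hN) ⟨-C q₂ ^ 2, ?_⟩
  · simpa [evalEval, mul_comm (eval y q₂) x] using ⟨h0, hc⟩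
  · rw [← C_pow, ← C_mul, ← hid]
    simp [biquadratic]
    ring

lemma ord_affine_of_eval_ne_zero {x y : L}
    (h : E.aK L * x ^ 2 + y ^ 2 = 1 + E.dK L * x ^ 2 * y ^ 2)
    (hf : q₁.eval y + x * q₂.eval y ≠ 0) :
    E.ord (C q₁ + X * C q₂) (.affine x y h) = 0 := by
  have h0 := E.sub_mul_sq_ne_zero h
  rw [← evalEval_linear] at hf
  simp only [ord, curve_eq_biquadratic, Nat.cast_eq_zero]
  by_cases hx : x = 0
  · subst hx
    refine vanishingOrder_biquadratic_outer_of_ne (E.two_ne_zeroK L) one_ne_zero ?_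
      (by linear_combination h) hf
    rintro rfl
    simp at h
  · exact vanishingOrder_biquadratic_inner (h := 1) (E.two_ne_zeroK L) hx
      (fun h1 => h0 (by linear_combination h1)) (by linear_combination h) (by simp) hf (by simp)

/-- The order at `(0, -1)` of `(1 + y) r(y) + x q₂(y)`. -/
lemma ord_O' {r : L[X]} (h : E.aK L * 0 ^ 2 + (-1) ^ 2 = 1 + E.dK L * 0 ^ 2 * (-1) ^ 2)
    (h2 : q₂.eval (-1) ≠ 0) :
    E.ord (C ((1 + X) * r) + X * C q₂) (.affine 0 (-1) h) = 1 := by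
  simp only [ord, curve_eq_biquadratic, Nat.cast_eq_one]
  refine vanishingOrder_biquadratic_outer (h := C (1 - X))
    (w := C (C (E.aK L) - C (E.dK L) * X ^ 2) * X * C r + C (1 - X) * C q₂)
    (E.two_ne_zeroK L) one_ne_zero (by simp) (by ring) ?_ ?_ ⟨-C r, ?_⟩
  · have : (1 : L) + 1 ≠ 0 := by rw [one_add_one_eq_two]; exact E.two_ne_zeroK L
    simpa [evalEval] using this
  · have : (1 : L) + 1 ≠ 0 := by rw [one_add_one_eq_two]; exact E.two_ne_zeroK L
    simpa [evalEval] using ⟨this, h2⟩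
  · simp [biquadratic]
    ring

/-- The order at the neutral element of `k x (1 - y) ^ m`. -/
lemma ord_neutral (m : ℕ) {k : L} (hk : k ≠ 0)
    (h : E.aK L * 0 ^ 2 + 1 ^ 2 = 1 + E.dK L * 0 ^ 2 * 1 ^ 2) :
    E.ord (C 0 + X * C (C k * (1 - X) ^ m)) (.affine 0 1 h) = 2 * m + 1 := by
  have key : vanishingOrder (E.curve L) (C 0 + X * C (C k * (1 - X) ^ m)) 0 1 = 2 * m + 1 := by
    rw [curve_eq_biquadratic]
    refine vanishingOrder_biquadratic_outer (h := C ((1 + X) ^ m))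
      (w := C (C k * (C (E.aK L) - C (E.dK L) * X ^ 2) ^ m))
      (E.two_ne_zeroK L) one_ne_zero (by simp) (by ring) ?_ ?_ ?_
    · have : (1 : L) + 1 ≠ 0 := by rw [one_add_one_eq_two]; exact E.two_ne_zeroK L
      simpa [evalEval] using pow_ne_zero m this
    · simpa [evalEval] using ⟨hk, fun h => absurd h (sub_ne_zero.2 (E.aK_ne_dK L))⟩
    · have e : (C ((1 + X) ^ m) * (C 0 + X * C (C k * (1 - X) ^ m)) -
          C (C k * (C (E.aK L) - C (E.dK L) * X ^ 2) ^ m) * X ^ (2 * m + 1) : L[X][X]) =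
          C (C k) * X * (C (1 - X ^ 2) ^ m - (C (C (E.aK L) - C (E.dK L) * X ^ 2) * X ^ 2) ^ m) := by
        rw [show (1 - X ^ 2 : L[X]) = (1 + X) * (1 - X) by ring]
        simp only [C_mul, C_pow, map_zero, zero_add, mul_pow, pow_succ, pow_mul]
        ring
      rw [e]
      refine Dvd.dvd.mul_left (dvd_trans ?_ (sub_dvd_pow_sub_pow _ _ m)) _
      exact ⟨-1, by simp [biquadratic]; ring⟩
  simp only [ord, key]
  push_cast
  ring

lemma ord_inf₁ {y : L} (h : E.dK L * y ^ 2 = E.aK L) (hq : q₂.eval y ≠ 0) :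
    E.ord (C q₁ + X * C q₂) (.inf₁ y h) = -1 := by
  have hq2 : q₂ ≠ 0 := by rintro rfl; simp at hq
  have hy : y ≠ 0 := by
    rintro rfl
    exact E.aK_ne_zero L (by simpa using h.symm)
  have hd : -E.dK L ≠ 0 := neg_ne_zero.2 (E.dK_ne_zero L)
  have hdeg : (C q₁ + X * C q₂ : L[X][X]).natDegree = 1 := by
    rw [add_comm, natDegree_add_C, X_mul_C, natDegree_C_mul_X _ hq2]
  have e1 : vanishingOrder (E.curve L).reverse (C q₁ + X * C q₂ : L[X][X]).reverse 0 y = 0 := by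
    rw [curve_reverse]
    refine vanishingOrder_biquadratic_outer_of_ne (E.two_ne_zeroK L) hd hy
      (by linear_combination -h) ?_
    have hl : (C q₁ + X * C q₂ : L[X][X]).leadingCoeff = q₂ := by
      rw [leadingCoeff, hdeg]; simp
    rwa [evalEval_reverse_zero, hl]
  have e2 : vanishingOrder (E.curve L).reverse X 0 y = 1 := by
    rw [curve_reverse]
    exact vanishingOrder_biquadratic_outer_X (E.two_ne_zeroK L) hd hy (by linear_combination -h)
  simp only [ord, e1, e2, hdeg]
  norm_num

lemma swap_linear : Bivariate.swap (C q₁ + X * C q₂) = q₁.map C + C X * q₂.map C := by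
  rw [map_add, map_mul, Bivariate.swap_C, Bivariate.swap_C, Bivariate.swap_Y]

lemma ord_inf₂ {m : ℕ} (h₁ : q₁.natDegree ≤ m) (h₂ : q₂.natDegree ≤ m)
    {x : L} (h : E.dK L * x ^ 2 = 1) (hq : q₁.coeff m + x * q₂.coeff m ≠ 0) :
    E.ord (C q₁ + X * C q₂) (.inf₂ x h) = -m := by
  have hx : x ≠ 0 := by rintro rfl; simp at h
  have hd : -E.dK L ≠ 0 := neg_ne_zero.2 (E.dK_ne_zero L)
  have hc : (Bivariate.swap (C q₁ + X * C q₂)).coeff m =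
      C (q₁.coeff m) + X * C (q₂.coeff m) := by
    rw [swap_linear]; simp
  have hdeg : (Bivariate.swap (C q₁ + X * C q₂)).natDegree = m := by
    refine natDegree_eq_of_le_of_coeff_ne_zero ?_ ?_
    · rw [swap_linear]
      refine (natDegree_add_le _ _).trans (max_le (natDegree_map_le.trans h₁) ?_)
      exact (natDegree_C_mul_le _ _).trans (natDegree_map_le.trans h₂)
    · rw [hc]
      intro h0
      apply hq
      simpa [mul_comm x] using congr(($h0).eval x)
  have e1 : vanishingOrder (Bivariate.swap (E.curve L)).reverse
      (Bivariate.swap (C q₁ + X * C q₂)).reverse 0 x = 0 := by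
    rw [swap_curve_reverse]
    refine vanishingOrder_biquadratic_outer_of_ne (E.two_ne_zeroK L) hd hx
      (by linear_combination -h) ?_
    rw [evalEval_reverse_zero, leadingCoeff, hdeg, hc]
    simpa [mul_comm x] using hq
  have e2 : vanishingOrder (Bivariate.swap (E.curve L)).reverse X 0 x = 1 := by
    rw [swap_curve_reverse]
    exact vanishingOrder_biquadratic_outer_X (E.two_ne_zeroK L) hd hx (by linear_combination -h)
  simp only [ord, e1, e2, hdeg]
  norm_num

/-- The norm identity expressing that the affine zeros of `(1 + y) r(y) + x q₂(y)` are `(0, -1)`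
and the points `(x i, y i)`. -/
structure NormData {ι : Type*} (s : Finset ι) (x y : ι → L) (r q₂ : L[X]) (m : ℕ) : Prop where
  natDegree_left : ((1 + X) * r).natDegree ≤ m
  natDegree_right : q₂.natDegree ≤ m
  card_eq : s.card = 2 * m + 1
  equation : ∀ i, E.aK L * x i ^ 2 + y i ^ 2 = 1 + E.dK L * x i ^ 2 * y i ^ 2
  norm_eq : ∃ c : L, c ≠ 0 ∧
    (C (E.aK L) - C (E.dK L) * X ^ 2) * ((1 + X) * r) ^ 2 - (1 - X ^ 2) * q₂ ^ 2 =
      C c * (1 + X) * ∏ i ∈ s, (X - C (y i))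
  generic_or_neutral :
    (∀ i ∈ s, x i ≠ 0 ∧ ((1 + X) * r).eval (y i) + x i * q₂.eval (y i) = 0 ∧ q₂.eval (y i) ≠ 0 ∧
      ∀ j ∈ s, y j = y i → x j = x i) ∨
    ((∀ i ∈ s, x i = 0 ∧ y i = 1) ∧ r = 0 ∧ ∃ k : L, k ≠ 0 ∧ q₂ = C k * (1 - X) ^ m)

namespace NormData

variable {E} {ι : Type*} {s : Finset ι} {x y : ι → L} {r : L[X]} {m : ℕ}
  (D : NormData E s x y r q₂ m)
include D

lemma y_ne_neg_one {i : ι} (hi : i ∈ s) : -1 - y i ≠ 0 := by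
  rcases D.generic_or_neutral with H | H
  · have := E.one_add_ne_zero (D.equation i) (H i hi).1
    intro h
    exact this (by linear_combination -h)
  · rw [(H.1 i hi).2]
    intro h
    exact E.two_ne_zeroK L (by linear_combination -h)

lemma norm_div : ∃ c : L, c ≠ 0 ∧
    (C (E.aK L) - C (E.dK L) * X ^ 2) * (1 + X) * r ^ 2 - (1 - X) * q₂ ^ 2 =
      C c * ∏ i ∈ s, (X - C (y i)) := by
  obtain ⟨c, hc, h⟩ := D.norm_eq
  refine ⟨c, hc, ?_⟩
  have h1 : (1 + X : L[X]) ≠ 0 := by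
    rw [add_comm, ← C_1]; exact X_add_C_ne_zero 1
  apply mul_left_cancel₀ h1
  linear_combination h

lemma eval_right_neg_one_ne_zero : q₂.eval (-1) ≠ 0 := by
  obtain ⟨c, hc, h⟩ := D.norm_div
  intro h0
  have := congr(($h).eval (-1))
  simp only [eval_sub, eval_mul, eval_add, eval_pow, eval_C, eval_X, eval_one, h0,
    eval_prod] at this
  refine mul_ne_zero hc (Finset.prod_ne_zero_iff.2 fun i hi => D.y_ne_neg_one hi) ?_
  linear_combination -this

lemma eval_right_ne_zero {z : L} (hz : E.dK L * z ^ 2 = E.aK L) : q₂.eval z ≠ 0 := by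
  obtain ⟨c, hc, h⟩ := D.norm_div
  intro h0
  have := congr(($h).eval z)
  simp only [eval_sub, eval_mul, eval_add, eval_pow, eval_C, eval_X, eval_one, h0,
    eval_prod] at this
  refine mul_ne_zero hc (Finset.prod_ne_zero_iff.2 fun i _ => ?_)
    (by linear_combination (1 + z) * eval z r ^ 2 * (-hz) - this)
  intro hzi
  obtain rfl : z = y i := sub_eq_zero.1 hzi
  exact E.sub_mul_sq_ne_zero (D.equation i) (by linear_combination -hz)

lemma coeff_sq : E.dK L * ((1 + X) * r).coeff m ^ 2 - q₂.coeff m ^ 2 ≠ 0 := by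
  obtain ⟨c, hc, h⟩ := D.norm_eq
  have hA : (C (E.aK L) - C (E.dK L) * X ^ 2).natDegree ≤ 2 := by compute_degree
  have hB : (1 - X ^ 2 : L[X]).natDegree ≤ 2 := by compute_degree
  have hp := natDegree_pow_le_of_le 2 D.natDegree_left
  have hq := natDegree_pow_le_of_le 2 D.natDegree_right
  have hl : (C c * (1 + X) * ∏ i ∈ s, (X - C (y i))).coeff (2 + 2 * m) = c := by
    rw [mul_assoc, coeff_C_mul]
    have hm : ((1 + X) * ∏ i ∈ s, (X - C (y i))).Monic :=
      (by rw [add_comm, ← C_1]; exact monic_X_add_C 1 : (1 + X : L[X]).Monic).mul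
        (monic_prod_X_sub_C y s)
    have hd : ((1 + X) * ∏ i ∈ s, (X - C (y i))).natDegree = 2 + 2 * m := by
      rw [(by rw [add_comm, ← C_1]; exact monic_X_add_C 1 : (1 + X : L[X]).Monic).natDegree_mul
        (monic_prod_X_sub_C y s), natDegree_finsetProd_X_sub_C_eq_card, D.card_eq, add_comm 1 X,
        ← C_1, natDegree_X_add_C]
      ring
    rw [← hd, coeff_natDegree, hm.leadingCoeff, mul_one]
  rw [← h, coeff_sub, coeff_mul_add_eq_of_natDegree_le hA hp, coeff_mul_add_eq_of_natDegree_le hB hq,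
    coeff_pow_of_natDegree_le D.natDegree_left, coeff_pow_of_natDegree_le D.natDegree_right] at hl
  simp [coeff_one] at hl
  intro h0
  apply hc
  rw [← hl]
  linear_combination -h0

lemma coeff_add_ne_zero {z : L} (hz : E.dK L * z ^ 2 = 1) :
    ((1 + X) * r).coeff m + z * q₂.coeff m ≠ 0 := by
  intro h0
  apply D.coeff_sq
  linear_combination E.dK L * (((1 + X) * r).coeff m - z * q₂.coeff m) * h0 +
    q₂.coeff m ^ 2 * hz

lemma max_natDegree_eq : max ((1 + X) * r).natDegree q₂.natDegree = m := by
  refine le_antisymm (max_le D.natDegree_left D.natDegree_right) ?_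
  by_contra! h
  rw [max_lt_iff] at h
  apply D.coeff_sq
  rw [coeff_eq_zero_of_natDegree_lt h.1, coeff_eq_zero_of_natDegree_lt h.2]
  ring

open scoped Classical in
lemma ord_affine {x₀ y₀ : L} (h : E.aK L * x₀ ^ 2 + y₀ ^ 2 = 1 + E.dK L * x₀ ^ 2 * y₀ ^ 2) :
    E.ord (C ((1 + X) * r) + X * C q₂) (.affine x₀ y₀ h) =
      ((s.filter fun i => x i = x₀ ∧ y i = y₀).card : ℤ) +
        if x₀ = 0 ∧ y₀ = -1 then 1 else 0 := by
  have two := E.two_ne_zeroK L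
  have hne : (1 : L) ≠ -1 := fun h => two (by linear_combination h)
  by_cases hx : x₀ = 0
  · subst hx
    have hy : (y₀ - 1) * (y₀ + 1) = 0 := by linear_combination h
    rcases mul_eq_zero.1 hy with hy | hy
    · obtain rfl : y₀ = 1 := by linear_combination hy
      rcases D.generic_or_neutral with H | ⟨H, rfl, k, hk, rfl⟩
      · rw [ord_affine_of_eval_ne_zero, Finset.filter_false_of_mem]
        · simp [hne]
        · exact fun i hi hxi => (H i hi).1 hxi.1
        · obtain ⟨c, hc, h⟩ := D.norm_div
          intro h0
          have e := congr(($h).eval 1)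
          simp only [eval_sub, eval_mul, eval_add, eval_pow, eval_C, eval_X, eval_one,
            eval_prod] at e h0
          refine mul_ne_zero hc (Finset.prod_ne_zero_iff.2 fun i hi =>
            E.one_sub_ne_zero (D.equation i) (H i hi).1) ?_
          linear_combination -e + (E.aK L - E.dK L) * eval 1 r * h0
      · rw [mul_zero, E.ord_neutral m hk, Finset.filter_true_of_mem H, D.card_eq]
        simp [hne]
    · obtain rfl : y₀ = -1 := by linear_combination hy
      rw [ord_O' _ _ D.eval_right_neg_one_ne_zero, Finset.filter_false_of_mem]
      · simp
      · intro i hi hxi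
        apply D.y_ne_neg_one hi
        rw [hxi.2]; ring
  · simp only [hx, false_and, if_false, add_zero]
    rcases D.generic_or_neutral with H | ⟨H, rfl, k, hk, rfl⟩
    · by_cases hf : ((1 + X) * r).eval y₀ + x₀ * q₂.eval y₀ = 0
      · obtain ⟨c, hc, hN⟩ := D.norm_eq
        have hy1 := E.one_add_ne_zero h hx
        obtain ⟨i, hi, hyi⟩ : ∃ i ∈ s, y₀ = y i := by
          have e := congr(($hN).eval y₀)
          have e0 : eval y₀ (C c * (1 + X) * ∏ i ∈ s, (X - C (y i))) = 0 := by
            rw [← e]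
            simp only [eval_sub, eval_mul, eval_add, eval_pow, eval_C, eval_X, eval_one] at hf ⊢
            linear_combination (E.aK L - E.dK L * y₀ ^ 2) *
              ((1 + y₀) * eval y₀ r - x₀ * eval y₀ q₂) * hf + eval y₀ q₂ ^ 2 * h
          simp only [eval_mul, eval_add, eval_C, eval_X, eval_one, eval_prod, mul_eq_zero, hc, hy1,
            false_or, Finset.prod_eq_zero_iff, eval_sub, sub_eq_zero] at e0
          exact e0
        subst hyi
        obtain ⟨hxi, hfi, hqi, hji⟩ := H i hi
        have hxx : x₀ = x i := by
          have : (x₀ - x i) * q₂.eval (y i) = 0 := by linear_combination hf - hfi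
          exact sub_eq_zero.1 ((mul_eq_zero.1 this).resolve_right hqi)
        subst hxx
        rw [E.ord_affine_of_conj_ne_zero (k := (s.filter fun j => y j = y i).card)
          (N := C c * (1 + X) * ∏ j ∈ s.filter (fun j => ¬ y j = y i), (X - C (y j)))]
        · congr 2
          ext j
          simp only [Finset.mem_filter, and_congr_right_iff]
          exact fun hj => ⟨fun e => ⟨hji j hj e, e⟩, fun e => e.2⟩
        · exact hxi
        · intro h0
          refine mul_ne_zero two (mul_ne_zero hxi hqi) ?_
          linear_combination hfi - h0
        · simp only [eval_mul, eval_add, eval_C, eval_X, eval_one, eval_prod, eval_sub]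
          refine mul_ne_zero (mul_ne_zero hc hy1) (Finset.prod_ne_zero_iff.2 fun j hj => ?_)
          exact sub_ne_zero.2 (Ne.symm (Finset.mem_filter.1 hj).2)
        · rw [hN, ← Finset.prod_filter_mul_prod_filter_not s (fun j => y j = y i),
            Finset.prod_congr rfl (g := fun _ => X - C (y i)), Finset.prod_const]
          · ring
          · intro j hj
            rw [(Finset.mem_filter.1 hj).2]
      · rw [E.ord_affine_of_eval_ne_zero h hf, Finset.filter_false_of_mem]
        · simp
        · rintro i hi ⟨rfl, rfl⟩
          exact hf (H i hi).2.1
    · rw [ord_affine_of_eval_ne_zero, Finset.filter_false_of_mem]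
      · simp
      · rintro i hi ⟨rfl, -⟩
        exact hx (H i hi).1
      · simpa using ⟨hx, hk, fun h0 => absurd h0 (E.one_sub_ne_zero h hx)⟩

/-- The divisor of `(1 + y) r(y) + x q₂(y)`. -/
theorem div_eq [IsAlgClosed L] : E.div (C ((1 + X) * r) + X * C q₂) =
    (∑ i ∈ s, Finsupp.single (.affine (x i) (y i) (D.equation i)) 1
      + Finsupp.single E.O' 1 - Finsupp.single .Ω₁ 2 - Finsupp.single .Ω₂ (2 * m : ℤ) :
      E.ProjPoint L →₀ ℤ) := by
  classical
  have two := E.two_ne_zeroK L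
  have hd := E.dK_ne_zero L
  funext Q
  cases Q with
  | affine x₀ y₀ h =>
    have hset : {P : E.Point L | E.toProj P = .affine x₀ y₀ h} = {.affine x₀ y₀ h} := by
      ext P
      cases P <;> simp [toProj]
    have e : E.div (C ((1 + X) * r) + X * C q₂) (.affine x₀ y₀ h) =
        ∑ᶠ (P) (_ : P ∈ {P : E.Point L | E.toProj P = .affine x₀ y₀ h}),
          E.ord (C ((1 + X) * r) + X * C q₂) P := rfl
    rw [e, hset, finsum_mem_singleton, D.ord_affine]
    simp [Finsupp.single_apply, O', eq_comm]
  | Ω₁ =>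
    obtain ⟨z, hz⟩ := IsAlgClosed.exists_pow_nat_eq (E.aK L / E.dK L) (n := 2) (by norm_num)
    have hz1 : E.dK L * z ^ 2 = E.aK L := by rw [hz]; field_simp
    have hz2 : E.dK L * (-z) ^ 2 = E.aK L := by rw [neg_sq, hz1]
    have hz0 : z ≠ 0 := by rintro rfl; exact E.aK_ne_zero L (by simpa using hz1.symm)
    have hset : {P : E.Point L | E.toProj P = .Ω₁} = {.inf₁ z hz1, .inf₁ (-z) hz2} := by
      ext P
      cases P with
      | affine => simp [toProj]
      | inf₂ => simp [toProj]
      | inf₁ w hw =>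
        simp only [toProj, Set.mem_ofPred_eq, true_iff, Set.mem_insert_iff, Point.inf₁.injEq,
          Set.mem_singleton_iff]
        exact sq_eq_sq_iff_eq_or_eq_neg.1 (mul_left_cancel₀ hd (hw.trans hz1.symm))
    have e : E.div (C ((1 + X) * r) + X * C q₂) .Ω₁ =
        ∑ᶠ (P) (_ : P ∈ {P : E.Point L | E.toProj P = .Ω₁}),
          E.ord (C ((1 + X) * r) + X * C q₂) P := rfl
    rw [e, hset, finsum_mem_pair, ord_inf₁ _ _ (D.eval_right_ne_zero hz1),
      ord_inf₁ _ _ (D.eval_right_ne_zero hz2)]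
    · simp [O']
    · rw [Ne, Point.inf₁.injEq]
      intro h
      exact mul_ne_zero two hz0 (by linear_combination h)
  | Ω₂ =>
    obtain ⟨z, hz⟩ := IsAlgClosed.exists_pow_nat_eq (1 / E.dK L) (n := 2) (by norm_num)
    have hz1 : E.dK L * z ^ 2 = 1 := by rw [hz]; field_simp
    have hz2 : E.dK L * (-z) ^ 2 = 1 := by rw [neg_sq, hz1]
    have hz0 : z ≠ 0 := by rintro rfl; simp at hz1
    have hset : {P : E.Point L | E.toProj P = .Ω₂} = {.inf₂ z hz1, .inf₂ (-z) hz2} := by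
      ext P
      cases P with
      | affine => simp [toProj]
      | inf₁ => simp [toProj]
      | inf₂ w hw =>
        simp only [toProj, Set.mem_ofPred_eq, true_iff, Set.mem_insert_iff, Point.inf₂.injEq,
          Set.mem_singleton_iff]
        exact sq_eq_sq_iff_eq_or_eq_neg.1 (mul_left_cancel₀ hd (hw.trans hz1.symm))
    have e : E.div (C ((1 + X) * r) + X * C q₂) .Ω₂ =
        ∑ᶠ (P) (_ : P ∈ {P : E.Point L | E.toProj P = .Ω₂}),
          E.ord (C ((1 + X) * r) + X * C q₂) P := rfl
    rw [e, hset, finsum_mem_pair,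
      ord_inf₂ _ D.natDegree_left D.natDegree_right _ (D.coeff_add_ne_zero hz1),
      ord_inf₂ _ D.natDegree_left D.natDegree_right _ (D.coeff_add_ne_zero hz2)]
    · simp [O']
      ring
    · rw [Ne, Point.inf₂.injEq]
      intro h
      exact mul_ne_zero two hz0 (by linear_combination h)

end NormData

end TwistedEdwards

/-! ### Functions on a Weierstrass curve with prescribed zeros -/

namespace WeierstrassCurve.Affine.CoordinateRing

variable {K : Type*} [Field K] {W : WeierstrassCurve.Affine K}

/-- The right hand side of the equation of a Weierstrass curve with `a₁ = a₃ = 0`. -/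
noncomputable def _root_.WeierstrassCurve.Affine.cubic (W : WeierstrassCurve.Affine K) : K[X] :=
  X ^ 3 + C W.a₂ * X ^ 2 + C W.a₄ * X + C W.a₆

lemma polynomial_eq_sq_sub (h₁ : W.a₁ = 0) (h₃ : W.a₃ = 0) :
    W.polynomial = X ^ 2 - C W.cubic := by
  simp [polynomial, cubic, h₁, h₃]

/-- The endomorphism `Y ↦ ε Y` of the coordinate ring that is semilinear for `φ`. -/
lemma exists_coordinateRing_end (h₁ : W.a₁ = 0) (h₃ : W.a₃ = 0) (φ : K →+* K)
    (hφ : W.cubic.map φ = W.cubic) {ε : K} (hε : ε ^ 2 = 1) :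
    ∃ T : W.CoordinateRing →+* W.CoordinateRing, (∀ p : K[X], T (mk W (C p)) = mk W (C (p.map φ))) ∧
      T (mk W X) = mk W (C (C ε)) * mk W X := by
  have hY : mk W X ^ 2 = mk W (C W.cubic) := by
    rw [← map_pow]
    exact AdjoinRoot.mk_eq_mk.2 (by rw [polynomial_eq_sq_sub h₁ h₃])
  have hε' : mk W (C (C ε)) ^ 2 = 1 := by
    rw [← map_pow, ← C_pow, ← C_pow, hε, C_1, C_1, map_one]
  refine ⟨AdjoinRoot.lift ((AdjoinRoot.of W.polynomial).comp (mapRingHom φ))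
    (mk W (C (C ε)) * mk W X) ?_, fun p => ?_, ?_⟩
  · refine (congrArg (eval₂ _ _) (polynomial_eq_sq_sub h₁ h₃)).trans ?_
    rw [eval₂_sub, eval₂_C, eval₂_X_pow, mul_pow, hY, hε', one_mul, RingHom.comp_apply,
      coe_mapRingHom, hφ]
    exact sub_self _
  · exact AdjoinRoot.lift_of _
  · exact AdjoinRoot.lift_root _

lemma map_XYIdeal {φ : K →+* K} {ε : K} (hε : ε ^ 2 = 1)
    {T : W.CoordinateRing →+* W.CoordinateRing}
    (hC : ∀ p : K[X], T (mk W (C p)) = mk W (C (p.map φ)))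
    (hX : T (mk W X) = mk W (C (C ε)) * mk W X) (x y : K) :
    (XYIdeal W x (C y)).map T = XYIdeal W (φ x) (C (ε * φ y)) := by
  have hε' : mk W (C (C ε)) * mk W (C (C ε)) = 1 := by
    rw [← map_mul, ← C_mul, ← C_mul, ← sq, hε, C_1, C_1, map_one]
  have e1 : T (XClass W x) = XClass W (φ x) := by
    rw [XClass, hC]; simp [XClass]
  have e2 : T (YClass W (C y)) = mk W (C (C ε)) * YClass W (C (ε * φ y)) := by
    rw [YClass, map_sub, map_sub, hC, hX, YClass, map_sub, mul_sub, map_C]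
    congr 1
    rw [C_mul, C_mul, map_mul, ← mul_assoc, hε', one_mul]
  rw [XYIdeal, Ideal.map_span, Set.image_pair, e1, e2, XYIdeal, Ideal.span_insert,
    Ideal.span_insert, Ideal.span_singleton_mul_left_unit (IsUnit.of_mul_eq_one _ hε')]

open scoped Classical in
/-- Points that sum to zero are the zeros of a function. -/
theorem exists_generator {ι : Type*} (s : Finset ι) (x y : ι → K)
    (h : ∀ i, W.Nonsingular (x i) (y i)) (hs : ∑ i ∈ s, Point.some (x i) (y i) (h i) = 0) :
    ∃ g : W.CoordinateRing, g ≠ 0 ∧ ∏ i ∈ s, XYIdeal W (x i) (C (y i)) = Ideal.span {g} := by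
  have h0 : ClassGroup.mk W.FunctionField (∏ i ∈ s, XYIdeal' (h i)) = 1 := by
    have := congr(Additive.toMul (Point.toClass $hs))
    rw [map_sum, toMul_sum] at this
    rw [map_prod]
    exact this
  exact (ClassGroup.mk_eq_one_of_coe_ideal (by
    rw [Units.coe_prod]
    simp only [XYIdeal'_eq]
    exact (map_prod (FractionalIdeal.coeIdealHom _ _) _ _).symm)).1 h0

lemma mk_C_dvd_mk_C {A B : K[X]} (h : mk W (C A) ∣ mk W (C B)) : A ∣ B := by
  obtain ⟨z, hz⟩ := h
  obtain ⟨p, q, rfl⟩ := exists_smul_basis_eq z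
  rw [mul_comm, smul_basis_mul_C] at hz
  have : (p * A - B) • (1 : W.CoordinateRing) + (q * A) • mk W X = 0 := by
    rw [sub_smul, sub_add_eq_add_sub, ← hz, CoordinateRing.smul, mul_one, sub_self]
  exact ⟨p, by linear_combination -(smul_basis_eq_zero this).1⟩

lemma associated_of_span_mk_C_eq {A B : K[X]}
    (h : Ideal.span {mk W (C A)} = Ideal.span {mk W (C B)}) : Associated A B :=
  associated_of_dvd_dvd (mk_C_dvd_mk_C (Ideal.span_singleton_le_span_singleton.1 h.ge))
    (mk_C_dvd_mk_C (Ideal.span_singleton_le_span_singleton.1 h.le))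

lemma norm_eq (h₁ : W.a₁ = 0) (h₃ : W.a₃ = 0) (p q : K[X]) :
    Algebra.norm K[X] (p • (1 : W.CoordinateRing) + q • mk W X) = p ^ 2 - q ^ 2 * W.cubic := by
  rw [norm_smul_basis, h₁, h₃, cubic]
  simp

/-- The norm of the function with zeros at the points `(x i, y i)`. -/
lemma associated_norm (h₁ : W.a₁ = 0) (h₃ : W.a₃ = 0) {ι : Type*} {s : Finset ι} {x y : ι → K}
    (h : ∀ i, W.Nonsingular (x i) (y i)) {p q : K[X]}
    (hg : ∏ i ∈ s, XYIdeal W (x i) (C (y i)) =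
      Ideal.span {p • (1 : W.CoordinateRing) + q • mk W X}) :
    Associated (p ^ 2 - q ^ 2 * W.cubic) (∏ i ∈ s, (X - C (x i))) := by
  obtain ⟨T, hC, hX⟩ := exists_coordinateRing_end h₁ h₃ (RingHom.id K) (by simp)
    (ε := -1) (by ring)
  have hT := congr(($hg).map T)
  have e1 : (∏ i ∈ s, XYIdeal W (x i) (C (y i))).map T =
      ∏ i ∈ s, XYIdeal W (x i) (C (W.negY (x i) (y i))) := by
    refine (map_prod (Ideal.mapHom T) _ _).trans (Finset.prod_congr rfl fun i _ => ?_)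
    refine (map_XYIdeal (ε := -1) (by ring) hC hX _ _).trans ?_
    simp [negY, h₁, h₃]
  apply associated_of_span_mk_C_eq (W := W)
  have e2 : ∏ i ∈ s, XIdeal W (x i) = Ideal.span {mk W (C (∏ i ∈ s, (X - C (x i))))} := by
    rw [map_prod, map_prod, ← Ideal.prod_span_singleton]
    rfl
  rw [← e2, ← Finset.prod_congr rfl fun i _ => XYIdeal_neg_mul (h i), Finset.prod_mul_distrib, hg,
    ← e1, hT, Ideal.map_span, Set.image_singleton, Ideal.span_singleton_mul_span_singleton]
  congr 2
  have hY : mk W X ^ 2 = mk W (C W.cubic) := by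
    rw [← map_pow]
    exact AdjoinRoot.mk_eq_mk.2 (by rw [polynomial_eq_sq_sub h₁ h₃])
  simp only [CoordinateRing.smul, map_add, map_mul, hC, hX, mul_one, map_sub, map_pow, map_neg,
    map_one, Polynomial.map_id]
  linear_combination mk W (C q) ^ 2 * hY

lemma XYIdeal_le_ker {x y : K} (h : W.polynomial.evalEval x y = 0) {I : Ideal W.CoordinateRing}
    (hI : I ≤ XYIdeal W x (C y)) : I ≤ RingHom.ker (AdjoinRoot.evalEval h) := by
  refine hI.trans (Ideal.span_le.2 ?_)
  rintro z (rfl | rfl)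
  · simp only [XClass, SetLike.mem_coe, RingHom.mem_ker, AdjoinRoot.evalEval_mk, evalEval, eval_C,
      eval_sub, eval_X, sub_self]
  · simp only [YClass, SetLike.mem_coe, RingHom.mem_ker, AdjoinRoot.evalEval_mk, evalEval, eval_C,
      eval_sub, eval_X, sub_self, eval_zero]

lemma evalEval_smul_basis {x y : K} (h : W.polynomial.evalEval x y = 0) (p q : K[X]) :
    AdjoinRoot.evalEval h (p • (1 : W.CoordinateRing) + q • mk W X) =
      p.eval x + q.eval x * y := by
  simp only [CoordinateRing.smul, mul_one, map_add, map_mul, AdjoinRoot.evalEval_mk, evalEval,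
    eval_C, eval_X]

lemma eval_eq_zero_of_span_le {x y : K} (h : W.Equation x y) {p q : K[X]}
    (hle : Ideal.span {p • (1 : W.CoordinateRing) + q • mk W X} ≤ XYIdeal W x (C y)) :
    p.eval x + q.eval x * y = 0 := by
  have h' : W.polynomial.evalEval x y = 0 := h
  rw [← evalEval_smul_basis h']
  exact XYIdeal_le_ker h' hle (Ideal.mem_span_singleton_self _)

/-- The function with zeros at the points `P i` does not vanish at `-P j`, unless this is one
of the points. -/
lemma eval_ne_zero_of_neg_notMem (h₁ : W.a₁ = 0) (h₃ : W.a₃ = 0) {ι : Type*} {s : Finset ι}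
    {x y : ι → K} {p q : K[X]}
    (hg : ∏ i ∈ s, XYIdeal W (x i) (C (y i)) =
      Ideal.span {p • (1 : W.CoordinateRing) + q • mk W X}) {i : ι}
    (h : W.Equation (x i) (y i)) (hs : ∀ j ∈ s, x j = x i → y j ≠ -y i) :
    p.eval (x i) - q.eval (x i) * y i ≠ 0 := by
  intro h0
  have h' : W.polynomial.evalEval (x i) (-y i) = 0 := by
    have : W.polynomial.evalEval (x i) (y i) = 0 := h
    rw [polynomial_eq_sq_sub h₁ h₃] at this ⊢
    simpa [evalEval] using this
  have hle : ∏ i ∈ s, XYIdeal W (x i) (C (y i)) ≤ RingHom.ker (AdjoinRoot.evalEval h') := by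
    rw [hg, Ideal.span_le, Set.singleton_subset_iff, SetLike.mem_coe, RingHom.mem_ker,
      evalEval_smul_basis]
    linear_combination h0
  obtain ⟨j, hj, hle⟩ := (Ideal.IsPrime.prod_le (RingHom.ker_isPrime _)).1 hle
  have e1 := hle (Ideal.subset_span (Set.mem_insert _ _))
  have e2 := hle (Ideal.subset_span (Set.mem_insert_of_mem _ rfl))
  simp only [RingHom.mem_ker, XClass, YClass, AdjoinRoot.evalEval_mk, evalEval, eval_C, eval_sub,
    eval_X] at e1 e2
  exact hs j hj (sub_eq_zero.1 e1).symm (sub_eq_zero.1 e2).symm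

lemma natDegree_of_natDegree_norm (h₁ : W.a₁ = 0) (h₃ : W.a₃ = 0) {p q : K[X]} {m : ℕ}
    (h : (p ^ 2 - q ^ 2 * W.cubic).natDegree = 2 * m + 3) :
    q ≠ 0 ∧ q.natDegree = m ∧ p.natDegree ≤ m + 1 := by
  have hd := degree_norm_smul_basis (W' := W) p q
  rw [norm_eq h₁ h₃, degree_eq_natDegree (by rintro h0; simp [h0] at h), h] at hd
  by_cases hp : p = 0 <;> by_cases hq : q = 0
  · simp [hp, hq] at h
  · rw [hp, degree_zero, degree_eq_natDegree hq, two_nsmul, two_nsmul, WithBot.bot_add,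
      max_eq_right bot_le] at hd
    norm_cast at hd
    exact ⟨hq, by omega, by simp [hp]⟩
  · rw [hq, degree_zero, degree_eq_natDegree hp, two_nsmul, two_nsmul, WithBot.bot_add,
      WithBot.bot_add, max_eq_left bot_le] at hd
    norm_cast at hd
    omega
  · rw [degree_eq_natDegree hp, degree_eq_natDegree hq, two_nsmul, two_nsmul] at hd
    obtain ⟨e1, e2⟩ := max_le_iff.1 hd.ge
    have e3 := le_max_iff.1 hd.le
    norm_cast at e1 e2 e3
    exact ⟨hq, by omega, by omega⟩

/-- An element whose norm has small degree is zero. -/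
lemma eq_zero_of_natDegree_lt (h₁ : W.a₁ = 0) (h₃ : W.a₃ = 0) {p q p' q' : K[X]} {m : ℕ}
    (h : (p ^ 2 - q ^ 2 * W.cubic).natDegree = 2 * m + 3)
    (hdvd : p • (1 : W.CoordinateRing) + q • mk W X ∣ p' • (1 : W.CoordinateRing) + q' • mk W X)
    (hp' : p'.natDegree ≤ m + 1) (hq' : q'.degree < m) : p' = 0 ∧ q' = 0 := by
  have hN := map_dvd (Algebra.norm K[X]) hdvd
  by_cases h0 : p' • (1 : W.CoordinateRing) + q' • mk W X = 0
  · exact smul_basis_eq_zero h0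
  exfalso
  have := Module.Finite.of_basis (CoordinateRing.basis W)
  have hd := degree_norm_smul_basis (W' := W) p' q'
  have hN0 : Algebra.norm K[X] (p' • (1 : W.CoordinateRing) + q' • mk W X) ≠ 0 :=
    Algebra.norm_ne_zero_iff.2 h0
  have hle := natDegree_le_of_dvd hN hN0
  rw [norm_eq h₁ h₃, h] at hle
  have hlt : (Algebra.norm K[X] (p' • (1 : W.CoordinateRing) + q' • mk W X)).degree <
      ((2 * m + 3 : ℕ) : WithBot ℕ) := by
    rw [hd, max_lt_iff]
    constructor
    · have : p'.degree ≤ ((m + 1 : ℕ) : WithBot ℕ) := natDegree_le_iff_degree_le.1 hp'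
      rw [two_nsmul]
      refine (add_le_add this this).trans_lt ?_
      norm_cast
      omega
    · by_cases hq0 : q' = 0
      · rw [hq0, degree_zero, two_nsmul, WithBot.bot_add, WithBot.bot_add]
        exact WithBot.bot_lt_coe _
      · rw [degree_eq_natDegree hq0] at hq' ⊢
        rw [two_nsmul]
        norm_cast at hq' ⊢
        omega
  rw [degree_eq_natDegree hN0] at hlt
  norm_cast at hlt
  omega

lemma span_C_mul_smul_basis {c : K} (hc : c ≠ 0) (p q : K[X]) :
    Ideal.span {(C c * p) • (1 : W.CoordinateRing) + (C c * q) • mk W X} =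
      Ideal.span {p • (1 : W.CoordinateRing) + q • mk W X} := by
  have hu : IsUnit (mk W (C (C c))) := by
    refine IsUnit.of_mul_eq_one (mk W (C (C c⁻¹))) ?_
    rw [← map_mul, ← C_mul, ← C_mul, mul_inv_cancel₀ hc, C_1, C_1, map_one]
  have e : (C c * p) • (1 : W.CoordinateRing) + (C c * q) • mk W X =
      mk W (C (C c)) * (p • (1 : W.CoordinateRing) + q • mk W X) := by
    simp only [CoordinateRing.smul, map_mul]
    ring
  rw [e, Ideal.span_singleton_mul_left_unit hu]

/-- Points summing to zero and permuted by the semilinear map `φ` are the zeros of a function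
`p(X) + q(X) Y` whose coefficients are fixed by `φ`. -/
theorem exists_fixed_function (h₁ : W.a₁ = 0) (h₃ : W.a₃ = 0) {ι : Type*} {s : Finset ι}
    {x y : ι → K} (h : ∀ i, W.Nonsingular (x i) (y i)) {g : W.CoordinateRing}
    (hg : ∏ i ∈ s, XYIdeal W (x i) (C (y i)) = Ideal.span {g})
    {m : ℕ} (hm : s.card = 2 * m + 3) (φ : K →+* K) (hφ : W.cubic.map φ = W.cubic)
    (hφs : ∏ i ∈ s, XYIdeal W (φ (x i)) (C (φ (y i))) = ∏ i ∈ s, XYIdeal W (x i) (C (y i))) :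
    ∃ p q : K[X], p.map φ = p ∧ q.map φ = q ∧ q.natDegree = m ∧ p.natDegree ≤ m + 1 ∧
      Associated (p ^ 2 - q ^ 2 * W.cubic) (∏ i ∈ s, (X - C (x i))) ∧
      ∏ i ∈ s, XYIdeal W (x i) (C (y i)) =
        Ideal.span {p • (1 : W.CoordinateRing) + q • mk W X} := by
  obtain ⟨p, q, hq, hg⟩ : ∃ p q : K[X], q.Monic ∧ ∏ i ∈ s, XYIdeal W (x i) (C (y i)) =
        Ideal.span {p • (1 : W.CoordinateRing) + q • mk W X} := by
    obtain ⟨p, q, rfl⟩ := exists_smul_basis_eq g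
    have hd := natDegree_eq_of_degree_eq
      (degree_eq_degree_of_associated (associated_norm h₁ h₃ h hg))
    rw [natDegree_finsetProd_X_sub_C_eq_card, hm] at hd
    obtain ⟨hq, -, -⟩ := natDegree_of_natDegree_norm h₁ h₃ hd
    refine ⟨C q.leadingCoeff⁻¹ * p, C q.leadingCoeff⁻¹ * q, ?_, ?_⟩
    · rw [mul_comm]; exact monic_mul_leadingCoeff_inv hq
    · rw [hg, span_C_mul_smul_basis (inv_ne_zero (leadingCoeff_ne_zero.2 hq))]
  have hA := associated_norm h₁ h₃ h hg
  have hd := natDegree_eq_of_degree_eq (degree_eq_degree_of_associated hA)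
  rw [natDegree_finsetProd_X_sub_C_eq_card, hm] at hd
  obtain ⟨hq0, hqm, hpm⟩ := natDegree_of_natDegree_norm h₁ h₃ hd
  obtain ⟨T, hC, hX⟩ := exists_coordinateRing_end h₁ h₃ φ hφ (ε := 1) (by ring)
  have hT := congr(($hg).map T)
  have e1 : (∏ i ∈ s, XYIdeal W (x i) (C (y i))).map T =
      ∏ i ∈ s, XYIdeal W (φ (x i)) (C (φ (y i))) := by
    refine (map_prod (Ideal.mapHom T) _ _).trans (Finset.prod_congr rfl fun i _ => ?_)
    refine (map_XYIdeal (ε := 1) (by ring) hC hX _ _).trans ?_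
    rw [one_mul]
  rw [e1, hφs, hg, Ideal.map_span, Set.image_singleton] at hT
  have hdvd := Ideal.span_singleton_le_span_singleton.1 hT.ge
  have hTg : T (p • (1 : W.CoordinateRing) + q • mk W X) =
      p.map φ • (1 : W.CoordinateRing) + q.map φ • mk W X := by
    simp only [CoordinateRing.smul, map_add, map_mul, hC, hX, mul_one, map_one, one_mul]
  have hsub := dvd_sub hdvd (dvd_refl (p • (1 : W.CoordinateRing) + q • mk W X))
  rw [hTg, add_sub_add_comm, ← sub_smul, ← sub_smul] at hsub
  obtain ⟨hp', hq'⟩ := eq_zero_of_natDegree_lt h₁ h₃ hd hsub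
    ((natDegree_sub_le _ _).trans (max_le (natDegree_map_le.trans hpm) hpm)) (by
      refine lt_of_lt_of_eq (degree_sub_lt_left (degree_map q φ) (Polynomial.map_ne_zero hq0) ?_) ?_
      · rw [leadingCoeff_map, hq.leadingCoeff, map_one]
      · rw [degree_map, degree_eq_natDegree hq0, hqm])
  exact ⟨p, q, sub_eq_zero.1 hp', sub_eq_zero.1 hq', hqm, hpm, hA, hg⟩

end WeierstrassCurve.Affine.CoordinateRing

/-! ### The trace zero subgroup -/

namespace TwistedEdwards

variable {F : Type*} [Field F] (E : TwistedEdwards F) {K : Type*} [Field K] [Algebra F K]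

/-- The isomorphism with the Weierstrass model as a group homomorphism. -/
noncomputable def toWeierstrassHom : letI := Classical.decEq K
    E.Point K →+ (E.weierstrassK K).Point :=
  letI := Classical.decEq K
  AddMonoidHom.mk' E.toWeierstrass (by convert E.toWeierstrass_add (K := K))

lemma mapFun_id (P : E.Point K) : E.mapFun (AlgHom.id F K) P = P := by
  cases P <;> rfl

lemma mapFun_comp {L M : Type*} [Field L] [Algebra F L] [Field M] [Algebra F M]
    (f : L →ₐ[F] M) (g : K →ₐ[F] L) (P : E.Point K) :
    E.mapFun (f.comp g) P = E.mapFun f (E.mapFun g P) := by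
  cases P <;> rfl

lemma neg_toWeierstrass (P : E.Point K) : E.toWeierstrass (-P) = -E.toWeierstrass P :=
  E.pointEquiv.apply_symm_apply _

lemma two_nsmul_inf₁ {y : K} (h : E.dK K * y ^ 2 = E.aK K) :
    2 • (Point.inf₁ y h : E.Point K) = 0 := by
  have : -(Point.inf₁ y h : E.Point K) = .inf₁ y h := by
    apply E.toWeierstrass_injective
    rw [neg_toWeierstrass]
    simp only [toWeierstrass, WeierstrassCurve.Affine.Point.neg_some, negY_eq, neg_zero]
  rw [two_nsmul]
  nth_rw 1 [← this]
  exact neg_add_cancel _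

lemma two_nsmul_affine_zero {y : K} (h : E.aK K * 0 ^ 2 + y ^ 2 = 1 + E.dK K * 0 ^ 2 * y ^ 2) :
    2 • (Point.affine 0 y h : E.Point K) = 0 := by
  obtain ⟨h', e⟩ := E.twoTorsion_add h h
  rw [two_nsmul, e, zero_eq]
  congr 1
  · ring
  · linear_combination h

lemma four_nsmul_inf₂ {x : K} (h : E.dK K * x ^ 2 = 1) :
    4 • (Point.inf₂ x h : E.Point K) = 0 := by
  classical
  have h2 := E.two_ne_zeroK K
  have had := sub_ne_zero.2 (E.aK_ne_dK K).symm
  have hx : x ≠ 0 := by rintro rfl; simp at h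
  have h0 : E.aK K * 0 ^ 2 + (-1) ^ 2 = 1 + E.dK K * 0 ^ 2 * (-1) ^ 2 := by ring
  have key : 2 • (Point.inf₂ x h : E.Point K) = .affine 0 (-1) h0 := by
    apply E.toWeierstrass_injective
    rw [two_nsmul, toWeierstrass_add, toWeierstrass_O']
    have hY : 2 * (E.dK K - E.aK K) / x ≠ (E.weierstrassK K).negY (E.dK K - E.aK K)
        (2 * (E.dK K - E.aK K) / x) := by
      rw [negY_eq]
      intro h
      refine mul_ne_zero h2 (div_ne_zero (mul_ne_zero h2 had) hx) ?_
      linear_combination h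
    simp only [toWeierstrass]
    rw [WeierstrassCurve.Affine.Point.add_self_of_Y_ne hY]
    have hl := WeierstrassCurve.Affine.slope_of_Y_ne (W := E.weierstrassK K) rfl hY
    rw [eq_div_iff (sub_ne_zero.2 hY), negY_eq] at hl
    have hl' := hl.trans (show _ =
      3 * (E.dK K - E.aK K) ^ 2 + 2 * (2 * (E.aK K + E.dK K)) * (E.dK K - E.aK K) +
        (E.aK K - E.dK K) ^ 2 by
      simp [weierstrass, WeierstrassCurve.baseChange,
        WeierstrassCurve.map, aK, dK, map_ofNat (algebraMap F K) 2])
    have key : ∀ {X Y : K} (hW : (E.weierstrassK K).Nonsingular X Y)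
        (h0 : (E.weierstrassK K).Nonsingular 0 0), X = 0 →
        (WeierstrassCurve.Affine.Point.some X Y hW : (E.weierstrassK K).Point) =
          .some 0 0 h0 := by
      rintro X Y hW h0 rfl
      have := (E.nonsingular_iff _ _).1 hW
      obtain rfl : Y = 0 := by simpa using this
      rfl
    refine key _ _ ?_
    rw [addX_eq]
    generalize (E.weierstrassK K).slope _ _ _ _ = l at hl'
    obtain rfl : l = 2 * E.dK K * x := by
      field_simp at hl'
      refine mul_left_cancel₀ (mul_ne_zero (mul_ne_zero h2 h2) had) ?_
      linear_combination hl'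
    linear_combination 4 * E.dK K * h
  rw [show 4 = 2 * 2 from rfl, mul_nsmul, key, two_nsmul_affine_zero]

variable [Fintype F]

lemma frobenius_apply (P : E.Point K) :
    E.frobenius K P = E.mapFun (FiniteField.frobeniusAlgHom F K) P := rfl

lemma frobenius_pow_apply (i : ℕ) (P : E.Point K) :
    (E.frobenius K ^ i) P = E.mapFun (FiniteField.frobeniusAlgHom F K ^ i) P := by
  induction i with
  | zero => exact (E.mapFun_id P).symm
  | succ i ih =>
    rw [pow_succ', AddMonoid.End.coe_mul, Function.comp_apply, ih, pow_succ']
    exact (E.mapFun_comp _ _ P).symm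

lemma mem_traceZero {P : E.Point K} : P ∈ E.traceZero K ↔
    ∑ i ∈ Finset.range (Module.finrank F K), (E.frobenius K ^ i) P = 0 := by
  rw [traceZero, AddMonoidHom.mem_ker, trace]
  exact Eq.congr_left (AddMonoidHom.finsetSum_apply
    (fun i => (E.frobenius K ^ i : E.Point K →+ E.Point K)) _ P)

lemma frobenius_pow_fixed {P : E.Point K} (h : E.frobenius K P = P) (i : ℕ) :
    (E.frobenius K ^ i) P = P := by
  induction i with
  | zero => rfl
  | succ i ih => rw [pow_succ', AddMonoid.End.coe_mul, Function.comp_apply, ih, h]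

lemma eq_zero_of_fixed (hodd : Odd (Module.finrank F K)) {P : E.Point K}
    (hP : P ∈ E.traceZero K) (h : E.frobenius K P = P) (h4 : 4 • P = 0) : P = 0 := by
  rw [mem_traceZero, Finset.sum_congr rfl fun i _ => E.frobenius_pow_fixed h i,
    Finset.sum_const, Finset.card_range] at hP
  have hcop : Nat.Coprime (Module.finrank F K) 4 :=
    hodd.coprime_two_right.pow_right 2
  have := Nat.dvd_gcd (addOrderOf_dvd_of_nsmul_eq_zero hP) (addOrderOf_dvd_of_nsmul_eq_zero h4)
  rw [hcop.gcd_eq_one, Nat.dvd_one, AddMonoid.addOrderOf_eq_one_iff] at this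
  exact this

variable [FiniteDimensional F K]

lemma frobeniusAlgHom_pow_finrank :
    FiniteField.frobeniusAlgHom F K ^ Module.finrank F K = 1 := by
  have := Module.finite_of_finite F (M := K)
  rw [← FiniteField.orderOf_frobeniusAlgHom, pow_orderOf_eq_one]

lemma frobenius_pow_finrank : E.frobenius K ^ Module.finrank F K = 1 := by
  ext P
  rw [frobenius_pow_apply, frobeniusAlgHom_pow_finrank]
  exact E.mapFun_id P

lemma frobenius_eq_self_of_sq {x : K} (hodd : Odd (Module.finrank F K))
    (h : FiniteField.frobeniusAlgHom F K (x ^ 2) = x ^ 2) (h2 : (2 : K) ≠ 0) :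
    FiniteField.frobeniusAlgHom F K x = x := by
  rw [map_pow] at h
  rcases sq_eq_sq_iff_eq_or_eq_neg.1 h with h | h
  · exact h
  have key : ∀ i, (FiniteField.frobeniusAlgHom F K ^ i) x = (-1) ^ i * x := by
    intro i
    induction i with
    | zero => simp
    | succ i ih =>
      rw [pow_succ', AlgHom.mul_apply, ih, map_mul, h]
      rw [map_pow, map_neg, map_one, pow_succ]
      ring
  have := key (Module.finrank F K)
  rw [frobeniusAlgHom_pow_finrank, hodd.neg_one_pow] at this
  have hx : x = 0 := by
    refine (mul_eq_zero.1 (?_ : 2 * x = 0)).resolve_left h2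
    simp only [AlgHom.one_apply] at this
    linear_combination this
  rw [hx, map_zero]

/-- A nonzero point of trace zero is affine, with nonzero `x`-coordinate. -/
theorem exists_affine_of_mem_traceZero (hodd : Odd (Module.finrank F K)) {P : E.Point K}
    (hP : P ∈ E.traceZero K) (h0 : P ≠ 0) : ∃ x y h, P = .affine x y h ∧ x ≠ 0 := by
  have h2 := E.two_ne_zeroK K
  cases P with
  | affine x y h =>
    refine ⟨x, y, h, rfl, ?_⟩
    rintro rfl
    apply h0
    have h4 : 4 • (Point.affine 0 y h : E.Point K) = 0 := by
      rw [show 4 = 2 * 2 from rfl, mul_nsmul, two_nsmul_affine_zero, nsmul_zero]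
    refine E.eq_zero_of_fixed hodd hP ?_ h4
    have hy : FiniteField.frobeniusAlgHom F K y = y := by
      refine frobenius_eq_self_of_sq hodd ?_ h2
      rw [show y ^ 2 = 1 by linear_combination h, map_one]
    rw [frobenius_apply]
    simp only [mapFun, map_zero, hy]
  | inf₁ y h =>
    refine absurd (E.eq_zero_of_fixed hodd hP ?_ ?_) h0
    · have hy : FiniteField.frobeniusAlgHom F K y = y := by
        refine frobenius_eq_self_of_sq hodd ?_ h2
        have : y ^ 2 = algebraMap F K (E.a / E.d) := by
          rw [map_div₀, eq_div_iff (show algebraMap F K E.d ≠ 0 from E.dK_ne_zero K), mul_comm]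
          exact h
        rw [this, AlgHom.commutes]
      rw [frobenius_apply]
      simp only [mapFun, hy]
    · rw [show 4 = 2 * 2 from rfl, mul_nsmul, two_nsmul_inf₁, nsmul_zero]
  | inf₂ x h =>
    refine absurd (E.eq_zero_of_fixed hodd hP ?_ (E.four_nsmul_inf₂ h)) h0
    have hy : FiniteField.frobeniusAlgHom F K x = x := by
      refine frobenius_eq_self_of_sq hodd ?_ h2
      have : x ^ 2 = algebraMap F K (1 / E.d) := by
        rw [map_div₀, eq_div_iff (show algebraMap F K E.d ≠ 0 from E.dK_ne_zero K), mul_comm,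
          map_one]
        exact h
      rw [this, AlgHom.commutes]
    rw [frobenius_apply]
    simp only [mapFun, hy]

lemma frobenius_pow_ne_neg (hodd : Odd (Module.finrank F K)) {P : E.Point K} (hP : P ≠ -P)
    (i : ℕ) : (E.frobenius K ^ i) P ≠ -P := by
  intro h
  have key : ∀ k, ((E.frobenius K ^ i) ^ k) P = (-1 : ℤ) ^ k • P := by
    intro k
    induction k with
    | zero => simp
    | succ k ih =>
      rw [pow_succ', AddMonoid.End.coe_mul, Function.comp_apply, ih, map_zsmul, h, pow_succ,
        mul_smul, neg_smul, one_smul]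
  have := key (Module.finrank F K)
  rw [← pow_mul, mul_comm, pow_mul, frobenius_pow_finrank, one_pow, hodd.neg_one_pow] at this
  apply hP
  simpa using this

/-- No two points of the Frobenius orbit of `P` are opposite, unless `P` is. -/
lemma frobenius_pow_ne_neg_frobenius_pow (hodd : Odd (Module.finrank F K)) {P : E.Point K}
    (hP : P ≠ -P) (i j : ℕ) : (E.frobenius K ^ i) P ≠ -(E.frobenius K ^ j) P := by
  intro h
  have e : ∀ k, (E.frobenius K ^ (Module.finrank F K * k)) = 1 := by
    intro k
    rw [pow_mul, frobenius_pow_finrank, one_pow]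
  apply E.frobenius_pow_ne_neg hodd hP ((Module.finrank F K * j - j) + i)
  have hpos := Module.finrank_pos (R := F) (M := K)
  rw [pow_add, AddMonoid.End.coe_mul, Function.comp_apply, h, map_neg, ← Function.comp_apply
    (f := (E.frobenius K ^ _ : AddMonoid.End (E.Point K))), ← AddMonoid.End.coe_mul, ← pow_add,
    Nat.sub_add_cancel (Nat.le_mul_of_pos_left j hpos), e]
  rfl

end TwistedEdwards

/-! ### The polynomial attached to a point of trace zero -/

/-- The form of degree `N` in `A` and `B` obtained by homogenizing `p`. -/
noncomputable def Polynomial.homogenizeAt {k : Type*} [Field k] (A B : k[X]) (N : ℕ) (p : k[X]) :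
    k[X] :=
  ∑ j ∈ Finset.range (N + 1), C (p.coeff j) * A ^ j * B ^ (N - j)

section Homogenize

variable {k : Type*} [Field k] {A B : k[X]} {N : ℕ} {p : k[X]}

lemma natDegree_homogenizeAt_le (hA : A.natDegree ≤ 1) (hB : B.natDegree ≤ 1) :
    (homogenizeAt A B N p).natDegree ≤ N := by
  refine natDegree_sum_le_of_forall_le _ _ fun j hj => ?_
  have hj' := Finset.mem_range.1 hj
  calc (C (p.coeff j) * A ^ j * B ^ (N - j)).natDegree
      ≤ (C (p.coeff j) * A ^ j).natDegree + (B ^ (N - j)).natDegree := natDegree_mul_le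
    _ ≤ j * 1 + (N - j) * 1 := add_le_add ((natDegree_C_mul_le _ _).trans
        (natDegree_pow_le_of_le j hA)) (natDegree_pow_le_of_le _ hB)
    _ = N := by omega

lemma map_homogenizeAt {k' : Type*} [Field k'] (f : k →+* k') :
    (homogenizeAt A B N p).map f = homogenizeAt (A.map f) (B.map f) N (p.map f) := by
  simp [homogenizeAt, Polynomial.map_sum]

lemma eval_homogenizeAt (hp : p.natDegree ≤ N) {z w : k}
    (hw : w * B.eval z = A.eval z) :
    (homogenizeAt A B N p).eval z = B.eval z ^ N * p.eval w := by
  rw [eval_eq_sum_range' (Nat.lt_succ_of_le hp), homogenizeAt, eval_finsetSum, Finset.mul_sum]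
  refine Finset.sum_congr rfl fun j hj => ?_
  have hj' : j ≤ N := Nat.le_of_lt_succ (Finset.mem_range.1 hj)
  rw [eval_mul, eval_mul, eval_C, eval_pow, eval_pow, ← hw, mul_pow]
  conv_rhs => rw [← Nat.sub_add_cancel hj', pow_add]
  ring

end Homogenize

namespace TwistedEdwards

variable {F : Type*} [Field F] (E : TwistedEdwards F) {L : Type*} [Field L] [Algebra F L]

/-- The first coordinate on the Weierstrass model. -/
noncomputable def wX (y : L) : L := (E.aK L - E.dK L) * (1 + y) / (1 - y)

/-- The second coordinate on the Weierstrass model. -/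
noncomputable def wY (x y : L) : L := 2 * E.wX y / x

/-- The polynomial `2 (a - d) (1 - y) ^ m q(X)`, where `X = (a - d) (1 + y) / (1 - y)`. -/
noncomputable def leftPoly (m : ℕ) (q : L[X]) : L[X] :=
  C (2 * (E.aK L - E.dK L)) * homogenizeAt (C (E.aK L - E.dK L) * (1 + X)) (1 - X) m q

/-- The polynomial `(1 - y) ^ m p(X)`, where `X = (a - d) (1 + y) / (1 - y)`. -/
noncomputable def rightPoly (m : ℕ) (p : L[X]) : L[X] :=
  homogenizeAt (C (E.aK L - E.dK L) * (1 + X)) (1 - X) m p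

lemma natDegree_rightPoly_le (m : ℕ) (p : L[X]) : (E.rightPoly m p).natDegree ≤ m :=
  natDegree_homogenizeAt_le (by compute_degree) (by compute_degree)

lemma natDegree_leftPoly_le (m : ℕ) (p : L[X]) : (E.leftPoly m p).natDegree ≤ m :=
  (natDegree_C_mul_le _ _).trans (E.natDegree_rightPoly_le m p)

lemma eval_rightPoly {m : ℕ} {p : L[X]} (hp : p.natDegree ≤ m) {z : L} (hz : 1 - z ≠ 0) :
    (E.rightPoly m p).eval z = (1 - z) ^ m * p.eval (E.wX z) := by
  rw [rightPoly, eval_homogenizeAt hp (w := E.wX z)]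
  · simp
  · simp [wX]
    field_simp

lemma eval_leftPoly {m : ℕ} {p : L[X]} (hp : p.natDegree ≤ m) {z : L} (hz : 1 - z ≠ 0) :
    (E.leftPoly m p).eval z = 2 * (E.aK L - E.dK L) * ((1 - z) ^ m * p.eval (E.wX z)) := by
  rw [← E.eval_rightPoly hp hz, leftPoly, eval_mul, eval_C, rightPoly]

lemma cubic_eq : (E.weierstrassK L).cubic =
    X ^ 3 + C (2 * (E.aK L + E.dK L)) * X ^ 2 + C ((E.aK L - E.dK L) ^ 2) * X := by
  simp [WeierstrassCurve.Affine.cubic, weierstrass, WeierstrassCurve.baseChange,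
    WeierstrassCurve.map, aK, dK, map_ofNat (algebraMap F L) 2]

/-- A function `p(X) + q(X) Y` on the Weierstrass model, multiplied by `x (1 - y) ^ m`, becomes
a polynomial with the same zeros and the further zero `(0, -1)`. -/
theorem normData_of_weierstrass [Infinite L] {ι : Type*} {s : Finset ι} {x y : ι → L} {m : ℕ}
    (hs : s.card = 2 * m + 3)
    (hP : ∀ i, E.aK L * x i ^ 2 + y i ^ 2 = 1 + E.dK L * x i ^ 2 * y i ^ 2)
    (hx : ∀ i, x i ≠ 0) (hinj : ∀ i j, y j = y i → x j = x i) {p q : L[X]}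
    (hp : p.natDegree ≤ m + 1) (hq : q.natDegree ≤ m) {c : L} (hc : c ≠ 0)
    (hN : p ^ 2 - q ^ 2 * (E.weierstrassK L).cubic = C c * ∏ i ∈ s, (X - C (E.wX (y i))))
    (h0 : ∀ i ∈ s, p.eval (E.wX (y i)) + q.eval (E.wX (y i)) * E.wY (x i) (y i) = 0)
    (h1 : ∀ i ∈ s, p.eval (E.wX (y i)) - q.eval (E.wX (y i)) * E.wY (x i) (y i) ≠ 0) :
    NormData E s x y (E.leftPoly m q) (E.rightPoly (m + 1) p) (m + 1) := by
  have h2 := E.two_ne_zeroK L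
  have had := sub_ne_zero.2 (E.aK_ne_dK L)
  have hy := fun i => E.one_sub_ne_zero (hP i) (hx i)
  refine ⟨?_, E.natDegree_rightPoly_le _ _, by omega, hP,
    ⟨-c * ∏ i ∈ s, (2 * (E.aK L - E.dK L) / (1 - y i)), ?_, ?_⟩, Or.inl fun i hi => ?_⟩
  · refine natDegree_mul_le.trans ?_
    rw [add_comm m]
    exact add_le_add (by compute_degree) (E.natDegree_leftPoly_le m q)
  · refine mul_ne_zero (neg_ne_zero.2 hc) (Finset.prod_ne_zero_iff.2 fun i _ => ?_)
    exact div_ne_zero (mul_ne_zero h2 had) (hy i)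
  · refine eq_of_infinite_eval_eq _ _ ((Set.finite_singleton (1 : L)).infinite_compl.mono ?_)
    intro z hz
    have hz : 1 - z ≠ 0 := sub_ne_zero.2 (Ne.symm hz)
    have hN' := congr(($hN).eval (E.wX z))
    rw [cubic_eq] at hN'
    simp only [Set.mem_ofPred_eq, eval_sub, eval_mul, eval_add, eval_pow, eval_C, eval_X, eval_one,
      eval_prod, E.eval_leftPoly hq hz, E.eval_rightPoly hp hz] at hN' ⊢
    have e1 : ∀ i, E.wX z - E.wX (y i) =
        2 * (E.aK L - E.dK L) / (1 - y i) * (z - y i) * (1 - z)⁻¹ := by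
      intro i
      have := hy i
      simp only [wX]
      field_simp
      ring
    rw [Finset.prod_congr rfl fun i _ => e1 i, Finset.prod_mul_distrib, Finset.prod_mul_distrib,
      Finset.prod_const, hs] at hN'
    generalize ∏ i ∈ s, (2 * (E.aK L - E.dK L) / (1 - y i)) = A at hN' ⊢
    generalize ∏ i ∈ s, (z - y i) = B at hN' ⊢
    generalize eval (E.wX z) p = u at hN' ⊢
    generalize eval (E.wX z) q = v at hN' ⊢
    have e2 : (u ^ 2 - v ^ 2 * (E.wX z ^ 3 + 2 * (E.aK L + E.dK L) * E.wX z ^ 2 +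
        (E.aK L - E.dK L) ^ 2 * E.wX z)) * (1 - z) ^ (2 * m + 3) = c * (A * B) := by
      have hz' := pow_ne_zero (2 * m + 3) hz
      rw [hN', inv_pow]
      field_simp
    have e3 : (E.wX z ^ 3 + 2 * (E.aK L + E.dK L) * E.wX z ^ 2 +
        (E.aK L - E.dK L) ^ 2 * E.wX z) * (1 - z) ^ 3 =
        4 * (E.aK L - E.dK L) ^ 2 * (1 + z) * (E.aK L - E.dK L * z ^ 2) := by
      simp only [wX]
      field_simp
      ring
    generalize (E.wX z ^ 3 + 2 * (E.aK L + E.dK L) * E.wX z ^ 2 +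
        (E.aK L - E.dK L) ^ 2 * E.wX z) = f at e2 e3
    have e4 : (1 - z) ^ (2 * m + 3) = ((1 - z) ^ m) ^ 2 * (1 - z) ^ 3 := by ring
    rw [e4] at e2
    rw [pow_succ]
    linear_combination -(1 + z) * e2 - (1 + z) * v ^ 2 * ((1 - z) ^ m) ^ 2 * e3
  · have hpi : p.eval (E.wX (y i)) ≠ 0 := by
      intro h
      apply h1 i hi
      linear_combination 2 * h - h0 i hi
    have e := h0 i hi
    refine ⟨hx i, ?_, ?_, fun j _ => hinj i j⟩
    · rw [eval_mul, E.eval_leftPoly hq (hy i), E.eval_rightPoly hp (hy i)]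
      have e3 : E.wY (x i) (y i) * (x i * (1 - y i)) =
          2 * ((E.aK L - E.dK L) * (1 + y i)) := by
        have := hx i
        have := hy i
        simp only [wY, wX]
        field_simp
      simp only [eval_add, eval_one, eval_X]
      linear_combination x i * (1 - y i) ^ (m + 1) * e - 
        eval (E.wX (y i)) q * (1 - y i) ^ m * e3
    · rw [E.eval_rightPoly hp (hy i)]
      exact mul_ne_zero (pow_ne_zero _ (hy i)) hpi

lemma map_rightPoly (m : ℕ) (p : F[X]) :
    (E.rightPoly m p).map (algebraMap F L) = E.rightPoly m (p.map (algebraMap F L)) := by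
  simp [rightPoly, map_homogenizeAt, aK, dK]

lemma map_leftPoly (m : ℕ) (p : F[X]) :
    (E.leftPoly m p).map (algebraMap F L) = E.leftPoly m (p.map (algebraMap F L)) := by
  simp [leftPoly, map_homogenizeAt, aK, dK, map_ofNat (algebraMap F L) 2]

lemma NormData.scale {E : TwistedEdwards F} {ι : Type*} {s : Finset ι} {x y : ι → L}
    {r q₂ : L[X]} {m : ℕ} (D : NormData E s x y r q₂ m) {c : L} (hc : c ≠ 0) :
    NormData E s x y (C c * r) (C c * q₂) m := by
  refine ⟨?_, (natDegree_C_mul_le _ _).trans D.natDegree_right, D.card_eq, D.equation, ?_, ?_⟩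
  · rw [mul_left_comm]
    exact (natDegree_C_mul_le _ _).trans D.natDegree_left
  · obtain ⟨k, hk, h⟩ := D.norm_eq
    refine ⟨c ^ 2 * k, mul_ne_zero (pow_ne_zero 2 hc) hk, ?_⟩
    rw [C_mul, C_pow]
    linear_combination C c ^ 2 * h
  · refine D.generic_or_neutral.imp (fun H i hi => ?_) ?_
    · obtain ⟨h1, h2, h3, h4⟩ := H i hi
      refine ⟨h1, ?_, ?_, h4⟩
      · rw [mul_left_comm, eval_mul, eval_C_mul, eval_C]
        linear_combination c * h2
      · rw [eval_C_mul]
        exact mul_ne_zero hc h3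
    · rintro ⟨H, rfl, k, hk, rfl⟩
      exact ⟨H, mul_zero _, c * k, mul_ne_zero hc hk, by rw [C_mul, mul_assoc]⟩

variable {K : Type*} [Field K] [Algebra F K] [Fintype F] [FiniteDimensional F K]

omit [FiniteDimensional F K] in
lemma mem_range_algebraMap_of_frobenius_eq {c : K}
    (h : FiniteField.frobeniusAlgHom F K c = c) : c ∈ Set.range (algebraMap F K) := by
  classical
  have h1 : 1 < Fintype.card F := Fintype.one_lt_card
  have h0 : (X ^ Fintype.card F - X : K[X]) ≠ 0 := FiniteField.X_pow_card_sub_X_ne_zero K h1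
  by_contra hc
  have hsub : insert c (Finset.univ.image (algebraMap F K)) ⊆
      (X ^ Fintype.card F - X : K[X]).roots.toFinset := by
    intro z hz
    rw [Multiset.mem_toFinset, mem_roots h0, IsRoot, eval_sub, eval_pow, eval_X, sub_eq_zero]
    rcases Finset.mem_insert.1 hz with rfl | hz
    · exact h
    · obtain ⟨w, -, rfl⟩ := Finset.mem_image.1 hz
      rw [← map_pow, FiniteField.pow_card]
  have hcard := (Finset.card_le_card hsub).trans ((Multiset.toFinset_card_le _).trans
    (card_roots' _))
  rw [FiniteField.X_pow_card_sub_X_natDegree_eq K h1, Finset.card_insert_of_notMem (by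
    simpa using fun x hx => hc ⟨x, hx⟩),
    Finset.card_image_of_injective _ (algebraMap F K).injective, Finset.card_univ] at hcard
  omega

omit [FiniteDimensional F K] in
lemma exists_map_eq_of_map_frobenius_eq {p : K[X]}
    (h : p.map (FiniteField.frobeniusAlgHom F K : K →+* K) = p) :
    ∃ p₀ : F[X], p₀.map (algebraMap F K) = p := by
  refine (Polynomial.mem_lifts p).1 ((lifts_iff_coeff_lifts p).2 fun i => ?_)
  have hi := congr(($h).coeff i)
  rw [coeff_map] at hi
  exact mem_range_algebraMap_of_frobenius_eq hi

@[to_additive]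
lemma prod_range_succ_eq_of_periodic {M : Type*} [CommMonoid M] {f : ℕ → M} {n : ℕ}
    (h : f n = f 0) : ∏ i ∈ Finset.range n, f (i + 1) = ∏ i ∈ Finset.range n, f i := by
  cases n with
  | zero => rfl
  | succ n => rw [Finset.prod_range_succ, h, ← Finset.prod_range_succ' f]

/-- The function on the Weierstrass model attached to a nonzero point of trace zero. -/
theorem exists_weierstrass_function {m : ℕ} (hn : Module.finrank F K = 2 * m + 3) {x y : K}
    (h : E.aK K * x ^ 2 + y ^ 2 = 1 + E.dK K * x ^ 2 * y ^ 2) (hx : x ≠ 0)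
    (hP : (Point.affine x y h : E.Point K) ∈ E.traceZero K) {xs ys : ℕ → K}
    (hxs : ∀ i, xs i = (FiniteField.frobeniusAlgHom F K ^ i) x)
    (hys : ∀ i, ys i = (FiniteField.frobeniusAlgHom F K ^ i) y)
    (hopp : ∀ i j, ys j = ys i → xs j = xs i) :
    ∃ p q : F[X], p.natDegree ≤ m + 1 ∧ q.natDegree ≤ m ∧
      (∃ c : K, c ≠ 0 ∧ p.map (algebraMap F K) ^ 2 -
        q.map (algebraMap F K) ^ 2 * (E.weierstrassK K).cubic =
        C c * ∏ i ∈ Finset.range (Module.finrank F K), (X - C (E.wX (ys i)))) ∧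
      (∀ i ∈ Finset.range (Module.finrank F K), (p.map (algebraMap F K)).eval (E.wX (ys i)) +
        (q.map (algebraMap F K)).eval (E.wX (ys i)) * E.wY (xs i) (ys i) = 0) ∧
      (∀ i ∈ Finset.range (Module.finrank F K), (p.map (algebraMap F K)).eval (E.wX (ys i)) -
        (q.map (algebraMap F K)).eval (E.wX (ys i)) * E.wY (xs i) (ys i) ≠ 0) := by
  classical
  set ψ := FiniteField.frobeniusAlgHom F K with hψ
  have h2 := E.two_ne_zeroK K
  have had := sub_ne_zero.2 (E.aK_ne_dK K)
  have hE : ∀ i, E.aK K * xs i ^ 2 + ys i ^ 2 = 1 + E.dK K * xs i ^ 2 * ys i ^ 2 := by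
    intro i
    have := congr_arg (ψ ^ i) h
    simpa only [aK, dK, hxs, hys, map_add, map_mul, map_pow, map_one, AlgHom.commutes] using this
  have hxi : ∀ i, xs i ≠ 0 := fun i => by rw [hxs]; exact (_root_.map_ne_zero _).2 hx
  have hW : ∀ i, (E.weierstrassK K).Nonsingular (E.wX (ys i)) (E.wY (xs i) (ys i)) :=
    fun i => E.affine_nonsingular (hE i) (hxi i)
  have hpt : ∀ i, E.toWeierstrass ((E.frobenius K ^ i) (.affine x y h)) =
      .some _ _ (hW i) := by
    intro i
    rw [frobenius_pow_apply, mapFun]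
    refine Eq.trans ?_ (E.toWeierstrass_of_ne (hE i) (hxi i))
    simp only [hxs, hys, hψ]
  have hsum : ∑ i ∈ Finset.range (Module.finrank F K),
      WeierstrassCurve.Affine.Point.some _ _ (hW i) = 0 := by
    rw [mem_traceZero] at hP
    have := congr(E.toWeierstrassHom $hP)
    rw [map_sum, map_zero] at this
    rw [← Finset.sum_congr rfl fun i _ => hpt i]
    convert this
    rfl
  obtain ⟨g, -, hg⟩ := WeierstrassCurve.Affine.CoordinateRing.exists_generator _ _ _ hW hsum
  have a1 : (E.weierstrassK K).a₁ = 0 := by simp [weierstrass]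
  have a3 : (E.weierstrassK K).a₃ = 0 := by simp [weierstrass]
  have hψW : ∀ i, ψ (E.wX (ys i)) = E.wX (ys (i + 1)) ∧
      ψ (E.wY (xs i) (ys i)) = E.wY (xs (i + 1)) (ys (i + 1)) := by
    intro i
    have e1 : ψ (xs i) = xs (i + 1) := by rw [hxs, hxs, pow_succ']; rfl
    have e2 : ψ (ys i) = ys (i + 1) := by rw [hys, hys, pow_succ']; rfl
    constructor
    · simp only [wX, aK, dK, map_div₀, map_mul, map_sub, map_add, map_one, AlgHom.commutes, e2]
    · simp only [wY, wX, aK, dK, map_div₀, map_mul, map_sub, map_add, map_one, AlgHom.commutes,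
        e1, e2, map_ofNat ψ 2]
  have hcub : (E.weierstrassK K).cubic.map (ψ : K →+* K) = (E.weierstrassK K).cubic := by
    rw [cubic_eq]
    simp [aK, dK, map_ofNat ψ 2]
  obtain ⟨p, q, hp, hq, hqm, hpm, hA, hI⟩ :=
    WeierstrassCurve.Affine.CoordinateRing.exists_fixed_function a1 a3 hW hg
      (m := m) (by rw [Finset.card_range, hn]) (ψ : K →+* K) hcub (by
        simp only [RingHom.coe_coe, hψW]
        refine prod_range_succ_eq_of_periodic (f := fun i =>
          WeierstrassCurve.Affine.CoordinateRing.XYIdeal (E.weierstrassK K) (E.wX (ys i))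
            (C (E.wY (xs i) (ys i)))) ?_
        have e1 : xs (Module.finrank F K) = xs 0 := by
          rw [hxs, hxs, hψ, frobeniusAlgHom_pow_finrank, pow_zero]
        have e2 : ys (Module.finrank F K) = ys 0 := by
          rw [hys, hys, hψ, frobeniusAlgHom_pow_finrank, pow_zero]
        simp only [e1, e2])
  obtain ⟨p₀, rfl⟩ := exists_map_eq_of_map_frobenius_eq hp
  obtain ⟨q₀, rfl⟩ := exists_map_eq_of_map_frobenius_eq hq
  rw [natDegree_map] at hqm hpm
  refine ⟨p₀, q₀, hpm, hqm.le, ?_, fun i hi => ?_, fun i hi => ?_⟩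
  · obtain ⟨u, hu⟩ := hA.symm
    obtain ⟨c, hc, hcu⟩ := Polynomial.isUnit_iff.1 u.isUnit
    exact ⟨c, hc.ne_zero, by rw [← hu, ← hcu, mul_comm]⟩
  · have hle : Ideal.span {p₀.map (algebraMap F K) • (1 : (E.weierstrassK K).CoordinateRing) +
        q₀.map (algebraMap F K) • WeierstrassCurve.Affine.CoordinateRing.mk (E.weierstrassK K) X} ≤
        WeierstrassCurve.Affine.CoordinateRing.XYIdeal (E.weierstrassK K) (E.wX (ys i))
            (C (E.wY (xs i) (ys i))) := by
      rw [← hI]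
      exact Ideal.prod_le_inf.trans (Finset.inf_le hi)
    exact WeierstrassCurve.Affine.CoordinateRing.eval_eq_zero_of_span_le (hW i).1 hle
  · refine WeierstrassCurve.Affine.CoordinateRing.eval_ne_zero_of_neg_notMem a1 a3 hI
      (x := fun i => E.wX (ys i)) (y := fun i => E.wY (xs i) (ys i)) (hW i).1 ?_
    intro j _ hXj hYj
    have hyj := E.one_sub_ne_zero (hE j) (hxi j)
    have hyi := E.one_sub_ne_zero (hE i) (hxi i)
    have hyy : ys j = ys i := by
      simp only [wX] at hXj
      field_simp at hXj
      refine mul_left_cancel₀ h2 ?_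
      linear_combination hXj
    have hxx := hopp i j hyy
    rw [hyy, hxx] at hYj
    have h0 : 2 * E.wY (xs i) (ys i) = 0 := by linear_combination hYj
    refine mul_ne_zero h2 (div_ne_zero (mul_ne_zero h2 (div_ne_zero (mul_ne_zero had ?_) hyi))
      (hxi i)) h0
    exact E.one_add_ne_zero (hE i) (hxi i)

end TwistedEdwards

namespace TwistedEdwards

variable {F : Type*} [Field F] (E : TwistedEdwards F)

section Map

variable {K L : Type*} [Field K] [Algebra F K] [Field L] [Algebra F L] [Algebra K L]
  [IsScalarTower F K L]

lemma algebraMap_aK : algebraMap K L (E.aK K) = E.aK L :=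
  (IsScalarTower.algebraMap_apply F K L _).symm

lemma algebraMap_dK : algebraMap K L (E.dK K) = E.dK L :=
  (IsScalarTower.algebraMap_apply F K L _).symm

lemma algebraMap_wX (y : K) : algebraMap K L (E.wX y) = E.wX (algebraMap K L y) := by
  simp [wX, algebraMap_aK, algebraMap_dK]

lemma algebraMap_wY (x y : K) :
    algebraMap K L (E.wY x y) = E.wY (algebraMap K L x) (algebraMap K L y) := by
  simp [wY, algebraMap_wX, map_ofNat (algebraMap K L) 2]

lemma map_cubic : (E.weierstrassK K).cubic.map (algebraMap K L) = (E.weierstrassK L).cubic := by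
  rw [cubic_eq, cubic_eq]
  simp [algebraMap_aK, algebraMap_dK, map_ofNat (algebraMap K L) 2]

end Map

lemma normData_neutral {L : Type*} [Field L] [Algebra F L] {ι : Type*} {s : Finset ι} {m : ℕ}
    (hs : s.card = 2 * m + 1) :
    NormData E s (fun _ => (0 : L)) (fun _ => 1) 0 ((X - C 1) ^ m) m := by
  refine ⟨by simp, ?_, hs, fun _ => by ring, ⟨1, one_ne_zero, ?_⟩, Or.inr ⟨fun _ _ => ⟨rfl, rfl⟩,
    rfl, (-1) ^ m, by simp, ?_⟩⟩
  · rw [natDegree_pow, natDegree_X_sub_C, mul_one]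
  · rw [Finset.prod_const, hs, C_1, pow_succ _ (2 * m), mul_comm 2 m, pow_mul]
    ring
  · rw [C_pow, ← mul_pow, C_neg, C_1]
    ring

variable {K : Type*} [Field K] [Algebra F K] [Fintype F] [FiniteDimensional F K]

/-- The polynomial attached to a point of trace zero. -/
theorem exists_normData {m : ℕ} (hn : Module.finrank F K = 2 * m + 3) {P : E.Point K}
    (hP : P ∈ E.traceZero K) :
    ∃ (r q₂ : F[X]) (xs ys : ℕ → AlgebraicClosure K)
      (D : NormData E (Finset.range (2 * m + 3)) xs ys
        (r.map (algebraMap F (AlgebraicClosure K)))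
        (q₂.map (algebraMap F (AlgebraicClosure K))) (m + 1)),
      r.natDegree ≤ m ∧ q₂.Monic ∧
      ∀ i, E.toProj (E.map (IsScalarTower.toAlgHom F K (AlgebraicClosure K))
        ((E.frobenius K ^ i) P)) = .affine (xs i) (ys i) (D.equation i) := by
  have hodd : Odd (Module.finrank F K) := ⟨m + 1, by omega⟩
  by_cases h0 : P = 0
  · subst h0
    have D := E.normData_neutral (L := AlgebraicClosure K) (s := Finset.range (2 * m + 3))
      (m := m + 1) (by rw [Finset.card_range]; ring)
    refine ⟨0, (X - C 1) ^ (m + 1), fun _ => 0, fun _ => 1, by simpa using D, by simp,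
      (monic_X_sub_C 1).pow _, fun i => ?_⟩
    rw [map_zero, map_zero, zero_eq]
    rfl
  obtain ⟨x, y, h, rfl, hx⟩ := E.exists_affine_of_mem_traceZero hodd hP h0
  set ψ := FiniteField.frobeniusAlgHom F K with hψ
  have h2 := E.two_ne_zeroK K
  have hne : (Point.affine x y h : E.Point K) ≠ -.affine x y h := by
    rw [neg_affine]
    intro e
    have hxx := (Point.affine.inj e).1
    exact mul_ne_zero h2 hx (by linear_combination hxx)
  have hE : ∀ i, E.aK K * (ψ ^ i) x ^ 2 + (ψ ^ i) y ^ 2 =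
      1 + E.dK K * (ψ ^ i) x ^ 2 * (ψ ^ i) y ^ 2 := by
    intro i
    have := congr_arg (ψ ^ i) h
    simpa only [aK, dK, map_add, map_mul, map_pow, map_one, AlgHom.commutes] using this
  have hpt : ∀ i, (E.frobenius K ^ i) (.affine x y h) = .affine _ _ (hE i) := by
    intro i
    rw [frobenius_pow_apply, mapFun]
  have hxi : ∀ i, (ψ ^ i) x ≠ 0 := fun i => (_root_.map_ne_zero _).2 hx
  have hopp : ∀ i j, (ψ ^ j) y = (ψ ^ i) y → (ψ ^ j) x = (ψ ^ i) x := by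
    intro i j hy
    rcases E.eq_or_eq_neg (hE i) (hE j) (hxi i) (by rw [hy]) with e | e
    · exact e
    · refine absurd ?_ (E.frobenius_pow_ne_neg_frobenius_pow hodd hne j i)
      rw [hpt, hpt, neg_affine]
      simp only [e, hy]
  obtain ⟨p, q, hp, hq, ⟨c, hc, hN⟩, hv, hnv⟩ := E.exists_weierstrass_function hn h hx hP
    (fun i => rfl) (fun i => rfl) hopp
  rw [hn] at hN hv hnv
  let L := AlgebraicClosure K
  have hmap : ∀ f : F[X], f.map (algebraMap F L) = (f.map (algebraMap F K)).map (algebraMap K L) :=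
    fun f => by rw [Polynomial.map_map, ← IsScalarTower.algebraMap_eq]
  have hinj := (algebraMap K L).injective
  have D : NormData E (Finset.range (2 * m + 3)) (fun i => algebraMap K L ((ψ ^ i) x))
      (fun i => algebraMap K L ((ψ ^ i) y)) (E.leftPoly m (q.map (algebraMap F L)))
      (E.rightPoly (m + 1) (p.map (algebraMap F L))) (m + 1) := by
    refine E.normData_of_weierstrass (by simp) ?_ ?_ ?_ (by rwa [natDegree_map])
      (by rwa [natDegree_map]) (c := algebraMap K L c) ((_root_.map_ne_zero _).2 hc) ?_ ?_ ?_
    · intro i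
      have := congr_arg (algebraMap K L) (hE i)
      simpa only [map_add, map_mul, map_pow, map_one, algebraMap_aK, algebraMap_dK] using this
    · exact fun i => (_root_.map_ne_zero _).2 (hxi i)
    · exact fun i j e => congr_arg _ (hopp i j (hinj e))
    · have := congr(($hN).map (algebraMap K L))
      rw [hmap, hmap, ← E.map_cubic (K := K)]
      simpa [Polynomial.map_prod, algebraMap_wX] using this
    · intro i hi
      rw [hmap, hmap, ← algebraMap_wX, ← algebraMap_wY, eval_map_apply, eval_map_apply, ← map_mul,
        ← map_add, hv i hi, map_zero]
    · intro i hi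
      rw [hmap, hmap, ← algebraMap_wX, ← algebraMap_wY, eval_map_apply, eval_map_apply, ← map_mul,
        ← map_sub]
      exact (_root_.map_ne_zero _).2 (hnv i hi)
  rw [← map_leftPoly, ← map_rightPoly] at D
  have hq₂ : E.rightPoly (m + 1) p ≠ 0 := by
    intro e
    apply D.eval_right_neg_one_ne_zero
    rw [e]
    simp
  have hl := inv_ne_zero (leadingCoeff_ne_zero.2 hq₂)
  have D' := D.scale (c := algebraMap F L (E.rightPoly (m + 1) p).leadingCoeff⁻¹)
    ((_root_.map_ne_zero _).2 hl)
  rw [← map_C, ← Polynomial.map_mul, ← Polynomial.map_mul] at D'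
  refine ⟨_, _, _, _, D', (natDegree_C_mul_le _ _).trans (E.natDegree_leftPoly_le m q), ?_,
    fun i => ?_⟩
  · rw [mul_comm]
    exact monic_mul_leadingCoeff_inv hq₂
  · rw [hpt]
    rfl

/-- The polynomial attached to a point of trace zero, and its divisor. -/
theorem exists_polynomial {m : ℕ} (hn : Module.finrank F K = 2 * m + 3) {P : E.Point K}
    (hP : P ∈ E.traceZero K) :
    ∃ r q₂ : F[X], E.div (linearInX K ((1 + X) * r) q₂) = E.traceDivisor P ∧
      max ((1 + X) * r).natDegree q₂.natDegree = m + 1 ∧ r.natDegree ≤ m ∧ q₂.Monic := by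
  obtain ⟨r, q₂, xs, ys, D, hr, hq, hpt⟩ := E.exists_normData hn hP
  refine ⟨r, q₂, ?_, ?_, hr, hq⟩
  · have e : linearInX K ((1 + X) * r) q₂ =
        C ((1 + X) * r.map (algebraMap F (AlgebraicClosure K))) +
          X * C (q₂.map (algebraMap F (AlgebraicClosure K))) := by
      simp [linearInX]
    rw [e, D.div_eq, traceDivisor, hn]
    simp only [hpt]
    congr 3
    push_cast
    ring
  · have := D.max_natDegree_eq
    rw [← natDegree_map (algebraMap F (AlgebraicClosure K)),
      ← natDegree_map (algebraMap F (AlgebraicClosure K)) (p := q₂)]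
    simpa using this

end TwistedEdwards

/-! ### A lower bound for the number of points, by the method of auxiliary polynomials -/

section Stepanov

variable {K : Type*} [Field K]

/-- The operator `s ↦ f s' + c f' s`. -/
noncomputable def twistedDerivative (f : K[X]) (c : K) : K[X] →ₗ[K] K[X] :=
  LinearMap.mulLeft K f ∘ₗ derivative + LinearMap.mulLeft K (C c * derivative f)

lemma twistedDerivative_apply (f : K[X]) (c : K) (s : K[X]) :
    twistedDerivative f c s = f * derivative s + C c * derivative f * s := rfl

lemma natDegree_twistedDerivative_le {f : K[X]} (hf : f.natDegree ≤ 3) (c : K) {s : K[X]} {N : ℕ}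
    (hs : s.natDegree ≤ N) : (twistedDerivative f c s).natDegree ≤ N + 2 := by
  rw [twistedDerivative_apply]
  refine natDegree_add_le_of_degree_le ?_ ?_
  · by_cases h0 : s.natDegree = 0
    · rw [natDegree_eq_zero.1 h0 |>.choose_spec.symm]
      simp
    · have := natDegree_derivative_le s
      refine natDegree_mul_le.trans ?_
      omega
  · have := natDegree_derivative_le f
    have := natDegree_C_mul_le c (derivative f)
    refine natDegree_mul_le.trans ?_
    omega

/-- The difference, on the set where `f ^ h = -1` and `x ^ q = x`, of the parts of an auxiliary
polynomial. -/
noncomputable def auxReduce (u v : K[X] →ₗ[K] K[X]) :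
    (Fin 4 → degreeLT K 10) →ₗ[K] K[X] :=
  let π (i : Fin 4) : (Fin 4 → degreeLT K 10) →ₗ[K] K[X] :=
    (degreeLT K 10).subtype ∘ₗ LinearMap.proj i
  (u ∘ₗ π 0 - v ∘ₗ π 1) + LinearMap.mulLeft K X ∘ₗ (u ∘ₗ π 2 - v ∘ₗ π 3)

lemma auxReduce_apply (u v : K[X] →ₗ[K] K[X]) (w : Fin 4 → degreeLT K 10) :
    auxReduce u v w = (u (w 0) - v (w 1)) + X * (u (w 2) - v (w 3)) := rfl

lemma natDegree_of_mem_degreeLT_ten (p : degreeLT K 10) : (p : K[X]).natDegree ≤ 9 := by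
  have := mem_degreeLT.1 p.2
  exact natDegree_le_of_degree_le (Order.le_of_lt_succ this)

lemma natDegree_auxReduce_le {u v : K[X] →ₗ[K] K[X]} {N : ℕ}
    (hu : ∀ p : degreeLT K 10, (u p).natDegree ≤ N) (hv : ∀ p : degreeLT K 10, (v p).natDegree ≤ N)
    (w : Fin 4 → degreeLT K 10) : (auxReduce u v w).natDegree ≤ N + 1 := by
  rw [auxReduce_apply]
  have h1 := (natDegree_sub_le (u (w 0)) (v (w 1))).trans (max_le (hu _) (hv _))
  have h2 := (natDegree_sub_le (u (w 2)) (v (w 3))).trans (max_le (hu _) (hv _))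
  refine natDegree_add_le_of_degree_le (h1.trans N.le_succ) ?_
  refine natDegree_mul_le.trans ?_
  rw [natDegree_X]
  omega

/-- There are auxiliary polynomials satisfying the linear conditions. -/
lemma exists_aux {f : K[X]} (hf : f.natDegree ≤ 3) (c : K) :
    ∃ w : Fin 4 → degreeLT K 10, w ≠ 0 ∧ auxReduce LinearMap.id LinearMap.id w = 0 ∧
      auxReduce (twistedDerivative f 0) (twistedDerivative f c) w = 0 ∧
      auxReduce (twistedDerivative f 0 ∘ₗ twistedDerivative f 0)
        (twistedDerivative f c ∘ₗ twistedDerivative f c) w = 0 := by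
  let co (N : ℕ) : K[X] →ₗ[K] (Fin N → K) := LinearMap.pi fun i => lcoeff K i
  have hco : ∀ {N : ℕ} {p : K[X]}, p.natDegree < N → co N p = 0 → p = 0 := by
    intro N p hp h
    ext i
    by_cases hi : i < N
    · exact congr_fun h ⟨i, hi⟩
    · rw [coeff_eq_zero_of_natDegree_lt (by omega), coeff_zero]
  let Φ : (Fin 4 → degreeLT K 10) →ₗ[K] (Fin 11 → K) × (Fin 13 → K) × (Fin 15 → K) :=
    (co 11 ∘ₗ auxReduce LinearMap.id LinearMap.id).prod
      ((co 13 ∘ₗ auxReduce (twistedDerivative f 0) (twistedDerivative f c)).prod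
        (co 15 ∘ₗ auxReduce (twistedDerivative f 0 ∘ₗ twistedDerivative f 0)
          (twistedDerivative f c ∘ₗ twistedDerivative f c)))
  have : Module.Finite K (degreeLT K 10) := Module.Finite.equiv (degreeLTEquiv K 10).symm
  have hdim : Module.finrank K (degreeLT K 10) = 10 := by
    rw [(degreeLTEquiv K 10).finrank_eq, Module.finrank_fin_fun]
  have hker : LinearMap.ker Φ ≠ ⊥ := by
    apply LinearMap.ker_ne_bot_of_finrank_lt
    rw [Module.finrank_pi_fintype, Module.finrank_prod, Module.finrank_prod]
    simp [hdim]
  obtain ⟨w, hw, hw0⟩ := Submodule.exists_mem_ne_zero_of_ne_bot hker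
  have hΦ : Φ w = 0 := hw
  have h9 := natDegree_of_mem_degreeLT_ten (K := K)
  have hD : ∀ (c : K) (p : degreeLT K 10), (twistedDerivative f c p).natDegree ≤ 11 :=
    fun c p => natDegree_twistedDerivative_le hf c (h9 p)
  have hDD : ∀ (c : K) (p : degreeLT K 10),
      ((twistedDerivative f c ∘ₗ twistedDerivative f c) p).natDegree ≤ 13 :=
    fun c p => natDegree_twistedDerivative_le hf c (hD c p)
  refine ⟨w, hw0, hco (N := 11) ?_ congr($hΦ.1), hco (N := 13) ?_ congr($hΦ.2.1),
    hco (N := 15) ?_ congr($hΦ.2.2)⟩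
  · exact Nat.lt_succ_of_le (natDegree_auxReduce_le h9 h9 w)
  · exact Nat.lt_succ_of_le (natDegree_auxReduce_le (hD 0) (hD c) w)
  · exact Nat.lt_succ_of_le (natDegree_auxReduce_le (hDD 0) (hDD c) w)

variable [Fintype K]

lemma eq_zero_of_X_pow_card_dvd {f : K[X]} (hf : f.natDegree = 3) (hf0 : f.eval 0 ≠ 0) {h : ℕ}
    (hh : Fintype.card K = 2 * h + 1) (hq : 21 < Fintype.card K) {r s : K[X]}
    (hr : r.natDegree ≤ 9) (hs : s.natDegree ≤ 9) (hd : X ^ Fintype.card K ∣ r + s * f ^ h) :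
    r = 0 ∧ s = 0 := by
  have hexp : X ^ Fintype.card K ∣ f ^ Fintype.card K - C (f.eval 0) := by
    rw [← FiniteField.expand_card f]
    refine ⟨expand K (Fintype.card K) f.divX, ?_⟩
    have e := congr(expand K (Fintype.card K) $(divX_mul_X_add f))
    rw [map_add, map_mul, expand_X, expand_C, coeff_zero_eq_eval_zero] at e
    linear_combination -e
  have hd2 : X ^ Fintype.card K ∣ f * r ^ 2 - C (f.eval 0) * s ^ 2 := by
    have e : f * r ^ 2 - C (f.eval 0) * s ^ 2 = (r + s * f ^ h) * (f * (r - s * f ^ h)) +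
        (f ^ Fintype.card K - C (f.eval 0)) * s ^ 2 := by
      rw [hh]
      ring
    rw [e]
    exact dvd_add (hd.mul_right _) (hexp.mul_right _)
  have hzero : f * r ^ 2 - C (f.eval 0) * s ^ 2 = 0 := by
    by_contra hne
    have h1 := natDegree_le_of_dvd hd2 hne
    rw [natDegree_X_pow] at h1
    have h2 : (f * r ^ 2 - C (f.eval 0) * s ^ 2).natDegree ≤ 21 := by
      refine (natDegree_sub_le _ _).trans (max_le (natDegree_mul_le.trans ?_)
        ((natDegree_C_mul_le _ _).trans ?_))
      · have := natDegree_pow_le_of_le 2 hr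
        omega
      · have := natDegree_pow_le_of_le 2 hs
        omega
    omega
  have hf' : f ≠ 0 := by rintro rfl; simp at hf
  have hr0 : r = 0 := by
    by_contra hr0
    have e := congr(natDegree $(sub_eq_zero.1 hzero))
    rw [natDegree_mul hf' (pow_ne_zero 2 hr0), natDegree_C_mul hf0, natDegree_pow, natDegree_pow,
      hf] at e
    omega
  refine ⟨hr0, ?_⟩
  rw [hr0] at hzero
  simpa [hf0] using hzero

/-- The auxiliary polynomial. -/
noncomputable def auxPoly (g : K[X]) (r₀ s₀ r₁ s₁ : K[X]) : K[X] :=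
  (r₀ + s₀ * g) + (r₁ + s₁ * g) * X ^ Fintype.card K

lemma mul_derivative_auxPoly (f : K[X]) (h : ℕ) (r₀ s₀ r₁ s₁ : K[X]) :
    f * derivative (auxPoly (f ^ h) r₀ s₀ r₁ s₁) =
      auxPoly (f ^ h) (twistedDerivative f 0 r₀) (twistedDerivative f h s₀)
        (twistedDerivative f 0 r₁) (twistedDerivative f h s₁) := by
  have hX : derivative (X ^ Fintype.card K : K[X]) = 0 := by
    rw [derivative_X_pow, Nat.cast_card_eq_zero, C_0, zero_mul]
  have hg : f * derivative (f ^ h) = C (h : K) * derivative f * f ^ h := by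
    cases h with
    | zero => simp
    | succ h => rw [derivative_pow, Nat.add_sub_cancel]; ring
  simp only [auxPoly, derivative_add, derivative_mul, hX, twistedDerivative_apply, C_0]
  linear_combination (s₀ + s₁ * X ^ Fintype.card K) * hg

lemma eval_auxPoly {g : K[X]} {x : K} (hx : g.eval x = -1) (r₀ s₀ r₁ s₁ : K[X]) :
    (auxPoly g r₀ s₀ r₁ s₁).eval x = ((r₀ - s₀) + X * (r₁ - s₁)).eval x := by
  simp only [auxPoly, eval_add, eval_mul, eval_sub, eval_X, eval_pow, hx, FiniteField.pow_card]
  ring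

/-- The number of `x` at which a cubic takes a non-square value is at most about `5 q / 6`. -/
theorem card_pow_eq_neg_one_le [DecidableEq K] {f : K[X]} (hf : f.natDegree = 3)
    (hf0 : f.eval 0 ≠ 0) {h : ℕ} (hh : Fintype.card K = 2 * h + 1) (hq : 21 < Fintype.card K)
    (h2 : (2 : K) ≠ 0) :
    6 * (Finset.univ.filter fun x : K => f.eval x ^ h = -1).card ≤ 5 * Fintype.card K + 15 := by
  obtain ⟨w, hw, a0, a1, a2⟩ := exists_aux hf.le (h : K)
  have h9 := natDegree_of_mem_degreeLT_ten (K := K)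
  rw [auxReduce_apply] at a0 a1 a2
  simp only [LinearMap.id_apply, LinearMap.comp_apply] at a0 a1 a2
  set V := auxPoly (f ^ h) (w 0) (w 1) (w 2) (w 3) with hV
  have hV0 : V ≠ 0 := by
    intro e
    apply hw
    have hd : X ^ Fintype.card K ∣ (w 0 : K[X]) + (w 1 : K[X]) * f ^ h :=
      ⟨-((w 2 : K[X]) + (w 3 : K[X]) * f ^ h), by rw [hV, auxPoly] at e; linear_combination e⟩
    obtain ⟨e0, e1⟩ := eq_zero_of_X_pow_card_dvd hf hf0 hh hq (h9 _) (h9 _) hd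
    rw [hV, auxPoly, e0, e1, zero_mul, add_zero, zero_add] at e
    have e' : (w 2 : K[X]) + (w 3 : K[X]) * f ^ h = 0 :=
      (mul_eq_zero.1 e).resolve_right (pow_ne_zero _ X_ne_zero)
    obtain ⟨e2, e3⟩ := eq_zero_of_X_pow_card_dvd hf hf0 hh hq (h9 _) (h9 _) (e' ▸ dvd_zero _)
    funext i
    apply Subtype.ext
    fin_cases i <;> assumption
  have hmult : ∀ x : K, f.eval x ^ h = -1 → 3 ≤ V.rootMultiplicity x := by
    intro x hx
    have hgx : (f ^ h).eval x = -1 := by rw [eval_pow, hx]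
    have hfx : f.eval x ≠ 0 := by
      intro e
      rw [e] at hx
      rcases Nat.eq_zero_or_pos h with rfl | hpos
      · omega
      · rw [zero_pow hpos.ne'] at hx
        simp at hx
    have r0 : V.eval x = 0 := by rw [hV, eval_auxPoly hgx, a0, eval_zero]
    have d1 := mul_derivative_auxPoly f h (w 0 : K[X]) (w 1) (w 2) (w 3)
    rw [← hV] at d1
    have r1 : (derivative V).eval x = 0 := by
      have e := congr(($d1).eval x)
      rw [eval_auxPoly hgx, a1, eval_zero, eval_mul] at e
      exact (mul_eq_zero.1 e).resolve_left hfx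
    have r2 : (derivative (derivative V)).eval x = 0 := by
      have d2 := mul_derivative_auxPoly f h (twistedDerivative f 0 (w 0 : K[X]))
        (twistedDerivative f h (w 1)) (twistedDerivative f 0 (w 2)) (twistedDerivative f h (w 3))
      rw [← d1] at d2
      have e := congr(($d2).eval x)
      rw [eval_auxPoly hgx, a2, eval_zero, derivative_mul] at e
      simp only [eval_mul, eval_add, r1, mul_zero, zero_add] at e
      exact (mul_eq_zero.1 ((mul_eq_zero.1 e).resolve_left hfx)).resolve_left hfx
    refine lt_rootMultiplicity_of_isRoot_iterate_derivative_of_mem_nonZeroDivisors hV0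
      (n := 2) (fun i hi => ?_) ?_
    · interval_cases i
      · exact r0
      · exact r1
      · exact r2
    · rw [mem_nonZeroDivisors_iff_ne_zero]
      simpa using h2
  have hdeg : V.natDegree ≤ 9 + 3 * h + Fintype.card K := by
    have hg : (f ^ h).natDegree ≤ 3 * h := by rw [natDegree_pow, hf, mul_comm]
    have hb : ∀ r s : degreeLT K 10, ((r : K[X]) + (s : K[X]) * f ^ h).natDegree ≤ 9 + 3 * h :=
      fun r s => natDegree_add_le_of_degree_le ((h9 r).trans (by omega))
        (natDegree_mul_le.trans (add_le_add (h9 s) hg))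
    refine natDegree_add_le_of_degree_le ((hb _ _).trans (by omega))
      (natDegree_mul_le.trans (add_le_add (hb _ _) ?_))
    rw [natDegree_X_pow]
  have hcount : 3 * (Finset.univ.filter fun x : K => f.eval x ^ h = -1).card ≤ V.natDegree := by
    calc 3 * (Finset.univ.filter fun x : K => f.eval x ^ h = -1).card
        = ∑ x ∈ Finset.univ.filter (fun x : K => f.eval x ^ h = -1), 3 := by
          rw [Finset.sum_const, smul_eq_mul, mul_comm]
      _ ≤ ∑ x ∈ Finset.univ.filter (fun x : K => f.eval x ^ h = -1), V.roots.count x := by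
          refine Finset.sum_le_sum fun x hx => ?_
          rw [count_roots]
          exact hmult x (Finset.mem_filter.1 hx).2
      _ ≤ ∑ x, V.roots.count x :=
          Finset.sum_le_sum_of_subset (Finset.filter_subset _ _)
      _ = V.roots.card := Multiset.sum_count_eq_card fun x _ => Finset.mem_univ x
      _ ≤ V.natDegree := card_roots' V
  omega

end Stepanov

/-! ### Counting points -/

namespace TwistedEdwards

variable {F : Type*} [Field F] (E : TwistedEdwards F) {K : Type*} [Field K] [Algebra F K]

instance [Finite K] : Finite (E.Point K) := by
  let g : E.Point K → (K × K) ⊕ K ⊕ K := fun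
    | .affine x y _ => .inl (x, y)
    | .inf₁ y _ => .inr (.inl y)
    | .inf₂ x _ => .inr (.inr x)
  refine Finite.of_injective g ?_
  rintro (_ | _ | _) (_ | _ | _) h <;> simp_all [g]

/-- The number of points is at most `2 (q + 1)`. -/
lemma card_point_le [Finite K] : Nat.card (E.Point K) ≤ 2 * (Nat.card K + 1) := by
  classical
  let g : (E.weierstrassK K).Point → Option K := fun
    | .zero => none
    | .some X _ _ => some X
  have := Fintype.ofFinite K
  have : Finite (E.weierstrassK K).Point := Finite.of_equiv _ E.pointEquiv
  have := Fintype.ofFinite (E.weierstrassK K).Point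
  rw [Nat.card_congr E.pointEquiv, Nat.card_eq_fintype_card, Nat.card_eq_fintype_card,
    ← Finset.card_univ, ← Fintype.card_option]
  refine (Finset.card_le_mul_card_image (f := g) Finset.univ 2 fun o _ => ?_).trans
    (Nat.mul_le_mul_left 2 (Finset.card_le_univ _))
  by_cases he : ((Finset.univ : Finset (E.weierstrassK K).Point).filter (g · = o)).Nonempty
  · obtain ⟨P, hP⟩ := he
    refine (Finset.card_le_card (t := {P, -P}) fun Q hQ => ?_).trans Finset.card_le_two
    rw [Finset.mem_filter] at hP hQ
    have hPQ : g Q = g P := hQ.2.trans hP.2.symm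
    rw [Finset.mem_insert, Finset.mem_singleton]
    rcases P with _ | ⟨X, Y, h⟩ <;> rcases Q with _ | ⟨X', Y', h'⟩
    · exact Or.inl rfl
    · simp [g] at hPQ
    · simp [g] at hPQ
    · obtain rfl : X' = X := by simpa [g] using hPQ
      rw [WeierstrassCurve.Affine.Point.neg_some]
      simp only [WeierstrassCurve.Affine.Point.some.injEq, true_and, negY_eq]
      rw [← sq_eq_sq_iff_eq_or_eq_neg, (E.nonsingular_iff _ _).1 h, (E.nonsingular_iff _ _).1 h']
  · rw [Finset.not_nonempty_iff_eq_empty.1 he]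
    simp

/-- The number of points is at least about `q / 6`. -/
lemma le_card_point [Finite K] (hK : 21 < Nat.card K) :
    Nat.card K ≤ 6 * Nat.card (E.Point K) + 15 := by
  classical
  have := Fintype.ofFinite K
  rw [Nat.card_eq_fintype_card] at hK ⊢
  have h2 := E.two_ne_zeroK K
  have hchar : ringChar K ≠ 2 := by
    intro e
    have := CharP.cast_eq_zero K (ringChar K)
    rw [e] at this
    exact h2 (by exact_mod_cast this)
  have hh : Fintype.card K = 2 * (Fintype.card K / 2) + 1 := by
    have := FiniteField.odd_card_of_char_ne_two hchar
    omega
  set h := Fintype.card K / 2 with hh'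
  set f := (E.weierstrassK K).cubic with hf
  have hdeg : f.natDegree = 3 := by
    rw [hf, cubic_eq]
    compute_degree!
  have hf0 : f ≠ 0 := by
    intro e
    rw [e, natDegree_zero] at hdeg
    omega
  obtain ⟨t, ht⟩ := exists_eval_ne_zero_of_natDegree_lt_card f hf0 (by
    rw [hdeg, Cardinal.mk_fintype]
    exact_mod_cast (by omega : 3 < Fintype.card K))
  have hcount := card_pow_eq_neg_one_le (f := f.comp (X + C t))
    (by rw [natDegree_comp, natDegree_X_add_C, hdeg]) (by simpa using ht) hh hK h2
  have hsq : ∀ x : K, (f.comp (X + C t)).eval x ^ h ≠ -1 →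
      ∃ Y, (E.weierstrassK K).Nonsingular (x + t) Y := by
    intro x hx
    have : IsSquare (f.eval (x + t)) := by
      by_cases h0 : f.eval (x + t) = 0
      · rw [h0]
        exact IsSquare.zero
      · refine (FiniteField.isSquare_iff hchar h0).2
          ((FiniteField.pow_dichotomy hchar h0).resolve_right ?_)
        simpa using hx
    obtain ⟨Y, hY⟩ := this
    refine ⟨Y, (E.nonsingular_iff _ _).2 ?_⟩
    rw [sq, ← hY, hf, cubic_eq]
    simp
  choose Y hY using hsq
  let g : {x : K // (f.comp (X + C t)).eval x ^ h ≠ -1} → E.Point K :=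
    fun x => E.pointEquiv.symm (.some (x + t) (Y x x.2) (hY x x.2))
  have hg : Function.Injective g := by
    intro x x' e
    have := E.pointEquiv.symm.injective e
    rw [WeierstrassCurve.Affine.Point.some.injEq] at this
    exact Subtype.ext (add_right_cancel this.1)
  have hle := Nat.card_le_card_of_injective g hg
  rw [Nat.card_eq_fintype_card, Fintype.card_subtype] at hle
  have hsum := Finset.card_filter_add_card_filter_not (s := (Finset.univ : Finset K))
    (fun x => (f.comp (X + C t)).eval x ^ h = -1)
  rw [Finset.card_univ] at hsum
  simp only [ne_eq] at hle
  omega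

variable [Fintype F]

lemma exists_eq_mapFun_of_frobenius_eq {P : E.Point K} (h : E.frobenius K P = P) :
    ∃ P' : E.Point F, E.mapFun (Algebra.ofId F K) P' = P := by
  have hinj := (algebraMap F K).injective
  rw [frobenius_apply] at h
  cases P with
  | affine x y hP =>
    obtain ⟨x, rfl⟩ := mem_range_algebraMap_of_frobenius_eq (Point.affine.inj h).1
    obtain ⟨y, rfl⟩ := mem_range_algebraMap_of_frobenius_eq (Point.affine.inj h).2
    refine ⟨.affine x y (hinj ?_), rfl⟩
    simpa [aK, dK] using hP
  | inf₁ y hP =>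
    obtain ⟨y, rfl⟩ := mem_range_algebraMap_of_frobenius_eq (Point.inf₁.inj h)
    refine ⟨.inf₁ y (hinj ?_), rfl⟩
    simpa [aK, dK] using hP
  | inf₂ x hP =>
    obtain ⟨x, rfl⟩ := mem_range_algebraMap_of_frobenius_eq (Point.inf₂.inj h)
    refine ⟨.inf₂ x (hinj ?_), rfl⟩
    simpa [aK, dK] using hP

variable [FiniteDimensional F K]

lemma frobenius_trace (P : E.Point K) : E.frobenius K (E.trace K P) = E.trace K P := by
  have e : E.trace K P =
      ∑ i ∈ Finset.range (Module.finrank F K), (E.frobenius K ^ i) P :=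
    AddMonoidHom.finsetSum_apply (fun i => (E.frobenius K ^ i : E.Point K →+ E.Point K)) _ P
  rw [e, map_sum]
  refine Eq.trans (Finset.sum_congr rfl fun i _ => ?_)
    (sum_range_succ_eq_of_periodic (f := fun i => (E.frobenius K ^ i) P) ?_)
  · rw [pow_succ']
    rfl
  · simp only [frobenius_pow_finrank, pow_zero]

lemma card_point_le_mul_card_traceZero :
    Nat.card (E.Point K) ≤ Nat.card (E.traceZero K) * (2 * (Fintype.card F + 1)) := by
  have : Finite K := Module.finite_of_finite F
  rw [← AddSubgroup.card_mul_index (E.traceZero K), traceZero, AddSubgroup.index_ker]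
  refine Nat.mul_le_mul_left _ ?_
  rw [← Nat.card_eq_fintype_card]
  refine le_trans ?_ (E.card_point_le (K := F))
  have hfix : ∀ P : (E.trace K).range, ∃ P' : E.Point F, E.mapFun (Algebra.ofId F K) P' = P := by
    rintro ⟨_, P, rfl⟩
    exact E.exists_eq_mapFun_of_frobenius_eq (E.frobenius_trace P)
  choose g hg using hfix
  refine Nat.card_le_card_of_injective g fun P Q e => Subtype.ext ?_
  rw [← hg P, ← hg Q, e]

/-- The trace zero subgroup has at least about `q ^ (n - 1)` elements. -/
theorem card_pow_le_card_traceZero {k : ℕ} (hn : Module.finrank F K = k + 1) :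
    Fintype.card F ^ k ≤ 48 * Nat.card (E.traceZero K) := by
  have : Finite K := Module.finite_of_finite F
  have hq : 1 < Fintype.card F := Fintype.one_lt_card
  have hpos : 0 < Nat.card (E.traceZero K) := Nat.card_pos
  have hK : Nat.card K = Fintype.card F ^ k * Fintype.card F := by
    rw [Module.natCard_eq_pow_finrank (K := F), hn, pow_succ, Nat.card_eq_fintype_card]
  by_cases h : 36 ≤ Nat.card K
  · have h1 := E.le_card_point (K := K) (by omega)
    have h2 := E.card_point_le_mul_card_traceZero (K := K)
    refine Nat.le_of_mul_le_mul_right (?_ : _ * Fintype.card F ≤ _ * Fintype.card F) (by omega)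
    rw [← hK]
    have h3 : Nat.card (E.traceZero K) ≤ Nat.card (E.traceZero K) * Fintype.card F :=
      Nat.le_mul_of_pos_right _ (by omega)
    have h4 : Nat.card K ≤ 24 * (Nat.card (E.traceZero K) * (Fintype.card F + 1)) := by
      rw [mul_left_comm] at h2
      omega
    rw [mul_add, mul_one] at h4
    rw [mul_assoc]
    omega
  · have : Fintype.card F ^ k ≤ Nat.card K := by
      rw [hK]
      exact Nat.le_mul_of_pos_right _ (by omega)
    omega

end TwistedEdwards

/-! ### The representation -/

namespace TwistedEdwards

section Representation

variable {F : Type*} [Field F] (E : TwistedEdwards F) {K : Type*} [Field K] [Algebra F K]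
  [Fintype F] [FiniteDimensional F K]

lemma traceDivisor_frobenius (P : E.Point K) :
    E.traceDivisor (E.frobenius K P) = E.traceDivisor P := by
  rw [traceDivisor, traceDivisor]
  congr 3
  refine Eq.trans (Finset.sum_congr rfl fun i _ => ?_)
    (sum_range_succ_eq_of_periodic (f := fun i => Finsupp.single (E.toProj
      (E.map (IsScalarTower.toAlgHom F K (AlgebraicClosure K)) ((E.frobenius K ^ i) P))) (1 : ℤ)) ?_)
  · rw [pow_succ]
    rfl
  · simp only [frobenius_pow_finrank, pow_zero]

lemma traceDivisor_frobenius_pow (P : E.Point K) (i : ℕ) :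
    E.traceDivisor ((E.frobenius K ^ i) P) = E.traceDivisor P := by
  induction i with
  | zero => rfl
  | succ i ih =>
    rw [pow_succ', AddMonoid.End.coe_mul, Function.comp_apply, traceDivisor_frobenius, ih]

/-- The divisor of a point of trace zero determines its Frobenius orbit. -/
theorem traceDivisor_eq_iff (hodd : Odd (Module.finrank F K)) (P : E.Point K) {Q : E.Point K}
    (hQ : Q ∈ E.traceZero K) : E.traceDivisor P = E.traceDivisor Q ↔
      ∃ i < Module.finrank F K, Q = (E.frobenius K ^ i) P := by
  classical
  constructor
  · intro h
    obtain ⟨x, y, hxy, rfl⟩ : ∃ x y h, Q = .affine x y h := by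
      by_cases h0 : Q = 0
      · exact ⟨_, _, _, h0.trans E.zero_eq⟩
      · obtain ⟨x, y, hxy, e, -⟩ := E.exists_affine_of_mem_traceZero hodd hQ h0
        exact ⟨x, y, hxy, e⟩
    set ι := IsScalarTower.toAlgHom F K (AlgebraicClosure K) with hι
    rw [traceDivisor, traceDivisor, sub_left_inj, sub_left_inj, add_left_inj] at h
    have hev := DFunLike.congr_fun h (E.toProj (E.map ι (.affine x y hxy)))
    rw [Finsupp.finsetSum_apply, Finsupp.finsetSum_apply] at hev
    have hpos : (0 : ℤ) < ∑ i ∈ Finset.range (Module.finrank F K),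
        (Finsupp.single (E.toProj (E.map ι ((E.frobenius K ^ i) (.affine x y hxy)))) (1 : ℤ))
          (E.toProj (E.map ι (.affine x y hxy))) := by
      refine Finset.sum_pos' (fun i _ => ?_) ⟨0, Finset.mem_range.2 hodd.pos, ?_⟩
      · rw [Finsupp.single_apply]
        split_ifs <;> simp
      · rw [pow_zero, AddMonoid.End.coe_one, id, Finsupp.single_eq_same]
        exact one_pos
    obtain ⟨i, hi, hne⟩ := Finset.exists_ne_zero_of_sum_ne_zero (hev.trans_ne hpos.ne')
    have e : E.toProj (E.map ι ((E.frobenius K ^ i) P)) = E.toProj (E.map ι (.affine x y hxy)) := by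
      by_contra hcon
      exact hne (Finsupp.single_eq_of_ne (Ne.symm hcon))
    refine ⟨i, Finset.mem_range.1 hi, ?_⟩
    have hinj : Function.Injective ι := ι.toRingHom.injective
    revert e
    rcases (E.frobenius K ^ i) P with ⟨x', y', h'⟩ | ⟨y', h'⟩ | ⟨x', h'⟩
    · intro e
      obtain ⟨e₁, e₂⟩ := ProjPoint.affine.inj e
      obtain rfl := hinj e₁
      obtain rfl := hinj e₂
      rfl
    · exact fun e => nomatch e
    · exact fun e => nomatch e
  · rintro ⟨i, -, rfl⟩
    exact (E.traceDivisor_frobenius_pow P i).symm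

/-- The representation of the points of trace zero by the coefficients of normalized
polynomials. -/
theorem exists_representation {m : ℕ} (hn : Module.finrank F K = 2 * m + 3) :
    ∃ R : E.traceZero K → (Fin (2 * m + 2) → F) × ZMod 2,
      (∀ P : E.traceZero K, ∃ r q₂ : F[X],
        E.div (linearInX K ((1 + X) * r) q₂) = E.traceDivisor (P : E.Point K) ∧
        r.natDegree ≤ m ∧ q₂.natDegree ≤ m + 1 ∧ q₂.Monic ∧
        (∀ i : Fin (2 * m + 2), (R P).1 i =
          if (i : ℕ) < m + 1 then r.coeff i else q₂.coeff (i - (m + 1))) ∧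
        q₂.coeff (m + 1) = ((R P).2.val : F)) ∧
      ∀ P Q : E.traceZero K, R P = R Q ↔
        E.traceDivisor (P : E.Point K) = E.traceDivisor (Q : E.Point K) := by
  have hex : ∀ D, (∃ P ∈ E.traceZero K, E.traceDivisor P = D) → ∃ r q₂ : F[X],
      E.div (linearInX K ((1 + X) * r) q₂) = D ∧
        r.natDegree ≤ m ∧ q₂.natDegree ≤ m + 1 ∧ q₂.Monic := by
    rintro _ ⟨P, hP, rfl⟩
    obtain ⟨r, q₂, h1, h2, h3, h4⟩ := E.exists_polynomial hn hP
    exact ⟨r, q₂, h1, h3, h2 ▸ le_max_right _ _, h4⟩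
  choose! r q₂ hdiv hr hq hmonic using hex
  have hP : ∀ P : E.traceZero K, ∃ Q ∈ E.traceZero K,
      E.traceDivisor Q = E.traceDivisor (P : E.Point K) := fun P => ⟨P, P.2, rfl⟩
  let R : E.traceZero K → (Fin (2 * m + 2) → F) × ZMod 2 := fun P =>
    (fun i => if (i : ℕ) < m + 1 then (r (E.traceDivisor (P : E.Point K))).coeff i
      else (q₂ (E.traceDivisor (P : E.Point K))).coeff (i - (m + 1)),
      if (q₂ (E.traceDivisor (P : E.Point K))).natDegree = m + 1 then 1 else 0)
  have htop : ∀ P : E.traceZero K,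
      (q₂ (E.traceDivisor (P : E.Point K))).coeff (m + 1) = ((R P).2.val : F) := by
    intro P
    simp only [R]
    split_ifs with h
    · rw [← h, (hmonic _ (hP P)).coeff_natDegree, ZMod.val_one, Nat.cast_one]
    · rw [coeff_eq_zero_of_natDegree_lt (lt_of_le_of_ne (hq _ (hP P)) h), ZMod.val_zero,
        Nat.cast_zero]
  refine ⟨R, fun P => ⟨_, _, hdiv _ (hP P), hr _ (hP P), hq _ (hP P), hmonic _ (hP P),
    fun i => rfl, htop P⟩, fun P Q => ⟨fun h => ?_, fun h => ?_⟩⟩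
  · have e₁ : r (E.traceDivisor (P : E.Point K)) = r (E.traceDivisor (Q : E.Point K)) := by
      ext i
      by_cases hi : i < m + 1
      · simpa [R, hi] using congr(($h).1 ⟨i, by omega⟩)
      · rw [coeff_eq_zero_of_natDegree_lt ((hr _ (hP P)).trans_lt (by omega)),
          coeff_eq_zero_of_natDegree_lt ((hr _ (hP Q)).trans_lt (by omega))]
    have e₂ : q₂ (E.traceDivisor (P : E.Point K)) = q₂ (E.traceDivisor (Q : E.Point K)) := by
      ext i
      rcases lt_trichotomy i (m + 1) with hi | rfl | hi
      · have hi' : ¬ m + 1 + i < m + 1 := by omega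
        simpa only [R, hi', if_false, Nat.add_sub_cancel_left] using
          congr(($h).1 ⟨m + 1 + i, by omega⟩)
      · rw [htop, htop, h]
      · rw [coeff_eq_zero_of_natDegree_lt ((hq _ (hP P)).trans_lt hi),
          coeff_eq_zero_of_natDegree_lt ((hq _ (hP Q)).trans_lt hi)]
    apply DFunLike.coe_injective
    rw [← hdiv _ (hP P), ← hdiv _ (hP Q), e₁, e₂]
  · simp only [R, h]

omit [FiniteDimensional F K] in
/-- A map on the trace zero subgroup whose fibres are the Frobenius orbits has fibres of at most
`n` elements. -/
lemma card_traceZero_le {S : Type*} [Finite S] (R : E.traceZero K → S)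
    (hR : ∀ P Q : E.traceZero K, R P = R Q →
      ∃ i < Module.finrank F K, (Q : E.Point K) = (E.frobenius K ^ i) (P : E.Point K)) :
    Nat.card (E.traceZero K) ≤ Module.finrank F K * Nat.card S := by
  have hR' : ∀ Q : E.traceZero K, ∃ i : Fin (Module.finrank F K), (Q : E.Point K) =
      (E.frobenius K ^ (i : ℕ)) (Function.surjInv (Set.rangeFactorization_surjective (f := R))
        (Set.rangeFactorization R Q) : E.traceZero K) := by
    intro Q
    obtain ⟨i, hi, h⟩ := hR _ Q
      congr(($(Function.surjInv_eq Set.rangeFactorization_surjective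
        (Set.rangeFactorization R Q))).1)
    exact ⟨⟨i, hi⟩, h⟩
  choose i hi using hR'
  have hinj : Function.Injective fun Q => (i Q, R Q) := by
    intro P Q h
    obtain ⟨h₁, h₂⟩ := Prod.mk.inj h
    have h₃ : Set.rangeFactorization R P = Set.rangeFactorization R Q := Subtype.ext h₂
    apply Subtype.ext
    rw [hi P, hi Q, h₁, h₃]
  simpa using Nat.card_le_card_of_injective _ hinj

end Representation

end TwistedEdwards

/-- If `q ^ k` and `t` agree up to constant factors, then so do their sizes in bits up to a
constant. -/
lemma abs_mul_clog_sub_clog_le {q k t n : ℕ} (hq : 1 < q) (hl : q ^ k ≤ 48 * t)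
    (hu : t ≤ n * (q ^ k * 2)) :
    |((k * Nat.clog 2 q + 1 : ℕ) : ℤ) - (Nat.clog 2 t : ℤ)| ≤ (k + 7 + Nat.clog 2 n : ℕ) := by
  have hc : 0 < Nat.clog 2 q := Nat.clog_pos one_lt_two hq
  have h1 : Nat.clog 2 t ≤ Nat.clog 2 n + (k * Nat.clog 2 q + 1) := by
    refine Nat.clog_le_of_le_pow (hu.trans ?_)
    rw [pow_add, pow_succ, mul_comm k, pow_mul]
    exact Nat.mul_le_mul (Nat.le_pow_clog one_lt_two n)
      (Nat.mul_le_mul_right 2 (Nat.pow_le_pow_left (Nat.le_pow_clog one_lt_two q) k))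
  have h2 : (Nat.clog 2 q - 1) * k ≤ 6 + Nat.clog 2 t := by
    refine (Nat.pow_le_pow_iff_right one_lt_two).1 ?_
    rw [pow_mul, pow_add]
    refine (Nat.pow_le_pow_left (Nat.pow_pred_clog_lt_self one_lt_two hq).le k).trans (hl.trans ?_)
    exact Nat.mul_le_mul (by norm_num) (Nat.le_pow_clog one_lt_two t)
  obtain ⟨c, hc'⟩ : ∃ c, Nat.clog 2 q = c + 1 := ⟨_, (Nat.succ_pred_eq_of_pos hc).symm⟩
  rw [hc'] at h1 h2 ⊢
  rw [Nat.add_sub_cancel, mul_comm] at h2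
  rw [mul_add, mul_one] at h1 ⊢
  rw [abs_le]
  push_cast
  omega

theorem mainTheorem1 (n : ℕ) (hn : n.Prime) (hodd : Odd n) :
    ∃ B : ℕ, ∀ (F : Type*) (K : Type*) [Field F] [Fintype F] [Field K] [Algebra F K]
      (E : TwistedEdwards F), Module.finrank F K = n →
      -- the polynomial attached to a point of trace zero
      (∀ P ∈ E.traceZero K, ∃ q₁ q₂ : F[X],
        E.div (TwistedEdwards.linearInX K q₁ q₂) = E.traceDivisor P ∧
        max q₁.natDegree q₂.natDegree = (n - 1) / 2 ∧
        (∃ r : F[X], q₁ = (1 + X) * r ∧ r.natDegree ≤ (n - 3) / 2) ∧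
        q₂ ≠ 0) ∧
      -- the representation by the coefficients of the normalized polynomial
      ∃ R : E.traceZero K → (Fin (n - 1) → F) × ZMod 2,
        (∀ P : E.traceZero K, ∃ r q₂ : F[X],
          E.div (TwistedEdwards.linearInX K ((1 + X) * r) q₂) = E.traceDivisor (P : E.Point K) ∧
          r.natDegree ≤ (n - 3) / 2 ∧ q₂.natDegree ≤ (n - 1) / 2 ∧ q₂.Monic ∧
          (∀ i : Fin (n - 1), (R P).1 i =
            if (i : ℕ) < (n - 1) / 2 then r.coeff i else q₂.coeff (i - (n - 1) / 2)) ∧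
          q₂.coeff ((n - 1) / 2) = ((R P).2.val : F)) ∧
        -- its fibres are the Frobenius orbits, so they have at most `n` elements
        (∀ P Q : E.traceZero K, R P = R Q ↔
          ∃ i < n, (Q : E.Point K) = (E.frobenius K ^ i) (P : E.Point K)) ∧
        -- it is optimal: its size in bits is `⌈log₂ |T_n|⌉ + O(1)`
        |(((n - 1) * Nat.clog 2 (Fintype.card F) + 1 : ℕ) : ℤ) -
          (Nat.clog 2 (Nat.card (E.traceZero K)) : ℤ)| ≤ B := by
  obtain ⟨m, rfl⟩ : ∃ m, n = 2 * m + 3 := by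
    obtain ⟨k, rfl⟩ := hodd
    have := hn.two_le
    exact ⟨k - 1, by omega⟩
  have e₁ : (2 * m + 3 - 1) / 2 = m + 1 := by omega
  have e₃ : (2 * m + 3 - 3) / 2 = m := by omega
  refine ⟨2 * m + 2 + 7 + Nat.clog 2 (2 * m + 3), ?_⟩
  intro F K _ _ _ _ E hfin
  rw [e₁, e₃]
  have : FiniteDimensional F K := FiniteDimensional.of_finrank_pos (by omega)
  refine ⟨fun P hP => ?_, ?_⟩
  · obtain ⟨r, q₂, h₁, h₂, h₃, h₄⟩ := E.exists_polynomial hfin hP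
    exact ⟨_, q₂, h₁, h₂, ⟨r, rfl, h₃⟩, h₄.ne_zero⟩
  · obtain ⟨R, hR, hfib⟩ := E.exists_representation hfin
    have horbit : ∀ P Q : E.traceZero K, R P = R Q ↔
        ∃ i < 2 * m + 3, (Q : E.Point K) = (E.frobenius K ^ i) (P : E.Point K) := by
      intro P Q
      rw [hfib, E.traceDivisor_eq_iff ⟨m + 1, by omega⟩ _ Q.2, hfin]
    refine ⟨R, hR, horbit, ?_⟩
    have hcard := E.card_traceZero_le R fun P Q h => hfin ▸ (horbit P Q).1 h
    rw [hfin, Nat.card_prod, Nat.card_fun, Nat.card_fin, Nat.card_zmod,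
      Nat.card_eq_fintype_card (α := F)] at hcard
    exact abs_mul_clog_sub_clog_le Fintype.one_lt_card (E.card_pow_le_card_traceZero hfin) hcard
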